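/- Let $e\ge 1$, let $\Gamma$ be the cyclic quiver of type $A^{(1)}_e$ with vertex set $I=\{0,1,\dots,e\}=\mathbb Z/(e+1)$ and edges $j\to j+1$, and fix $i\in I$. Let $\overline\Gamma$ (type $A^{(1)}_{e+1}$) be the quiver obtained by subdividing the edge $i\to i+1$: the vertices $j\le i$ keep their labels, the vertices $j>i$ are relabelled $j+1$, and the new vertex is $i+1$. Write $\overline{\jmath}$ for the new label of $j$. Let $\boldsymbol\lambda=(\lambda^{(1)},\dots,\lambda^{(\ell)})$ be an $\ell$-partition of $n$ and $\boldsymbol\rho\in I^\ell$. The residue of the node $(m,r,c)$ is $c-r+\rho_m\in I$. *Box definition.* For a partition $\lambda$ and $\rho\in I$, a strip is a sequence of nodes of $\lambda$ with residues alternating between $i$ and $i+1$, in which an $i$-node is followed by its right neighbour and an $(i+1)$-node by its lower neighbour. In every maximal strip whose first node has residue $i$, insert a box directly to the right of each $i$-node, pushing the rest of its row to the right; in every maximal strip whose first node has residue $i+1$, insert a box directly above each $i$-node, pushing that node and the rest of its column down. The resulting box configuration is $\lambda^+$. *Abacus definition.* For $0\le\rho\le e$ and an integer $N<0$ with $\rho-N(e+1)\ge\ell(\lambda)$,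 let $\mathrm{Ab}(\lambda,\rho)$ be the $(e+1)$-runner abacus with beads at the numbers $\lambda_j+\rho-j\geq N(e+1)$, $j\ge1$ (position $a(e+1)+b$, $0\le b\le e$, is on level $a$ of runner $b$). Let $N_0(\lambda,\rho)=\lfloor(\rho-\ell(\lambda))/(e+1)\rfloor$, the maximal admissible value of $N$, let $\rho'\in\{0,\dots,e\}$ be the residue of $\rho-i$, and let $k(\lambda)=\#\{j\ge1: j\equiv\rho-i \bmod (e+1),\ \lambda_{j+1}>0\}$. Insert a new runner between the runners $i-1$ and $i$ of $\mathrm{Ab}(\lambda,\rho)$ and put $k(\lambda)+N_0(\lambda,\rho)-N+\delta$ beads on it, on the levels $N,N+1,\dots$, where $\delta=1$ if the first empty position $\rho-\ell(\lambda)$ of $\mathrm{Ab}(\lambda,\rho)$ is on one of the runners $i,\dots,e$, and $\delta=0$ otherwise. The partition represented by this $(e+2)$-runner abacus is $\lambda_+$. Both definitions are extended to $\ell$-partitions componentwise. *Idempotent diagrams.* An idempotent diagram for a cyclic quiver with ghost shifts $\sigma$ on its edges consists of vertical solid strings with positions and residues, a ghost $j$-string at distance $\sigma_{j\to j+1}$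 to the right of each solid $j$-string, and red strings with positions and residues, such that no two strings coincide. Two such diagrams with the same ghost shifts and the same red strings are identified if one is obtained from the other by moving solid strings together with their ghosts without ever passing a solid string through a solid string of the same residue, a ghost $j$-string through a solid $(j+1)$-string, or a solid string through a red string of the same residue; that is, up to isotopy and those Reidemeister II moves that hold without correction in the KLRW algebra. Fix integers $\kappa_1<\dots<\kappa_\ell$. For the cyclic quiver with $p$ vertices, ghost shifts all $1$, red strings of residue $\rho_m$ at $\kappa_m$, and a small $\eta>0$ ($2n(\ell+np)\eta<1$), the diagram $1_{\boldsymbol\lambda}$ has one solid string for each node $(m,r,c)$, of the residue of that node, at position $\kappa_m+(c-r)-\frac{m}{\ell+np}-(c+r)\eta$. If the ghost shifts are not all $1$, then $c-r$ is replaced by the signed sum of the ghost shifts along the path of $c-r$ edges starting at $\rho_m$, and $\eta$ is taken small relative to the least ghost shift $\varepsilon\le 1$, namely $2n(\ell+np)\eta<\varepsilon$. *Subdivision.* In an idempotent diagram $Y$ for $\Gamma$ consider the maximal close tuples, i.e. the maximal sequences, alternating and with neighbours at distance at most $\delta_0$, of ghost $i$-strings and solid $(i+1)$-strings; a tuple starts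 with its rightmost string. The diagram $S_{t,\varepsilon}(Y)$ for $\overline\Gamma$ is obtained by relabelling residues by $j\mapsto\overline{\jmath}$ and adding, for each ghost $i$-string, a solid string of the new residue $i+1$ at distance $t$ to the left of it if its maximal close tuple starts with a ghost $i$-string, and at distance $t$ to the right of it if the tuple starts with a solid $(i+1)$-string; the ghosts of the added strings are at distance $\varepsilon$ to their right. Thus in $\overline\Gamma$ the edge starting in the new vertex has ghost shift $\varepsilon$ and all other edges have ghost shift $1$. **Proposition.** (1) $\boldsymbol\lambda^+$ is an $\ell$-partition and $\boldsymbol\lambda^+=\boldsymbol\lambda_+$, for every admissible choice of $N$ in each component. The same partition is obtained from each $\mathrm{Ab}(\lambda^{(m)},\rho_m')$ by adding a new leftmost runner with $k(\lambda^{(m)})+N_0(\lambda^{(m)},\rho_m')-N+1$ beads on the levels $N,N+1,\dots$. (2) Let $1_{\boldsymbol\lambda}$ be the diagram for $\Gamma$ (with $p=e+1$, unit ghost shifts, and $\eta$ as above), let $\eta\le\delta_0\le\frac1{2(\ell+n(e+1))}$, and let $t,\varepsilon>0$ satisfy $t\ne\varepsilon$ and $t+\varepsilon<\eta$. Let $1_{\boldsymbol\lambda^+}$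 be the diagram of $\boldsymbol\lambda^+$ for $\overline\Gamma$ (with $p=e+2$, the ghost shifts described above, red strings of residue $\overline{\rho_m}$ at $\kappa_m$, and a parameter small as above). Then $1_{\boldsymbol\lambda}$, $S_{t,\varepsilon}(1_{\boldsymbol\lambda})$ and $1_{\boldsymbol\lambda^+}$ are idempotent diagrams (no two strings coincide), and $$S_{t,\varepsilon}(1_{\boldsymbol\lambda})=1_{\boldsymbol\lambda^+}.$$ -/

import Mathlib

noncomputable section

namespace Subdiv

/-! ### Residues and the box definition of the subdivided partition

The quiver of type `A_e^{(1)}` has vertex set `ZMod (e + 1)` and one edge `j → j + 1` for each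
vertex `j`, so that edges are indexed by their sources.  Partitions are Young diagrams; nodes
`(r, c)` (row, column) are numbered from `0`. -/

/-- The residue of the node `A = (r, c)`, in the charge `ρ`, for the quiver with `p` vertices. -/
def res (p : ℕ) (ρ : ZMod p) (A : ℕ × ℕ) : ZMod p := (A.2 : ZMod p) - (A.1 : ZMod p) + ρ

/-- `B` may follow `A` in an `(i, i+1)`-strip: residues alternate between `i` and `i + 1`, hence
one steps to the right from an `i`-node and down from an `(i+1)`-node. -/
def StripNext (p : ℕ) (ρ i : ZMod p) (A B : ℕ × ℕ) : Prop :=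
  (res p ρ A = i ∧ B = (A.1, A.2 + 1)) ∨ (res p ρ A = i + 1 ∧ B = (A.1 + 1, A.2))

/-- The strips along the edge `i → i + 1`: `(i, i+1)`-strips, when the first node has residue `i`,
and `(i+1, i)`-strips, when the first node has residue `i + 1`. -/
def IsStrip (p : ℕ) (μ : YoungDiagram) (ρ i : ZMod p) (l : List (ℕ × ℕ)) : Prop :=
  l ≠ [] ∧ (∀ A ∈ l, A ∈ μ ∧ (res p ρ A = i ∨ res p ρ A = i + 1)) ∧ l.IsChain (StripNext p ρ i)

/-- A strip that cannot be completed to a larger one. -/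
def IsMaxStrip (p : ℕ) (μ : YoungDiagram) (ρ i : ZMod p) (l : List (ℕ × ℕ)) : Prop :=
  IsStrip p μ ρ i l ∧ ∀ l', IsStrip p μ ρ i l' → l <:+: l' → l = l'

/-- `B` is an `i`-node of a maximal strip whose starting residue is `k`. -/
def InStripFrom (p : ℕ) (μ : YoungDiagram) (ρ i k : ZMod p) (B : ℕ × ℕ) : Prop :=
  res p ρ B = i ∧ ∃ l, IsMaxStrip p μ ρ i l ∧ B ∈ l ∧ ∃ A, l.head? = some A ∧ res p ρ A = k

open Classical in
/-- The `i`-nodes of the maximal strips whose starting residue is `k`. -/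
def stripNodes (p : ℕ) (μ : YoungDiagram) (ρ i k : ZMod p) : Finset (ℕ × ℕ) :=
  μ.cells.filter (InStripFrom p μ ρ i k)

/-- The number of boxes inserted to the left of the node `A` in its row: one for each `i`-node of a
strip starting with residue `i`. -/
def shiftRight (p : ℕ) (μ : YoungDiagram) (ρ i : ZMod p) (A : ℕ × ℕ) : ℕ :=
  ((stripNodes p μ ρ i i).filter fun B => B.1 = A.1 ∧ B.2 < A.2).card

/-- The number of boxes inserted above the `i`-nodes lying strictly above `A` in its column: one
for each `i`-node of a strip starting with residue `i + 1`. -/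
def shiftDown (p : ℕ) (μ : YoungDiagram) (ρ i : ZMod p) (A : ℕ × ℕ) : ℕ :=
  ((stripNodes p μ ρ i (i + 1)).filter fun B => B.2 = A.2 ∧ B.1 < A.1).card

/-- The new place of a node of `μ`; an `i`-node of a strip starting with residue `i + 1` moves down
once more, since a box is inserted just above it. -/
def movedNode (p : ℕ) (μ : YoungDiagram) (ρ i : ZMod p) (A : ℕ × ℕ) : ℕ × ℕ :=
  (A.1 + shiftDown p μ ρ i A + (if A ∈ stripNodes p μ ρ i (i + 1) then 1 else 0),
    A.2 + shiftRight p μ ρ i A)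

/-- The box definition of `λ⁺` for the edge `i → i + 1`, as a set of boxes.  In every maximal strip
starting with residue `i`, a box (of the new residue) is inserted directly to the right of each
`i`-node, pushing the rest of the row to the right; in every maximal strip starting with residue
`i + 1`, a box is inserted directly above each `i`-node, pushing that node and the rest of the
column down. -/
def boxPlus (p : ℕ) (μ : YoungDiagram) (ρ i : ZMod p) : Finset (ℕ × ℕ) :=
  μ.cells.image (movedNode p μ ρ i) ∪
  (stripNodes p μ ρ i i).image
    (fun A => ((movedNode p μ ρ i A).1, (movedNode p μ ρ i A).2 + 1)) ∪
  (stripNodes p μ ρ i (i + 1)).image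
    (fun A => (A.1 + shiftDown p μ ρ i A, A.2 + shiftRight p μ ρ i A))

/-! ### Abacuses -/

/-- The number of (nonzero) rows. -/
def len (μ : YoungDiagram) : ℕ := μ.colLen 0

/-- The abacus with `p` runners of `(μ, ρ)`, truncated above level `N`, as its set of occupied
positions; position `a * p + b`, `0 ≤ b < p`, is on level `a` of runner `b`.  The beads are the
beta numbers `μ_j + ρ - j`, `j = 1, 2, …`. -/
def abacus (p : ℕ) (μ : YoungDiagram) (ρ N : ℤ) : Set ℤ :=
  {b | N * p ≤ b ∧ ∃ j : ℕ, b = (μ.rowLen j : ℤ) + ρ - ((j : ℤ) + 1)}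

/-- `ν` is the partition read off the abacus with `p` runners, top level `N`, and set of beads `B`
(for a suitable, uniquely determined, integer charge). -/
def Represents (p : ℕ) (N : ℤ) (B : Set ℤ) (ν : YoungDiagram) : Prop :=
  ∃ ρ' : ℤ, (len ν : ℤ) ≤ ρ' - N * p ∧ B = abacus p ν ρ' N

/-- The largest `N` with `ρ - N p ≥ ℓ(μ)`, i.e. the largest `N` such that all positions on levels
`< N` carry beads (`/` is the floor division). -/
def N0 (p : ℕ) (μ : YoungDiagram) (ρ : ℤ) : ℤ := (ρ - len μ) / (p : ℤ)

/-- `#{j ≥ 1 | j ≡ ρ mod p, μ_{j+1} > 0}`. -/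
def kCount (p : ℕ) (μ : YoungDiagram) (ρ : ℤ) : ℕ :=
  ((Finset.Ico 1 (len μ)).filter fun j : ℕ => (j : ℤ) ≡ ρ [ZMOD p]).card

/-- Insert a new runner into an abacus with `p` runners, as new runner number `i`, so between the
old runners `i - 1` and `i` (leftmost, if `i = 0`), and put `count` beads on it from level `N`
downwards. -/
def insertRunner (p i : ℕ) (N count : ℤ) (B : Set ℤ) : Set ℤ :=
  {b | ∃ a ∈ B, b = (a / (p : ℤ)) * ((p : ℤ) + 1) +
      (if a % (p : ℤ) < i then a % (p : ℤ) else a % (p : ℤ) + 1)} ∪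
  {b | ∃ j : ℤ, N ≤ j ∧ j < N + count ∧ b = j * ((p : ℤ) + 1) + i}

/-! ### Idempotent diagrams -/

/-- An idempotent diagram (vertical strings, no dots) for the cyclic quiver with `p` vertices:
the ghost shift of each edge `j → j + 1`, the positions and residues of the red strings, and the
positions and residues of the solid strings.  A solid `j`-string at `x` has its ghost `j`-string
at `x + shift j`. -/
structure IdemDiagram (p ℓ : ℕ) where
  shift : ZMod p → ℝ
  charge : Fin ℓ → ℝ
  red : Fin ℓ → ZMod p
  solid : Finset (ℝ × ZMod p)

/-- The ghost string of a solid string. -/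
def IdemDiagram.ghost {p ℓ : ℕ} (Y : IdemDiagram p ℓ) (s : ℝ × ZMod p) : ℝ := s.1 + Y.shift s.2

/-- The positions of the strings form a loading: red strings are ordered, and no two of the solid,
ghost and red strings coincide. -/
def IdemDiagram.IsLoading {p ℓ : ℕ} (Y : IdemDiagram p ℓ) : Prop :=
  (∀ j, Y.shift j ≠ 0) ∧ StrictMono Y.charge ∧
  (∀ s ∈ Y.solid, ∀ s' ∈ Y.solid, s.1 = s'.1 → s = s') ∧
  (∀ s ∈ Y.solid, ∀ s' ∈ Y.solid, Y.ghost s = Y.ghost s' → s = s') ∧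
  (∀ s ∈ Y.solid, ∀ s' ∈ Y.solid, Y.ghost s ≠ s'.1) ∧
  (∀ s ∈ Y.solid, ∀ m, s.1 ≠ Y.charge m ∧ Y.ghost s ≠ Y.charge m)

/-- Equality of idempotent diagrams, up to pulling strings.  The strings of `Y` can be moved to the
strings of `Z` (solid strings together with their ghosts, red strings fixed) such that no string is
pulled through one that blocks it.  The pairs that block each other are those for which the
Reidemeister II relation fails: two solid strings of the same residue, a ghost `j`-string and a
solid `(j+1)`-string, a red and a solid string of the same residue.  The trace of the motion and
its reverse are diagrams whose two composites are, by Reidemeister II, the two idempotents. -/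
def IdemDiagram.PullEq {p ℓ : ℕ} (Y Z : IdemDiagram p ℓ) : Prop :=
  Y.shift = Z.shift ∧ Y.charge = Z.charge ∧ Y.red = Z.red ∧
  ∃ (w : {s // s ∈ Y.solid} ≃ {s // s ∈ Z.solid}) (x : {s // s ∈ Y.solid} → ℝ → ℝ),
    (∀ a, (w a).1.2 = a.1.2) ∧
    (∀ a, Continuous (x a)) ∧ (∀ a, x a 0 = a.1.1) ∧ (∀ a, x a 1 = (w a).1.1) ∧
    ∀ u ∈ Set.Icc (0 : ℝ) 1,
      (∀ a b, a ≠ b → a.1.2 = b.1.2 → x a u ≠ x b u) ∧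
      (∀ a b, b.1.2 = a.1.2 + 1 → x a u + Y.shift a.1.2 ≠ x b u) ∧
      (∀ a m, Y.red m = a.1.2 → x a u ≠ Y.charge m)

/-- The sum of the ghost shifts along the path of `d` edges from the vertex `ρ` (with a minus sign,
and against the orientation, if `d < 0`).  It is `d` if all ghost shifts are `1`. -/
def pathShift {p : ℕ} (σ : ZMod p → ℝ) (ρ : ZMod p) (d : ℤ) : ℝ :=
  if 0 ≤ d then ∑ k ∈ Finset.range d.toNat, σ (ρ + (k : ZMod p))
  else - ∑ k ∈ Finset.range (-d).toNat, σ (ρ - ((k : ZMod p) + 1))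

/-- The number of nodes of an `ℓ`-partition. -/
def size {ℓ : ℕ} (Λ : Fin ℓ → YoungDiagram) : ℕ := ∑ m, (Λ m).card

/-- The number `ℓ + n p` for an `ℓ`-partition of `n` and the quiver with `p` vertices. -/
def hatLevel (p : ℕ) {ℓ : ℕ} (Λ : Fin ℓ → YoungDiagram) : ℕ := ℓ + size Λ * p

/-- The idempotent diagram of an `ℓ`-partition.  With components, rows and columns counted from
`1`, the node `(m, r, c)` gives a solid string at
`κ_m + (c - r) - m / (ℓ + n p) - (c + r) η` if all ghost shifts are `1`; in general `c - r` is
replaced by the corresponding sum of ghost shifts. -/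
def idem {p ℓ : ℕ} (σ : ZMod p → ℝ) (κ : Fin ℓ → ℤ) (ρ : Fin ℓ → ZMod p) (η : ℝ)
    (Λ : Fin ℓ → YoungDiagram) : IdemDiagram p ℓ where
  shift := σ
  charge := fun m => (κ m : ℝ)
  red := ρ
  solid := Finset.univ.biUnion fun m => (Λ m).cells.image fun A =>
    ((κ m : ℝ) + pathShift σ (ρ m) ((A.2 : ℤ) - (A.1 : ℤ))
        - ((m : ℝ) + 1) / (hatLevel p Λ : ℝ) - ((A.2 : ℝ) + (A.1 : ℝ) + 2) * η,
      res p (ρ m) A)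

/-! ### Subdivision of idempotent diagrams at the edge `i → i + 1` -/

/-- The vertex of the subdivided quiver that is put between `i` and `i + 1`. -/
def newVertex {e : ℕ} (i : ZMod (e + 1)) : ZMod (e + 2) := ((i.val + 1 : ℕ) : ZMod (e + 2))

/-- The relabelling of the old vertices: `0, …, i` are kept and `i + 1, …, e` are raised by `1`. -/
def relabel {e : ℕ} (i j : ZMod (e + 1)) : ZMod (e + 2) :=
  if j.val ≤ i.val then (j.val : ZMod (e + 2)) else ((j.val + 1 : ℕ) : ZMod (e + 2))

/-- The ghost shifts after subdivision: `ε` on the edge starting in the new vertex, the old ghost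
shifts on the edges starting in old vertices. -/
def subdivShift {e : ℕ} (i : ZMod (e + 1)) (ε : ℝ) (σ : ZMod (e + 1) → ℝ) (j : ZMod (e + 2)) : ℝ :=
  if j = newVertex i then ε
  else if j.val ≤ i.val then σ (j.val : ZMod (e + 1))
  else σ ((j.val - 1 : ℕ) : ZMod (e + 1))

/-- The two kinds of strings in a close tuple: ghost `i`-strings and solid `(i+1)`-strings. -/
inductive Kind
  | ghost
  | solid

/-- The ghost `i`-strings and solid `(i+1)`-strings of a diagram, with their positions. -/
def tupleStrings {p ℓ : ℕ} (Y : IdemDiagram p ℓ) (i : ZMod p) : Set (ℝ × Kind) :=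
  {a | (a.2 = Kind.ghost ∧ ∃ s ∈ Y.solid, s.2 = i ∧ a.1 = Y.ghost s) ∨
       (a.2 = Kind.solid ∧ (a.1, i + 1) ∈ Y.solid)}

/-- A close `(i, i+1)`-tuple, listed from left to right: ghost `i`-strings and solid
`(i+1)`-strings alternate, and neighbours are at distance at most `δ`. -/
def IsCloseTuple {p ℓ : ℕ} (Y : IdemDiagram p ℓ) (i : ZMod p) (δ : ℝ) (l : List (ℝ × Kind)) :
    Prop :=
  l ≠ [] ∧ (∀ a ∈ l, a ∈ tupleStrings Y i) ∧
    l.IsChain fun a b => a.2 ≠ b.2 ∧ a.1 < b.1 ∧ b.1 - a.1 ≤ δ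

/-- A close tuple that cannot be expanded. -/
def IsMaxCloseTuple {p ℓ : ℕ} (Y : IdemDiagram p ℓ) (i : ZMod p) (δ : ℝ) (l : List (ℝ × Kind)) :
    Prop :=
  IsCloseTuple Y i δ l ∧ ∀ l', IsCloseTuple Y i δ l' → l.Sublist l' → l = l'

/-- The ghost `i`-string of the solid string `s` is in a maximal close tuple that starts with a
string of kind `k`; a tuple starts with its rightmost string. -/
def InTupleFrom {p ℓ : ℕ} (Y : IdemDiagram p ℓ) (i : ZMod p) (δ : ℝ) (k : Kind) (s : ℝ × ZMod p) :
    Prop :=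
  s.2 = i ∧ ∃ l, IsMaxCloseTuple Y i δ l ∧ (Y.ghost s, Kind.ghost) ∈ l ∧
    ∃ x : ℝ, l.getLast? = some (x, k)

open Classical in
/-- The `(t, ε)`-subdivision of an idempotent diagram at the edge `i → i + 1`.  Old strings keep
their places and are relabelled.  For each ghost `i`-string a solid string of the new residue is
added, at distance `t` to the left of the ghost if its maximal close tuple starts with a ghost
`i`-string, and at distance `t` to the right if it starts with a solid `(i+1)`-string.  The added
solid strings have their ghosts `ε` to the right.  The number `δ` measures closeness. -/
def subdivide {e ℓ : ℕ} (i : ZMod (e + 1)) (δ t ε : ℝ) (Y : IdemDiagram (e + 1) ℓ) :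
    IdemDiagram (e + 2) ℓ where
  shift := subdivShift i ε Y.shift
  charge := Y.charge
  red := fun m => relabel i (Y.red m)
  solid := Y.solid.image (fun s => (s.1, relabel i s.2)) ∪
    (Y.solid.filter (InTupleFrom Y i δ Kind.ghost)).image
      (fun s => (Y.ghost s - t, newVertex i)) ∪
    (Y.solid.filter (InTupleFrom Y i δ Kind.solid)).image
      (fun s => (Y.ghost s + t, newVertex i))

end Subdiv

end

noncomputable section

set_option linter.unusedSectionVars false

namespace Subdiv

/-! ### Counting residues -/

/-! Put `p = e + 1` and let `a` in `[0, p)` be the residue of `i - ρ`, so that the `i`-nodes are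
those of content congruent to `a` modulo `p`. A node is determined by its content and its depth on
its diagonal. Subdivision doubles each diagonal of `i`-nodes: the diagonal of content `d` moves to
`newContent d`, and the inserted copy lies at `newContent d + 1`. So a box belongs to `λ⁺` exactly
if its image under `collapse`, which keeps the depth and undoes the doubling, belongs to `λ`
(`mem_boxPlus_iff`); as `collapse` is monotone, `λ⁺` is a partition. The two cases of the box rule
fit this picture because a maximal strip begins in the first row or in the first column, so that the
sign of the content decides between them (`inStripFrom_iff`).

A bead at `x` means that some row contains content `x` but not `x + 1`. If `x + 1` is an old
content, such rows of `λ⁺` and `λ` correspond (`mem_maya_plus_iff`). If `x + 1` is new, both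
contents collapse to the same one, and a row ends there exactly for `x < 0`
(`mem_maya_plus_iff_of_isNew`). These `x` form the new runner, and counting its beads gives the
abacus definition (`represents_insertRunner_iff`).

The strings of both diagrams are indexed by the boxes of `λ⁺`, and in both diagrams the string of a
box lies at the same integer, shifted by the same type of small corrections (`subdivPos`,
`plusPos`). Close tuples behave like strips (`inTupleFrom_iff`). The strings can be moved along
straight lines if every blocking pair has the same order at both ends (`sameSign`, `sameSign_red`).
The order is decided by integers and components, unless the contents in one component agree (a ghost
counting as one step to the right); then the heights `c + r` decide. The only tie, between a ghost
`i`-string and the string inserted for it, is broken by the side on which that string is inserted.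
-/

/-- The signed number of contents in `[0, d)` congruent to `b` modulo `q`. -/
def resCount (q : ℕ) (b d : ℤ) : ℤ := (d - b - 1) / (q : ℤ) + 1

theorem resCount_eq_iff {q : ℕ} (hq : 0 < q) {b d m : ℤ} :
    resCount q b d = m ↔ (q : ℤ) * (m - 1) ≤ d - b - 1 ∧ d - b - 1 < q * m := by
  have hq' : (0 : ℤ) < q := by exact_mod_cast hq
  have : resCount q b d = m ↔ (d - b - 1) / (q : ℤ) = m - 1 := by
    unfold resCount; constructor <;> intro h <;> linarith
  rw [this, Int.ediv_eq_iff_of_pos hq']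
  constructor <;> rintro ⟨h1, h2⟩ <;> constructor <;> nlinarith

theorem resCount_spec {q : ℕ} (hq : 0 < q) (b d : ℤ) :
    (q : ℤ) * (resCount q b d - 1) ≤ d - b - 1 ∧ d - b - 1 < q * resCount q b d :=
  (resCount_eq_iff hq).1 rfl

theorem resCount_succ {q : ℕ} (hq : 0 < q) (b d : ℤ) :
    resCount q b (d + 1) = resCount q b d + if (q : ℤ) ∣ d - b then 1 else 0 := by
  obtain ⟨h1, h2⟩ := resCount_spec hq b d
  rw [resCount_eq_iff hq]
  split_ifs with h
  · obtain ⟨k, hk⟩ := h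
    have hq' : (0 : ℤ) < q := by exact_mod_cast hq
    have h3 : resCount q b d ≤ k := by
      have : (q : ℤ) * (resCount q b d - 1) < q * k := by linarith
      have := lt_of_mul_lt_mul_left this hq'.le
      linarith
    have h4 : k ≤ resCount q b d := by
      have : (q : ℤ) * k < q * (resCount q b d + 1) := by linarith
      have := lt_of_mul_lt_mul_left this hq'.le
      linarith
    have h5 : k = resCount q b d := le_antisymm h4 h3
    rw [← h5]
    constructor <;> linarith
  · have h3 : d - b ≠ q * resCount q b d := fun h' => h ⟨_, h'⟩
    have h4 : d - b < q * resCount q b d := lt_of_le_of_ne (by linarith) h3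
    constructor <;> linarith

theorem resCount_zero {q : ℕ} {b : ℤ} (hb : 0 ≤ b) (hbq : b < q) : resCount q b 0 = 0 := by
  have hq : 0 < q := by omega
  rw [resCount_eq_iff hq]
  constructor <;> linarith

theorem resCount_mono {q : ℕ} (hq : 0 < q) (b : ℤ) : Monotone (resCount q b) := by
  refine monotone_int_of_le_succ fun d => ?_
  rw [resCount_succ hq]
  split_ifs <;> linarith

theorem resCount_sub_mono {q : ℕ} (hq : 0 < q) (b : ℤ) :
    Monotone fun d => d - resCount q b d := by
  refine monotone_int_of_le_succ fun d => ?_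
  rw [resCount_succ hq]
  split_ifs <;> linarith

theorem resCount_nonneg {q : ℕ} {b d : ℤ} (hb : 0 ≤ b) (hbq : b < q) (hd : 0 ≤ d) :
    0 ≤ resCount q b d := by
  rw [← resCount_zero hb hbq]
  exact resCount_mono (by omega) b hd

theorem resCount_nonpos {q : ℕ} {b d : ℤ} (hb : 0 ≤ b) (hbq : b < q) (hd : d ≤ 0) :
    resCount q b d ≤ 0 := by
  rw [← resCount_zero hb hbq]
  exact resCount_mono (by omega) b hd

/-- Members of one residue class are at least two apart because `q ≥ 2`. This is how `e ≥ 1` limits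
the number of `ε`-shifts to about half the content. -/
theorem two_mul_resCount_le {q : ℕ} {b d : ℤ} (hq : 2 ≤ q) (hb : 0 ≤ b) (hd : 0 ≤ d) :
    2 * resCount q b d ≤ d + 1 := by
  obtain ⟨h1, h2⟩ := resCount_spec (by omega : 0 < q) b d
  have hq' : (2 : ℤ) ≤ q := by exact_mod_cast hq
  by_cases h : 1 ≤ resCount q b d
  · nlinarith
  · linarith

theorem neg_two_mul_resCount_le {q : ℕ} {b d : ℤ} (hq : 2 ≤ q) (hbq : b < q) (hd : d ≤ 0) :
    - (2 * resCount q b d) ≤ - d + 1 := by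
  obtain ⟨h1, h2⟩ := resCount_spec (by omega : 0 < q) b d
  have hq' : (2 : ℤ) ≤ q := by exact_mod_cast hq
  by_cases h : resCount q b d ≤ -1
  · have : (q : ℤ) * (- resCount q b d - 1) ≤ - d - 1 := by nlinarith
    nlinarith
  · linarith

/-- The content, in the partition to be subdivided, of the diagonal that becomes (or is doubled by)
the diagonal of content `x`. -/
def oldContent (p : ℕ) (a x : ℤ) : ℤ := x - resCount (p + 1) a x

/-- The new content of the diagonal of content `d`. -/
def newContent (p : ℕ) (a d : ℤ) : ℤ := d + resCount p a d

/-- The new contents that belong to inserted boxes. -/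
def IsNew (p : ℕ) (a x : ℤ) : Prop := ((p : ℤ) + 1) ∣ x - a - 1

open Classical in
-- New contents are those congruent to `a + 1` modulo `p + 1`. The class `a + 1` counts them (with
-- sign) in `[0, x)`, the class `a` counts them in `(0, x]`, so only `x` itself makes a difference.
theorem resCount_isNew (p : ℕ) (a x : ℤ) :
    resCount (p + 1) (a + 1) x + (if IsNew p a x then 1 else 0) = resCount (p + 1) a x := by
  have h := resCount_succ (by omega : 0 < p + 1) a (x - 1)
  rw [sub_add_cancel] at h
  rw [h]
  have h1 : resCount (p + 1) (a + 1) x = resCount (p + 1) a (x - 1) := by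
    unfold resCount; congr 2; ring
  have h2 : IsNew p a x ↔ ((p + 1 : ℕ) : ℤ) ∣ x - 1 - a := by
    unfold IsNew; push_cast; rw [sub_right_comm]
  rw [h1]
  simp only [h2]

open Classical in
-- The old content stands still on entering a new content, which thus shares the old content of its
-- predecessor.
theorem oldContent_succ (p : ℕ) (a x : ℤ) :
    oldContent p a (x + 1) = oldContent p a x + 1 - if IsNew p a (x + 1) then 1 else 0 := by
  unfold oldContent
  rw [resCount_succ (by omega)]
  have h2 : IsNew p a (x + 1) ↔ ((p + 1 : ℕ) : ℤ) ∣ x - a := by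
    unfold IsNew; push_cast; rw [show x + 1 - a - 1 = x - a by ring]
  simp only [h2]
  ring

section
variable {p : ℕ} {a : ℤ}

theorem oldContent_zero (ha : 0 ≤ a) (hap : a < p) : oldContent p a 0 = 0 := by
  unfold oldContent
  rw [resCount_zero ha (by push_cast; linarith)]; simp

theorem oldContent_mono : Monotone (oldContent p a) := resCount_sub_mono (by omega) a

theorem oldContent_nonneg (ha : 0 ≤ a) (hap : a < p) {x : ℤ} (hx : 0 ≤ x) :
    0 ≤ oldContent p a x := by
  rw [← oldContent_zero ha hap]; exact oldContent_mono hx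

theorem le_newContent (ha : 0 ≤ a) (hap : a < p) {d : ℤ} (hd : 0 ≤ d) : d ≤ newContent p a d := by
  have := resCount_nonneg ha hap hd
  unfold newContent; linarith

theorem newContent_le (ha : 0 ≤ a) (hap : a < p) {d : ℤ} (hd : d ≤ 0) : newContent p a d ≤ d := by
  have := resCount_nonpos ha hap hd
  unfold newContent; linarith

theorem newContent_succ (hp : 0 < p) (d : ℤ) :
    newContent p a (d + 1) = newContent p a d + 1 + if (p : ℤ) ∣ d - a then 1 else 0 := by
  unfold newContent
  rw [resCount_succ hp]; ring

/-- One content is inserted per period, so periods of length `p` become periods of length `p + 1`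
and each content stays in its period. -/
theorem resCount_newContent (hp : 0 < p) (d : ℤ) :
    resCount (p + 1) a (newContent p a d) = resCount p a d := by
  obtain ⟨h1, h2⟩ := resCount_spec hp a d
  rw [resCount_eq_iff (by omega)]
  unfold newContent
  push_cast
  constructor <;> linarith

theorem oldContent_newContent (hp : 0 < p) (d : ℤ) : oldContent p a (newContent p a d) = d := by
  unfold oldContent
  rw [resCount_newContent hp]; unfold newContent; ring

/-- With `k = resCount p a d`, the number `newContent d - a - 1` lies strictly between `(p + 1)(k -
1)` and `(p + 1)k`. -/
theorem not_isNew_newContent (hp : 0 < p) (d : ℤ) : ¬ IsNew p a (newContent p a d) := by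
  rintro ⟨k, hk⟩
  obtain ⟨h1, h2⟩ := resCount_spec hp a d
  unfold newContent at hk
  have hp' : (0 : ℤ) < p + 1 := by positivity
  have h3 : resCount p a d - 1 < k := by
    have : ((p : ℤ) + 1) * (resCount p a d - 1) < (p + 1) * k := by linarith
    exact lt_of_mul_lt_mul_left this hp'.le
  have h4 : k < resCount p a d := by
    have : ((p : ℤ) + 1) * k < (p + 1) * (resCount p a d) := by linarith
    exact lt_of_mul_lt_mul_left this hp'.le
  linarith

theorem isNew_newContent_succ (hp : 0 < p) {d : ℤ} :
    IsNew p a (newContent p a d + 1) ↔ (p : ℤ) ∣ d - a := by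
  have h1 := oldContent_succ p a (newContent p a d)
  have hp' : (0 : ℤ) < p := by exact_mod_cast hp
  have h3 := resCount_newContent (a := a) hp d
  constructor
  · rintro ⟨k, hk⟩
    obtain ⟨h1, h2⟩ := resCount_spec hp a d
    unfold newContent at hk
    have h3 : resCount p a d ≤ k := by
      have : ((p : ℤ) + 1) * (resCount p a d - 1) < (p + 1) * k := by linarith
      have := lt_of_mul_lt_mul_left this (by linarith)
      linarith
    have h4 : k ≤ resCount p a d := by
      have : ((p : ℤ) + 1) * k < (p + 1) * (resCount p a d + 1) := by linarith
      have := lt_of_mul_lt_mul_left this (by linarith)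
      linarith
    have h5 : k = resCount p a d := le_antisymm h4 h3
    exact ⟨k, by rw [← h5] at hk; linarith⟩
  · rintro ⟨k, hk⟩
    have h5 : resCount p a d = k := by
      rw [resCount_eq_iff hp]; constructor <;> linarith
    refine ⟨k, ?_⟩
    unfold newContent
    rw [h5]; linarith

theorem oldContent_newContent_succ (hp : 0 < p) {d : ℤ} (hd : (p : ℤ) ∣ d - a) :
    oldContent p a (newContent p a d + 1) = d := by
  rw [oldContent_succ, if_pos ((isNew_newContent_succ hp).2 hd), oldContent_newContent hp]; ring

/-- Old contents are those of the form `newContent d`. -/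
theorem newContent_oldContent (hp : 0 < p) {x : ℤ} (hx : ¬ IsNew p a x) :
    newContent p a (oldContent p a x) = x := by
  obtain ⟨h1, h2⟩ := resCount_spec (by omega : 0 < p + 1) a x
  have h3 : x - a - 1 ≠ ((p : ℤ) + 1) * (resCount (p + 1) a x - 1) := fun h => hx ⟨_, h⟩
  push_cast at h1 h2
  have h4 := lt_of_le_of_ne h1 (Ne.symm h3)
  have h5 : resCount p a (oldContent p a x) = resCount (p + 1) a x := by
    rw [resCount_eq_iff hp]
    unfold oldContent
    constructor <;> linarith
  unfold newContent
  rw [h5]; unfold oldContent; ring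

/-- New contents are those of the form `newContent d + 1` with `d` congruent to `a`. -/
theorem dvd_oldContent_of_isNew (hp : 0 < p) {x : ℤ} (hx : IsNew p a x) :
    (p : ℤ) ∣ oldContent p a x - a ∧ newContent p a (oldContent p a x) + 1 = x := by
  obtain ⟨k, hk⟩ := hx
  have h1 : resCount (p + 1) a x = k + 1 := by
    rw [resCount_eq_iff (by omega)]; push_cast; constructor <;> linarith
  have h2 : oldContent p a x - a = p * k := by unfold oldContent; rw [h1]; linarith
  refine ⟨⟨k, h2⟩, ?_⟩
  have h3 : resCount p a (oldContent p a x) = k := by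
    rw [resCount_eq_iff hp]; constructor <;> linarith
  unfold newContent
  rw [h3]; linarith

end

/-! ### Nodes in terms of their diagonals -/

/-- The content of a node. -/
def content (A : ℕ × ℕ) : ℤ := (A.2 : ℤ) - A.1

/-- The number of nodes above a given node on its diagonal. -/
def depth (A : ℕ × ℕ) : ℕ := min A.1 A.2

/-- The node with a given depth and content. -/
def node (k : ℕ) (x : ℤ) : ℕ × ℕ := (k + (-x).toNat, k + x.toNat)

@[simp] theorem depth_node (k : ℕ) (x : ℤ) : depth (node k x) = k := by
  simp only [depth, node]; omega

@[simp] theorem content_node (k : ℕ) (x : ℤ) : content (node k x) = x := by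
  simp only [content, node]; omega

@[simp] theorem node_depth_content (A : ℕ × ℕ) : node (depth A) (content A) = A := by
  ext <;> simp only [content, depth, node] <;> omega

theorem node_eq_iff {k : ℕ} {x : ℤ} {A : ℕ × ℕ} : node k x = A ↔ k = depth A ∧ x = content A := by
  constructor
  · rintro rfl; simp
  · rintro ⟨rfl, rfl⟩; simp

theorem node_ext {A B : ℕ × ℕ} (h1 : depth A = depth B) (h2 : content A = content B) : A = B := by
  rw [← node_depth_content A, h1, h2, node_depth_content]

theorem add_eq_depth (A : ℕ × ℕ) : ((A.2 : ℤ) + A.1) = 2 * depth A + |content A| := by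
  simp only [content, depth]
  rcases le_total A.1 A.2 with h | h
  · rw [abs_of_nonneg (by omega)]; omega
  · rw [abs_of_nonpos (by omega)]; omega

/-- The node of the old partition from which a node of the subdivided partition arises. -/
def collapse (p : ℕ) (a : ℤ) (A : ℕ × ℕ) : ℕ × ℕ := node (depth A) (oldContent p a (content A))

/-- `oldContent` increases in steps of `0` or `1` and maps nonnegative contents to nonnegative ones
and nonpositive to nonpositive ones. Hence a step to the right or down becomes no move, the same
step, or a step along the diagonal. -/
theorem collapse_mono {p : ℕ} {a : ℤ} (ha : 0 ≤ a) (hap : a < p) : Monotone (collapse p a) := by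
  have key1 : ∀ r c : ℕ, collapse p a (r, c) ≤ collapse p a (r, c + 1) := by
    intro r c
    have h := oldContent_succ p a ((c : ℤ) - r)
    have h1 : oldContent p a ((c : ℤ) - r) ≤ oldContent p a ((c : ℤ) - r + 1) :=
      oldContent_mono (by omega)
    have h2 : oldContent p a ((c : ℤ) - r + 1) ≤ oldContent p a ((c : ℤ) - r) + 1 := by
      rw [h]; split_ifs <;> omega
    have h3 : 0 ≤ (c : ℤ) - r → 0 ≤ oldContent p a ((c : ℤ) - r) := oldContent_nonneg ha hap
    have e : ((c + 1 : ℕ) : ℤ) - r = (c : ℤ) - r + 1 := by push_cast; ring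
    have h4 : (c : ℤ) - r + 1 ≤ 0 → oldContent p a ((c : ℤ) - r + 1) ≤ 0 := by
      intro h; rw [← oldContent_zero ha hap]; exact oldContent_mono h
    simp only [collapse, content, depth, node, e]
    generalize oldContent p a ((c : ℤ) - r + 1) = y at *
    generalize oldContent p a ((c : ℤ) - r) = z at *
    constructor <;> simp only <;> omega
  have key2 : ∀ r c : ℕ, collapse p a (r, c) ≤ collapse p a (r + 1, c) := by
    intro r c
    have h := oldContent_succ p a ((c : ℤ) - r - 1)
    rw [sub_add_cancel] at h
    have h1 : oldContent p a ((c : ℤ) - r - 1) ≤ oldContent p a ((c : ℤ) - r) :=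
      oldContent_mono (by omega)
    have h2 : oldContent p a ((c : ℤ) - r) ≤ oldContent p a ((c : ℤ) - r - 1) + 1 := by
      rw [h]; split_ifs <;> omega
    have h3 : 0 ≤ (c : ℤ) - r - 1 → 0 ≤ oldContent p a ((c : ℤ) - r - 1) := oldContent_nonneg ha hap
    have e : (c : ℤ) - (r + 1 : ℕ) = (c : ℤ) - r - 1 := by push_cast; ring
    have h4 : (c : ℤ) - r ≤ 0 → oldContent p a ((c : ℤ) - r) ≤ 0 := by
      intro h; rw [← oldContent_zero ha hap]; exact oldContent_mono h
    simp only [collapse, content, depth, node, e]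
    generalize oldContent p a ((c : ℤ) - r - 1) = y at *
    generalize oldContent p a ((c : ℤ) - r) = z at *
    constructor <;> simp only <;> omega
  rintro ⟨r, c⟩ ⟨r', c'⟩ ⟨h1, h2⟩
  simp only at h1 h2
  exact (monotone_nat_of_le_succ (f := fun c => collapse p a (r, c)) (key1 r) h2).trans
    (monotone_nat_of_le_succ (f := fun r => collapse p a (r, c')) (fun r => key2 r c') h1)

/-! ### Residues -/

section
variable {p : ℕ} [NeZero p]

/-- The residue class of the contents of the `i`-nodes. -/
def offset (ρ i : ZMod p) : ℤ := ((i - ρ).val : ℤ)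

theorem offset_nonneg (ρ i : ZMod p) : 0 ≤ offset ρ i := Int.natCast_nonneg _

theorem offset_lt (ρ i : ZMod p) : offset ρ i < p := by
  unfold offset; exact_mod_cast ZMod.val_lt _

theorem offset_cast (ρ i : ZMod p) : ((offset ρ i : ℤ) : ZMod p) = i - ρ := by
  unfold offset; simp

theorem res_eq (ρ : ZMod p) (A : ℕ × ℕ) : res p ρ A = ((content A : ℤ) : ZMod p) + ρ := by
  simp [res, content]

theorem res_eq_iff {ρ i : ZMod p} {A : ℕ × ℕ} :
    res p ρ A = i ↔ (p : ℤ) ∣ content A - offset ρ i := by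
  rw [res_eq, ← ZMod.intCast_zmod_eq_zero_iff_dvd]
  push_cast
  rw [offset_cast]
  constructor <;> intro h
  · rw [← h]; ring
  · linear_combination h

/-! ### Strips -/

/-- Lengths are bounded, so extending must stop. The order `R` is left open because strips are
maximal for infixes, close tuples for sublists. -/
theorem exists_maximal_list {α : Type*} (S : List α → Prop) (R : List α → List α → Prop)
    (hrefl : ∀ l, R l l) (htrans : ∀ l l' l'', R l l' → R l' l'' → R l l'')
    (hR : ∀ l l', R l l' → l.Sublist l') (n : ℕ) (hn : ∀ l, S l → l.length ≤ n) :
    ∀ l₀, S l₀ → ∃ l, S l ∧ R l₀ l ∧ ∀ l', S l' → R l l' → l = l' := by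
  have : ∀ k : ℕ, ∀ l₀, S l₀ → n - l₀.length ≤ k →
      ∃ l, S l ∧ R l₀ l ∧ ∀ l', S l' → R l l' → l = l' := by
    intro k
    induction k with
    | zero =>
      intro l₀ h0 hk
      refine ⟨l₀, h0, hrefl _, fun l' h' hl' => (hR _ _ hl').eq_of_length_le ?_⟩
      have := hn _ h'; omega
    | succ k ih =>
      intro l₀ h0 hk
      by_cases h : ∀ l', S l' → R l₀ l' → l₀ = l'
      · exact ⟨l₀, h0, hrefl _, h⟩
      · push Not at h
        obtain ⟨l', h1, h2, h3⟩ := h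
        have h4 : l₀.length < l'.length := by
          by_contra hlt
          exact h3 ((hR _ _ h2).eq_of_length_le (by omega))
        obtain ⟨l, hl1, hl2, hl3⟩ := ih l' h1 (by have := hn _ h1; omega)
        exact ⟨l, hl1, htrans _ _ _ h2 hl2, hl3⟩
  exact fun l₀ h0 => this _ l₀ h0 le_rfl

theorem length_le_card_of_nodup {α : Type*} {l : List α} (s : Finset α)
    (hl : l.Nodup) (h : ∀ A ∈ l, A ∈ s) : l.length ≤ s.card := by
  classical
  rw [← List.toFinset_card_of_nodup hl]
  exact Finset.card_le_card fun A hA => h A (List.mem_toFinset.1 hA)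

/-- Each step of a strip raises `r + c` by one; so no node is repeated, which bounds the length by
the number of boxes. -/
theorem IsStrip.pairwise {μ : YoungDiagram} {ρ i : ZMod p} {l : List (ℕ × ℕ)}
    (hl : IsStrip p μ ρ i l) : l.Pairwise fun A B => A.1 + A.2 < B.1 + B.2 := by
  have : IsTrans (ℕ × ℕ) fun A B => A.1 + A.2 < B.1 + B.2 := ⟨fun _ _ _ h h' => h.trans h'⟩
  rw [← List.isChain_iff_pairwise]
  refine hl.2.2.imp ?_
  rintro A B (⟨-, rfl⟩ | ⟨-, rfl⟩) <;> simp only <;> omega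

theorem IsStrip.length_le {μ : YoungDiagram} {ρ i : ZMod p} {l : List (ℕ × ℕ)}
    (hl : IsStrip p μ ρ i l) : l.length ≤ μ.cells.card := by
  refine length_le_card_of_nodup _ ?_ fun A hA => (YoungDiagram.mem_cells _).2 (hl.2.1 A hA).1
  exact hl.pairwise.imp fun {A B} h h' => by rw [h'] at h; exact lt_irrefl _ h

open Classical in
/-- The content of the `i`-nodes in the strip of a node of residue `i` or `i + 1`. -/
def stripContent (ρ i : ZMod p) (A : ℕ × ℕ) : ℤ := content A - if res p ρ A = i then 0 else 1

/-- A step to the right raises the content by one and a step down lowers it, so a strip zigzags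
between two adjacent diagonals. -/
theorem IsStrip.stripContent_eq (hp : (1 : ZMod p) ≠ 0) {μ : YoungDiagram} {ρ i : ZMod p}
    {A : ℕ × ℕ} {l : List (ℕ × ℕ)} (hl : IsStrip p μ ρ i (A :: l)) :
    ∀ B ∈ A :: l, stripContent ρ i B = stripContent ρ i A := by
  have h : (A :: l).IsChain fun A B => stripContent ρ i A = stripContent ρ i B := by
    refine hl.2.2.imp ?_
    rintro A B (⟨h, rfl⟩ | ⟨h, rfl⟩)
    · have h' : res p ρ (A.1, A.2 + 1) ≠ i := by
        rw [← h]; simp only [res]; push_cast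
        intro h2; apply hp; linear_combination h2
      simp only [stripContent, h, if_true, h', if_false, content]; push_cast; ring
    · have h' : res p ρ (A.1 + 1, A.2) = i := by
        simp only [res] at h ⊢; push_cast; linear_combination h
      have h2 : res p ρ A ≠ i := by rw [h]; simpa using hp
      simp only [stripContent, h', if_true, h2, if_false, content]; push_cast; ring
  have : IsTrans (ℕ × ℕ) fun A B => stripContent ρ i A = stripContent ρ i B :=
    ⟨fun _ _ _ h h' => h.trans h'⟩
  rw [List.isChain_iff_pairwise, List.pairwise_cons] at h
  intro B hB
  rcases List.mem_cons.1 hB with rfl | hB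
  · rfl
  · exact (h.1 B hB).symm

/-- The only possible predecessor of an `i`-node is the box above it, that of an `(i+1)`-node the
box to its left. If such a box exists it is in `μ`, so the head of a maximal strip lies on the
border. -/
theorem IsMaxStrip.head_eq {μ : YoungDiagram} {ρ i : ZMod p}
    {A : ℕ × ℕ} {l : List (ℕ × ℕ)} (hl : IsMaxStrip p μ ρ i (A :: l)) :
    (res p ρ A = i → A.1 = 0) ∧ (res p ρ A = i + 1 → A.2 = 0) := by
  have key : ∀ B : ℕ × ℕ, B ≤ A → (res p ρ B = i ∨ res p ρ B = i + 1) → ¬ StripNext p ρ i B A := by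
    intro B hBA hres hnext
    have h := hl.2 (B :: A :: l) ⟨by simp, ?_, List.IsChain.cons_cons hnext hl.1.2.2⟩
      (List.suffix_cons B (A :: l)).isInfix
    · simpa using congrArg List.length h
    · intro C hC
      rcases List.mem_cons.1 hC with rfl | hC
      · exact ⟨μ.isLowerSet hBA (hl.1.2.1 A (by simp)).1, hres⟩
      · exact hl.1.2.1 C hC
  constructor
  · intro h
    by_contra h0
    obtain ⟨r, hr⟩ := Nat.exists_eq_succ_of_ne_zero h0
    have h' : res p ρ (r, A.2) = i + 1 := by
      rw [← h]; simp only [res, hr]; push_cast; ring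
    refine key (r, A.2) ⟨by simp only; omega, le_rfl⟩ (Or.inr h') (Or.inr ⟨h', ?_⟩)
    ext <;> simp [hr]
  · intro h
    by_contra h0
    obtain ⟨c, hc⟩ := Nat.exists_eq_succ_of_ne_zero h0
    have h' : res p ρ (A.1, c) = i := by
      simp only [res, hc] at h ⊢; push_cast at h; linear_combination h
    refine key (A.1, c) ⟨le_rfl, by simp only; omega⟩ (Or.inl h') (Or.inl ⟨h', ?_⟩)
    ext <;> simp [hc]

/-- Let `d` be the common content of the `i`-nodes. A head of residue `i` is in the first row and
has content `d ≥ 0`; a head of residue `i + 1` is in the first column and has content `d + 1 ≤ 0`.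
-/
theorem IsMaxStrip.head_res (hp : (1 : ZMod p) ≠ 0) {μ : YoungDiagram} {ρ i : ZMod p}
    {A B : ℕ × ℕ} {l : List (ℕ × ℕ)} (hl : IsMaxStrip p μ ρ i l) (hB : B ∈ l)
    (hBi : res p ρ B = i) (hA : l.head? = some A) :
    res p ρ A = if 0 ≤ content B then i else i + 1 := by
  obtain ⟨l, rfl⟩ : ∃ l', l = A :: l' := by
    cases l with
    | nil => simp at hA
    | cons C l => exact ⟨l, by simp at hA; rw [hA]⟩
  have h1 := hl.1.stripContent_eq hp B hB
  have h2 := hl.head_eq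
  unfold stripContent at h1
  rw [if_pos hBi] at h1
  rcases (hl.1.2.1 A (by simp)).2 with h | h
  · rw [if_pos h] at h1
    have := h2.1 h
    rw [if_pos, h]
    unfold content at *; omega
  · have h' : res p ρ A ≠ i := by rw [h]; simpa using hp
    rw [if_neg h'] at h1
    have := h2.2 h
    rw [if_neg, h]
    unfold content at *; omega

theorem inStripFrom_iff (hp : (1 : ZMod p) ≠ 0) {μ : YoungDiagram} {ρ i k : ZMod p} {B : ℕ × ℕ}
    (hB : B ∈ μ) :
    InStripFrom p μ ρ i k B ↔ res p ρ B = i ∧ k = if 0 ≤ content B then i else i + 1 := by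
  constructor
  · rintro ⟨h1, l, hl, hBl, A, hA, rfl⟩
    exact ⟨h1, hl.head_res hp hBl h1 hA⟩
  · rintro ⟨h1, h2⟩
    obtain ⟨l, hl1, hl2, hl3⟩ := exists_maximal_list (IsStrip p μ ρ i) (· <:+: ·)
      (fun l => List.infix_rfl) (fun _ _ _ => List.IsInfix.trans) (fun _ _ => List.IsInfix.sublist)
      _ (fun l => IsStrip.length_le) [B]
      ⟨by simp, by simpa using ⟨hB, Or.inl h1⟩, List.isChain_singleton _⟩
    have hBl : B ∈ l := hl2.subset (by simp)
    obtain ⟨A, hA⟩ : ∃ A, l.head? = some A := by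
      cases l with
      | nil => simp at hBl
      | cons C l => exact ⟨C, rfl⟩
    exact ⟨h1, l, ⟨hl1, hl3⟩, hBl, A, hA, by rw [IsMaxStrip.head_res hp ⟨hl1, hl3⟩ hBl h1 hA, h2]⟩

theorem mem_stripNodes (hp : (1 : ZMod p) ≠ 0) {μ : YoungDiagram} {ρ i : ZMod p} {B : ℕ × ℕ} :
    B ∈ stripNodes p μ ρ i i ↔ B ∈ μ ∧ (p : ℤ) ∣ content B - offset ρ i ∧ 0 ≤ content B := by
  simp only [stripNodes, Finset.mem_filter, YoungDiagram.mem_cells]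
  refine and_congr_right fun hB => ?_
  rw [inStripFrom_iff hp hB, ← res_eq_iff]
  refine and_congr_right fun _ => ?_
  split_ifs with h <;> simp [h, hp]

theorem mem_stripNodes_succ (hp : (1 : ZMod p) ≠ 0) {μ : YoungDiagram} {ρ i : ZMod p} {B : ℕ × ℕ} :
    B ∈ stripNodes p μ ρ i (i + 1) ↔
      B ∈ μ ∧ (p : ℤ) ∣ content B - offset ρ i ∧ content B < 0 := by
  simp only [stripNodes, Finset.mem_filter, YoungDiagram.mem_cells]
  refine and_congr_right fun hB => ?_
  rw [inStripFrom_iff hp hB, ← res_eq_iff]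
  refine and_congr_right fun _ => ?_
  split_ifs with h
  · simp [hp, h]
  · simpa using h

/-! ### The box definition -/

open Classical in
theorem card_filter_range_dvd {p : ℕ} {a : ℤ} (ha : 0 ≤ a) (hap : a < p) (n : ℕ) :
    (((Finset.range n).filter fun j : ℕ => (p : ℤ) ∣ j - a).card : ℤ) = resCount p a n := by
  induction n with
  | zero => simp [resCount_zero ha hap]
  | succ n ih =>
    rw [Finset.range_add_one, Finset.filter_insert]
    push_cast
    rw [resCount_succ (by omega), ← ih]
    split_ifs with h
    · rw [Finset.card_insert_of_notMem (by simp)]; push_cast; rfl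
    · simp

open Classical in
theorem card_filter_range_dvd_neg {p : ℕ} {a : ℤ} (ha : 0 ≤ a) (hap : a < p) (n : ℕ) :
    (((Finset.range n).filter fun j : ℕ => (p : ℤ) ∣ -((j : ℤ) + 1) - a).card : ℤ)
      = - resCount p a (-n) := by
  induction n with
  | zero => simp [resCount_zero ha hap]
  | succ n ih =>
    rw [Finset.range_add_one, Finset.filter_insert]
    have h := resCount_succ (by omega : 0 < p) a (-((n : ℤ) + 1))
    rw [show -((n : ℤ) + 1) + 1 = - n by ring] at h
    rw [h] at ih
    push_cast
    split_ifs with h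
    · rw [Finset.card_insert_of_notMem (by simp)]; push_cast; rw [ih, if_pos h]; ring
    · rw [ih, if_neg h]; ring

/-- The strip nodes counted are those boxes of the row that have contents `0, …, content A - 1` in
the class of `offset ρ i`. -/
theorem shiftRight_eq (hp : (1 : ZMod p) ≠ 0) {μ : YoungDiagram} {ρ i : ZMod p} {A : ℕ × ℕ}
    (hA : A ∈ μ) :
    (shiftRight p μ ρ i A : ℤ)
      = if 0 ≤ content A then resCount p (offset ρ i) (content A) else 0 := by
  classical
  unfold shiftRight
  split_ifs with h
  · have e : content A = ((A.2 - A.1 : ℕ) : ℤ) := by unfold content at *; omega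
    rw [e, ← card_filter_range_dvd (offset_nonneg ρ i) (offset_lt ρ i)]
    congr 1
    symm
    refine Finset.card_bij (fun j _ => (A.1, A.1 + j)) ?_ ?_ ?_
    · intro j hj
      simp only [Finset.mem_filter, Finset.mem_range] at hj
      simp only [Finset.mem_filter, mem_stripNodes hp, content]
      refine ⟨⟨μ.isLowerSet (a := A) ⟨le_rfl, ?_⟩ hA, ?_, ?_⟩, trivial, ?_⟩
      · simp only; omega
      · convert hj.2 using 2; push_cast; ring
      · omega
      · omega
    · intro j _ j' _ h; simpa using h
    · rintro ⟨r, c⟩ hB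
      simp only [Finset.mem_filter, mem_stripNodes hp, content] at hB
      obtain ⟨⟨h1, h2, h3⟩, rfl, h4⟩ := hB
      refine ⟨c - A.1, ?_, by ext <;> simp only <;> omega⟩
      simp only [Finset.mem_filter, Finset.mem_range]
      refine ⟨by omega, ?_⟩
      convert h2 using 2; omega
  · rw [Nat.cast_eq_zero, Finset.card_eq_zero, Finset.filter_eq_empty_iff]
    rintro ⟨r, c⟩ hB ⟨h1, h2⟩
    rw [mem_stripNodes hp] at hB
    unfold content at *; simp only at *; omega

/-- The strip nodes counted have contents from `content A + 1` to `-1`. The box `A` is not among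
them; `movedNode` adds its contribution separately. -/
theorem shiftDown_eq (hp : (1 : ZMod p) ≠ 0) {μ : YoungDiagram} {ρ i : ZMod p} {A : ℕ × ℕ}
    (hA : A ∈ μ) :
    (shiftDown p μ ρ i A : ℤ)
      = if 0 ≤ content A then 0 else - resCount p (offset ρ i) (content A + 1) := by
  classical
  unfold shiftDown
  split_ifs with h
  · rw [Nat.cast_eq_zero, Finset.card_eq_zero, Finset.filter_eq_empty_iff]
    rintro ⟨r, c⟩ hB ⟨h1, h2⟩
    rw [mem_stripNodes_succ hp] at hB
    unfold content at *; simp only at *; omega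
  · have e : content A + 1 = -((A.1 - A.2 - 1 : ℕ) : ℤ) := by unfold content at *; omega
    rw [e, ← card_filter_range_dvd_neg (offset_nonneg ρ i) (offset_lt ρ i)]
    congr 1
    symm
    refine Finset.card_bij (fun j _ => (A.2 + j + 1, A.2)) ?_ ?_ ?_
    · intro j hj
      simp only [Finset.mem_filter, Finset.mem_range] at hj
      simp only [Finset.mem_filter, mem_stripNodes_succ hp, content]
      refine ⟨⟨μ.isLowerSet (a := A) ⟨?_, le_rfl⟩ hA, ?_, ?_⟩, trivial, ?_⟩
      · simp only; omega
      · convert hj.2 using 2; push_cast; ring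
      · omega
      · omega
    · intro j _ j' _ h; simpa using h
    · rintro ⟨r, c⟩ hB
      simp only [Finset.mem_filter, mem_stripNodes_succ hp, content] at hB
      obtain ⟨⟨h1, h2, h3⟩, rfl, h4⟩ := hB
      refine ⟨r - A.2 - 1, ?_, by ext <;> simp only <;> omega⟩
      simp only [Finset.mem_filter, Finset.mem_range]
      refine ⟨by omega, ?_⟩
      convert h2 using 2; omega

/-- On and above the main diagonal only the column changes, below it only the row. So the depth is
kept, and the shift is the number of class members passed on the way from content `0`. -/
theorem movedNode_eq (hp : (1 : ZMod p) ≠ 0) {μ : YoungDiagram} {ρ i : ZMod p} {A : ℕ × ℕ}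
    (hA : A ∈ μ) :
    movedNode p μ ρ i A = node (depth A) (newContent p (offset ρ i) (content A)) := by
  have h1 := shiftRight_eq hp (ρ := ρ) (i := i) hA
  have h2 := shiftDown_eq hp (ρ := ρ) (i := i) hA
  have h3 := mem_stripNodes_succ hp (ρ := ρ) (i := i) (μ := μ) (B := A)
  have hpp : 0 < p := Nat.pos_of_ne_zero (NeZero.ne p)
  have h4 := resCount_succ hpp (offset ρ i) (content A)
  unfold movedNode node newContent
  split_ifs at h1 h2 with h
  · have h6 := resCount_nonneg (offset_nonneg ρ i) (offset_lt ρ i) h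
    rw [if_neg (fun h' => by have := (h3.1 h').2.2; omega)]
    ext <;> simp only [depth] <;> unfold content at * <;> omega
  · have h6 := resCount_nonpos (offset_nonneg ρ i) (offset_lt ρ i) (by omega : content A ≤ 0)
    by_cases h5 : (p : ℤ) ∣ content A - offset ρ i
    · rw [if_pos (h3.2 ⟨hA, h5, by omega⟩)]
      rw [if_pos h5] at h4
      rw [h4] at h2
      ext <;> simp only [depth] <;> unfold content at * <;> omega
    · rw [if_neg (fun h' => h5 (h3.1 h').2.1)]
      rw [if_neg h5] at h4
      rw [h4] at h2
      ext <;> simp only [depth] <;> unfold content at * <;> omega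

/-- Inserting to the right for nonnegative content and inserting above for negative content have the
same effect: a box of the same depth whose content follows that of the moved node. Both rules
therefore double a diagonal. -/
theorem mem_boxPlus_iff (hp : (1 : ZMod p) ≠ 0) {μ : YoungDiagram} {ρ i : ZMod p} {A : ℕ × ℕ} :
    A ∈ boxPlus p μ ρ i ↔ collapse p (offset ρ i) A ∈ μ := by
  have hpp : 0 < p := Nat.pos_of_ne_zero (NeZero.ne p)
  have ha := offset_nonneg ρ i
  have hap := offset_lt ρ i
  have new1 : ∀ B ∈ stripNodes p μ ρ i i,
      ((movedNode p μ ρ i B).1, (movedNode p μ ρ i B).2 + 1)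
        = node (depth B) (newContent p (offset ρ i) (content B) + 1) := by
    intro B hB
    rw [mem_stripNodes hp] at hB
    rw [movedNode_eq hp hB.1]
    have := le_newContent ha hap hB.2.2
    ext <;> simp only [node] <;> omega
  have new2 : ∀ B ∈ stripNodes p μ ρ i (i + 1),
      (B.1 + shiftDown p μ ρ i B, B.2 + shiftRight p μ ρ i B)
        = node (depth B) (newContent p (offset ρ i) (content B) + 1) := by
    intro B hB
    have h0 := movedNode_eq hp ((mem_stripNodes_succ hp).1 hB).1 (ρ := ρ) (i := i)
    unfold movedNode at h0
    rw [if_pos hB] at h0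
    rw [mem_stripNodes_succ hp] at hB
    have := newContent_succ hpp (content B) (a := offset ρ i)
    rw [if_pos hB.2.1] at this
    -- The left side is `newContent (content B) + 2`, so the inserted box stays strictly below the
    -- main diagonal, where the depth is the column.
    have h5 : newContent p (offset ρ i) (content B + 1) ≤ content B + 1 :=
      newContent_le ha hap (by omega)
    have h1 := congrArg Prod.fst h0
    have h2 := congrArg Prod.snd h0
    simp only [node] at h1 h2
    ext <;> simp only [node] <;> omega
  simp only [boxPlus, Finset.mem_union, Finset.mem_image, YoungDiagram.mem_cells]
  constructor
  · rintro ((⟨B, hB, rfl⟩ | ⟨B, hB, rfl⟩) | ⟨B, hB, rfl⟩)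
    · rw [movedNode_eq hp hB]
      simp only [collapse, depth_node, content_node, oldContent_newContent hpp, node_depth_content]
      exact hB
    · rw [new1 B hB]
      rw [mem_stripNodes hp] at hB
      simp only [collapse, depth_node, content_node, oldContent_newContent_succ hpp hB.2.1,
        node_depth_content]
      exact hB.1
    · rw [new2 B hB]
      rw [mem_stripNodes_succ hp] at hB
      simp only [collapse, depth_node, content_node, oldContent_newContent_succ hpp hB.2.1,
        node_depth_content]
      exact hB.1
  · intro h
    by_cases hn : IsNew p (offset ρ i) (content A)
    · obtain ⟨h1, h2⟩ := dvd_oldContent_of_isNew hpp hn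
      rcases lt_or_ge (oldContent p (offset ρ i) (content A)) 0 with h3 | h3
      · right
        have hB : collapse p (offset ρ i) A ∈ stripNodes p μ ρ i (i + 1) := by
          rw [mem_stripNodes_succ hp]; exact ⟨h, by simpa [collapse] using h1, by simpa [collapse]⟩
        refine ⟨_, hB, ?_⟩
        rw [new2 _ hB, node_eq_iff]
        simpa [collapse] using h2
      · left; right
        have hB : collapse p (offset ρ i) A ∈ stripNodes p μ ρ i i := by
          rw [mem_stripNodes hp]; exact ⟨h, by simpa [collapse] using h1, by simpa [collapse]⟩
        refine ⟨_, hB, ?_⟩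
        rw [new1 _ hB, node_eq_iff]
        simpa [collapse] using h2
    · left; left
      refine ⟨_, h, ?_⟩
      rw [movedNode_eq hp h, node_eq_iff]
      simpa [collapse] using newContent_oldContent hpp hn

/-- The subdivided partition. -/
def plus (p : ℕ) [NeZero p] (hp : (1 : ZMod p) ≠ 0) (μ : YoungDiagram) (ρ i : ZMod p) :
    YoungDiagram where
  cells := boxPlus p μ ρ i
  isLowerSet := by
    intro A B hBA hA
    rw [Finset.mem_coe, mem_boxPlus_iff hp] at *
    exact μ.isLowerSet (collapse_mono (offset_nonneg ρ i) (offset_lt ρ i) hBA) hA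

theorem mem_plus_iff (hp : (1 : ZMod p) ≠ 0) {μ : YoungDiagram} {ρ i : ZMod p} {A : ℕ × ℕ} :
    A ∈ plus p hp μ ρ i ↔ collapse p (offset ρ i) A ∈ μ :=
  mem_boxPlus_iff hp

/-- Each box causes at most one insertion, since the two families of strip nodes are separated by
the sign of the content. -/
theorem card_plus_le (hp : (1 : ZMod p) ≠ 0) (μ : YoungDiagram) (ρ i : ZMod p) :
    (plus p hp μ ρ i).card ≤ 2 * μ.card := by
  classical
  have h1 : (stripNodes p μ ρ i i).card + (stripNodes p μ ρ i (i + 1)).card ≤ μ.cells.card := by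
    rw [← Finset.card_union_of_disjoint]
    · refine Finset.card_le_card (Finset.union_subset ?_ ?_) <;> exact Finset.filter_subset _ _
    · rw [Finset.disjoint_left]
      intro A h h'
      rw [mem_stripNodes hp] at h
      rw [mem_stripNodes_succ hp] at h'
      omega
  have h2 : (plus p hp μ ρ i).card ≤ (μ.cells.card + (stripNodes p μ ρ i i).card)
      + (stripNodes p μ ρ i (i + 1)).card := by
    refine (Finset.card_union_le _ _).trans (add_le_add ((Finset.card_union_le _ _).trans
      (add_le_add ?_ ?_)) ?_) <;> exact Finset.card_image_le
  unfold YoungDiagram.card at *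
  omega

end

/-! ### Bead sets -/

/-- The beta numbers of a partition, in charge `0`. -/
def maya (μ : YoungDiagram) : Set ℤ := {x | ∃ r : ℕ, x = (μ.rowLen r : ℤ) - ((r : ℤ) + 1)}

theorem mem_abacus_iff {p : ℕ} {μ : YoungDiagram} {R N b : ℤ} :
    b ∈ abacus p μ R N ↔ N * p ≤ b ∧ b - R ∈ maya μ := by
  simp only [abacus, maya, Set.mem_ofPred_eq]
  refine and_congr_right fun _ => exists_congr fun r => ?_
  constructor <;> intro h <;> linarith

theorem rowLen_eq_zero_iff {μ : YoungDiagram} {r : ℕ} : μ.rowLen r = 0 ↔ len μ ≤ r := by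
  have h1 := YoungDiagram.mem_iff_lt_rowLen (μ := μ) (i := r) (j := 0)
  have h2 := YoungDiagram.mem_iff_lt_colLen (μ := μ) (i := r) (j := 0)
  unfold len
  rw [h1] at h2
  omega

theorem mem_maya_of_lt {μ : YoungDiagram} {x : ℤ} (h : x < - len μ) : x ∈ maya μ := by
  refine ⟨(-x - 1).toNat, ?_⟩
  rw [rowLen_eq_zero_iff.2 (by omega)]
  omega

/-- Filling all positions smaller than `N * p` recovers the full set of beta numbers. These decrease
strictly with the row, so the set determines the sequence, and a row beyond both partitions
determines the charge. -/
theorem Represents.unique {p : ℕ} {N : ℤ} {B : Set ℤ} {ν ν' : YoungDiagram}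
    (h : Represents p N B ν) (h' : Represents p N B ν') : ν = ν' := by
  have key : ∀ {ν : YoungDiagram} {R : ℤ}, (len ν : ℤ) ≤ R - N * p → B = abacus p ν R N →
      (Set.range fun r : ℕ => (ν.rowLen r : ℤ) - ((r : ℤ) + 1) + R) = B ∪ Set.Iio (N * p) := by
    intro ν R h1 h2
    ext b
    rw [h2, Set.mem_union, mem_abacus_iff, Set.mem_Iio]
    have h3 : b ∈ (Set.range fun r : ℕ => (ν.rowLen r : ℤ) - ((r : ℤ) + 1) + R) ↔
        b - R ∈ maya ν := by
      simp only [Set.mem_range, maya, Set.mem_ofPred_eq]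
      exact exists_congr fun r => by constructor <;> intro h <;> linarith
    rw [h3]
    constructor
    · intro h
      rcases lt_or_ge b (N * p) with h4 | h4
      · exact Or.inr h4
      · exact Or.inl ⟨h4, h⟩
    · rintro (h | h)
      · exact h.2
      · exact mem_maya_of_lt (by linarith)
  have anti : ∀ (ν : YoungDiagram) (R : ℤ),
      StrictAnti fun r : ℕ => (ν.rowLen r : ℤ) - ((r : ℤ) + 1) + R := by
    intro ν R
    refine strictAnti_nat_of_succ_lt fun r => ?_
    have := ν.rowLen_anti r (r + 1) (by omega)
    push_cast
    have : (ν.rowLen (r + 1) : ℤ) ≤ ν.rowLen r := by exact_mod_cast this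
    linarith
  obtain ⟨R, h1, h2⟩ := h
  obtain ⟨R', h1', h2'⟩ := h'
  have h3 := (StrictMono.range_inj (γ := ℤᵒᵈ) (anti ν R).dual_right (anti ν' R').dual_right).1
    (by
      have := (key h1 h2).trans (key h1' h2').symm
      exact this)
  have h4 : ∀ r : ℕ, (ν.rowLen r : ℤ) - ((r : ℤ) + 1) + R = ν'.rowLen r - ((r : ℤ) + 1) + R' :=
    fun r => congrFun h3 r
  have h5 : R = R' := by
    have := h4 (max (len ν) (len ν'))
    rw [rowLen_eq_zero_iff.2 (le_max_left _ _), rowLen_eq_zero_iff.2 (le_max_right _ _)] at this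
    linarith
  ext ⟨r, c⟩
  have := h4 r
  rw [YoungDiagram.mem_cells, YoungDiagram.mem_cells, YoungDiagram.mem_iff_lt_rowLen,
    YoungDiagram.mem_iff_lt_rowLen]
  omega

/-- In row `r` there is a node of content `d`, where all rows are extended infinitely to the left
and the partition is extended infinitely upwards. -/
def HasContent (μ : YoungDiagram) (r d : ℤ) : Prop := r < 0 ∨ r + d < μ.rowLen r.toNat

/-- In charge `0` the beta number of a row is the content of its last box, rows being continued
infinitely to the left. -/
theorem mem_maya_iff {μ : YoungDiagram} {x : ℤ} :
    x ∈ maya μ ↔ ∃ r : ℤ, HasContent μ r x ∧ ¬ HasContent μ r (x + 1) := by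
  constructor
  · rintro ⟨r, rfl⟩
    refine ⟨r, Or.inr ?_, ?_⟩
    · rw [Int.toNat_natCast]; linarith
    · unfold HasContent; rw [Int.toNat_natCast]; omega
  · rintro ⟨r, h1, h2⟩
    unfold HasContent at h1 h2
    exact ⟨r.toNat, by omega⟩

/-! ### Beads of the subdivided partition -/

section
variable {p : ℕ} {a : ℤ} {μ ν : YoungDiagram}

/-- The difference between the number of rows above the first node of content `x` and that of its
old content. -/
def rowShift (p : ℕ) (a x : ℤ) : ℤ := max 0 (-x) - max 0 (-oldContent p a x)

/-- On a fixed diagonal `collapse` translates the rows by `rowShift`. If `r + x < 0`, both sides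
hold by the extension of the rows to the left. -/
theorem hasContent_plus_iff (ha : 0 ≤ a) (hap : a < p) (hν : ∀ A, A ∈ ν ↔ collapse p a A ∈ μ)
    {r x : ℤ} (hr : 0 ≤ r) :
    HasContent ν r x ↔ HasContent μ (r - rowShift p a x) (oldContent p a x) := by
  have h1 : 0 ≤ x → 0 ≤ oldContent p a x := oldContent_nonneg ha hap
  have h2 : x ≤ 0 → oldContent p a x ≤ 0 := by
    intro h; rw [← oldContent_zero ha hap]; exact oldContent_mono h
  unfold HasContent
  rcases lt_or_ge (r + x) 0 with h | h
  · unfold rowShift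
    constructor <;> intro _ <;> omega
  · have h3 := hν (r.toNat, (r + x).toNat)
    have h4 : content (r.toNat, (r + x).toNat) = x := by unfold content; simp only; omega
    rw [YoungDiagram.mem_iff_lt_rowLen, collapse, h4] at h3
    have h5 : node (depth (r.toNat, (r + x).toNat)) (oldContent p a x)
        = ((r - rowShift p a x).toNat, (r - rowShift p a x + oldContent p a x).toNat) := by
      unfold rowShift depth node
      ext <;> simp only <;> omega
    rw [h5, YoungDiagram.mem_iff_lt_rowLen] at h3
    have h6 : 0 ≤ r - rowShift p a x ∧ 0 ≤ r - rowShift p a x + oldContent p a x := by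
      unfold rowShift; omega
    omega

/-- The step from `x` to `x + 1` collapses to a step by one, and the translation of rows is the same
at both contents, so row ends correspond. -/
theorem mem_maya_plus_iff (ha : 0 ≤ a) (hap : a < p) (hν : ∀ A, A ∈ ν ↔ collapse p a A ∈ μ)
    {x : ℤ} (hx : ¬ IsNew p a (x + 1)) : x ∈ maya ν ↔ oldContent p a x ∈ maya μ := by
  have h1 := oldContent_succ p a x
  rw [if_neg hx] at h1
  have h2 : 0 ≤ x → 0 ≤ oldContent p a x := oldContent_nonneg ha hap
  have h3 : x + 1 ≤ 0 → oldContent p a (x + 1) ≤ 0 := by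
    intro h; rw [← oldContent_zero ha hap]; exact oldContent_mono h
  have h4 : rowShift p a (x + 1) = rowShift p a x := by unfold rowShift; omega
  have h5 : 0 ≤ rowShift p a x := by
    have : x ≤ 0 → resCount (p + 1) a x ≤ 0 := resCount_nonpos ha (by push_cast; omega)
    unfold rowShift oldContent at *; omega
  rw [mem_maya_iff, mem_maya_iff]
  constructor
  · rintro ⟨r, hr1, hr2⟩
    have hr : 0 ≤ r := by unfold HasContent at hr2; omega
    rw [hasContent_plus_iff ha hap hν hr] at hr1 hr2
    rw [h4, h1, sub_zero] at hr2
    exact ⟨_, hr1, hr2⟩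
  · rintro ⟨r, hr1, hr2⟩
    have hr : 0 ≤ r := by unfold HasContent at hr2; omega
    refine ⟨r + rowShift p a x, ?_⟩
    rw [hasContent_plus_iff ha hap hν (by omega), hasContent_plus_iff ha hap hν (by omega), h4, h1,
      sub_zero, add_sub_cancel_right]
    exact ⟨hr1, hr2⟩

/-- Both contents collapse to the same one, so a row can end at `x` only if the row translations at
`x` and `x + 1` differ, which happens for `x < 0`. That row comes from the first row lacking the
collapsed content. -/
theorem mem_maya_plus_iff_of_isNew (ha : 0 ≤ a) (hap : a < p)
    (hν : ∀ A, A ∈ ν ↔ collapse p a A ∈ μ) {x : ℤ} (hx : IsNew p a (x + 1)) :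
    x ∈ maya ν ↔ x < 0 := by
  have h1 := oldContent_succ p a x
  rw [if_pos hx] at h1
  have h2 : 0 ≤ x → 0 ≤ oldContent p a x := oldContent_nonneg ha hap
  have h3 : x + 1 ≤ 0 → oldContent p a (x + 1) ≤ 0 := by
    intro h; rw [← oldContent_zero ha hap]; exact oldContent_mono h
  rw [mem_maya_iff]
  constructor
  · rintro ⟨r, hr1, hr2⟩
    have hr : 0 ≤ r := by unfold HasContent at hr2; omega
    rw [hasContent_plus_iff ha hap hν hr] at hr1 hr2
    by_contra h
    have h4 : rowShift p a (x + 1) = rowShift p a x := by unfold rowShift; omega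
    rw [h4, h1, add_sub_cancel_right] at hr2
    exact hr2 hr1
  · intro h
    have h4 : rowShift p a x = rowShift p a (x + 1) + 1 := by unfold rowShift; omega
    have h5 : 0 ≤ rowShift p a (x + 1) := by
      have : resCount (p + 1) a (x + 1) ≤ 0 := resCount_nonpos ha (by push_cast; omega) (by omega)
      unfold rowShift oldContent at *; omega
    have hex : ∃ r : ℕ, ¬ HasContent μ r (oldContent p a x) := by
      refine ⟨max (len μ) (-oldContent p a x).toNat, ?_⟩
      unfold HasContent
      rw [Int.toNat_natCast, rowLen_eq_zero_iff.2 (le_max_left _ _)]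
      omega
    classical
    have hr2 := Nat.find_spec hex
    -- If this is row `0`, its predecessor is row `-1`, which has every content by the upward
    -- extension.
    have hr1 : HasContent μ ((Nat.find hex : ℤ) - 1) (oldContent p a x) := by
      rcases Nat.eq_zero_or_pos (Nat.find hex) with h0 | h0
      · left; omega
      · have := Nat.find_min hex (m := Nat.find hex - 1) (by omega)
        rw [not_not] at this
        convert this using 1
        omega
    refine ⟨Nat.find hex + rowShift p a (x + 1), ?_⟩
    rw [hasContent_plus_iff ha hap hν (by omega), hasContent_plus_iff ha hap hν (by omega), h4, h1,
      add_sub_cancel_right, add_sub_cancel_right]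
    refine ⟨?_, hr2⟩
    convert hr1 using 1
    ring

/-! ### The abacus definition -/

/-- A position moves up by one for each position of the old runner `i` up to and including `b`,
hence the argument `b + 1`. -/
theorem insert_position_eq (hp : 0 < p) (i : ℕ) (hi : i < p) (b : ℤ) :
    (b / (p : ℤ)) * ((p : ℤ) + 1) + (if b % (p : ℤ) < i then b % (p : ℤ) else b % (p : ℤ) + 1)
      = b + resCount p i (b + 1) := by
  have hp' : (0 : ℤ) < p := by exact_mod_cast hp
  have h1 := Int.mul_ediv_add_emod b p
  have h2 := Int.emod_nonneg b hp'.ne'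
  have h3 := Int.emod_lt_of_pos b hp'
  have h4 : resCount p i (b + 1) = b / p + if b % (p : ℤ) < i then 0 else 1 := by
    rw [resCount_eq_iff hp]
    split_ifs with h
    · constructor <;> nlinarith
    · constructor <;> nlinarith
  rw [h4]
  split_ifs <;> linarith

/-- Relative to the new charge `R + Q`, the positions on the new runner are the `x` with `x + 1`
new. They carry beads exactly for `x < 0`, which means on levels `j < Q`; this explains the count `C
= Q - N`. -/
theorem represents_insertRunner (hp : 0 < p) (ha : 0 ≤ a) (hap : a < p)
    (hν : ∀ A, A ∈ ν ↔ collapse p a A ∈ μ) {R N C Q : ℤ} {i : ℕ} (hi : i < p)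
    (hQ : R + a - i = p * Q) (hC : N + C = Q) (hN : (len μ : ℤ) ≤ R - N * p) :
    (len ν : ℤ) ≤ R + Q - N * ((p + 1 : ℕ) : ℤ) ∧
      insertRunner p i N C (abacus p μ R N) = abacus (p + 1) ν (R + Q) N := by
  have hp' : (0 : ℤ) < p := by exact_mod_cast hp
  have hNQ : N ≤ Q := by
    by_contra h
    have h' : Q + 1 ≤ N := by omega
    nlinarith
  refine ⟨?_, ?_⟩
  · have hr : 0 ≤ R + Q - N * ((p + 1 : ℕ) : ℤ) := by push_cast; nlinarith
    -- This box of the first column collapses to row `R - N * p` of the first column, which is not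
    -- in `μ`.
    have h1 := hν ((R + Q - N * ((p + 1 : ℕ) : ℤ)).toNat, 0)
    have h2 : content ((R + Q - N * ((p + 1 : ℕ) : ℤ)).toNat, 0)
        = - (R + Q - N * ((p + 1 : ℕ) : ℤ)) := by unfold content; simp only; omega
    have h3 : resCount (p + 1) a (- (R + Q - N * ((p + 1 : ℕ) : ℤ))) = N - Q := by
      rw [resCount_eq_iff (by omega)]
      push_cast
      constructor <;> nlinarith
    have h4 : oldContent p a (- (R + Q - N * ((p + 1 : ℕ) : ℤ))) = N * p - R := by
      unfold oldContent; rw [h3]; push_cast; ring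
    have h5 : depth ((R + Q - N * ((p + 1 : ℕ) : ℤ)).toNat, 0) = 0 := by simp [depth]
    rw [collapse, h2, h4, h5, YoungDiagram.mem_iff_lt_colLen, node] at h1
    have h6 : 0 + (N * p - R).toNat = 0 := by omega
    rw [h6, YoungDiagram.mem_iff_lt_colLen] at h1
    unfold len at *
    omega
  · ext b
    rw [mem_abacus_iff, insertRunner]
    simp only [insert_position_eq hp i hi, Set.mem_union, Set.mem_ofPred_eq]
    -- Since `R + a ≡ i`, adding `R` carries contents in the class `a` to positions on runner `i`,
    -- and `Q` levels further.
    have hK : ∀ d : ℤ, resCount p i (d + R + 1) = resCount p a (d + 1) + Q := by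
      intro d
      rw [resCount_eq_iff hp]
      obtain ⟨h1, h2⟩ := resCount_spec hp a (d + 1)
      constructor <;> linarith
    -- The truncation survives the insertion because a bead stays on its level.
    have hlow : ∀ d : ℤ, N * p ≤ d ↔ N * ((p : ℤ) + 1) ≤ d + resCount p i (d + 1) := by
      intro d
      obtain ⟨h1, h2⟩ := resCount_spec hp i (d + 1)
      have hip : (i : ℤ) < p := by exact_mod_cast hi
      constructor <;> intro h
      · have : N ≤ resCount p i (d + 1) := by
          have : (p : ℤ) * N < p * (resCount p i (d + 1) + 1) := by linarith
          have := lt_of_mul_lt_mul_left this hp'.le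
          linarith
        linarith
      · by_contra h3
        push Not at h3
        have : resCount p i (d + 1) < N + 1 := by
          have : (p : ℤ) * (resCount p i (d + 1) - 1) < p * N := by linarith
          have := lt_of_mul_lt_mul_left this hp'.le
          linarith
        linarith
    push_cast
    constructor
    · rintro (⟨b, hb, rfl⟩ | ⟨j, hj1, hj2, rfl⟩)
      · rw [mem_abacus_iff] at hb
        refine ⟨(hlow b).1 hb.1, ?_⟩
        have h1 := hK (b - R)
        rw [sub_add_cancel] at h1
        have h2 : b + resCount p i (b + 1) - (R + Q) = newContent p a (b - R + 1) - 1 := by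
          rw [h1]; unfold newContent; ring
        have h3 := not_isNew_newContent (a := a) hp (b - R + 1)
        rw [h2, mem_maya_plus_iff ha hap hν (by rw [sub_add_cancel]; exact h3)]
        have h4 := oldContent_succ p a (newContent p a (b - R + 1) - 1)
        rw [sub_add_cancel, if_neg h3, oldContent_newContent hp] at h4
        have h5 : oldContent p a (newContent p a (b - R + 1) - 1) = b - R := by linarith
        rw [h5]; exact hb.2
      · have h1 : j * ((p : ℤ) + 1) + i - (R + Q) = (j - Q) * ((p : ℤ) + 1) + a := by linarith
        refine ⟨by nlinarith, ?_⟩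
        rw [h1, mem_maya_plus_iff_of_isNew ha hap hν ⟨j - Q, by ring⟩]
        nlinarith
    · rintro ⟨h1, h2⟩
      by_cases hx : IsNew p a (b - (R + Q) + 1)
      · rw [mem_maya_plus_iff_of_isNew ha hap hν hx] at h2
        obtain ⟨k, hk⟩ := hx
        right
        have hip : (i : ℤ) < p := by exact_mod_cast hi
        have h3 : b = (k + Q) * ((p : ℤ) + 1) + i := by linarith
        refine ⟨k + Q, ?_, ?_, h3⟩
        · have : ((p : ℤ) + 1) * N < (p + 1) * (k + Q + 1) := by linarith
          have := lt_of_mul_lt_mul_left this (by linarith)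
          linarith
        · have : ((p : ℤ) + 1) * k < (p + 1) * 0 := by linarith
          have := lt_of_mul_lt_mul_left this (by linarith)
          linarith
      · rw [mem_maya_plus_iff ha hap hν hx] at h2
        left
        have h4 := oldContent_succ p a (b - (R + Q))
        rw [if_neg hx, sub_zero] at h4
        have h5 := newContent_oldContent hp hx
        rw [h4] at h5
        unfold newContent at h5
        have h6 := hK (oldContent p a (b - (R + Q)))
        have h7 : b = oldContent p a (b - (R + Q)) + R
            + resCount p i (oldContent p a (b - (R + Q)) + R + 1) := by rw [h6]; linarith
        refine ⟨oldContent p a (b - (R + Q)) + R, ?_, h7⟩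
        rw [mem_abacus_iff]
        refine ⟨?_, by rwa [add_sub_cancel_right]⟩
        rw [hlow, ← h7]
        exact h1

/-- For `1 ≤ j < len μ` the numbers `R - j` run through `[R - len μ + 1, R)`, and the congruence
puts `R - j` on runner `i`. -/
theorem kCount_eq (hp : 0 < p) (μ : YoungDiagram) (R : ℤ) (i : ℕ) (h : 1 ≤ len μ) :
    (kCount p μ (R - i) : ℤ) = resCount p i R - resCount p i (R - len μ + 1) := by
  unfold kCount
  generalize len μ = L at *
  induction L, h using Nat.le_induction with
  | base => simp
  | succ L hL ih =>
    have h1 := resCount_succ hp i (R - L)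
    rw [← Finset.insert_Ico_right_eq_Ico_add_one hL, Finset.filter_insert]
    have h2 : ((L : ℤ) ≡ R - i [ZMOD p]) ↔ (p : ℤ) ∣ R - L - i := by
      rw [Int.modEq_iff_dvd, sub_right_comm]
    push_cast
    rw [show R - ((L : ℤ) + 1) + 1 = R - L by ring]
    by_cases h3 : (p : ℤ) ∣ R - L - i
    · rw [if_pos (h2.2 h3), Finset.card_insert_of_notMem (by simp)]
      rw [if_pos h3] at h1
      push_cast
      linarith
    · rw [if_neg (fun h => h3 (h2.1 h))]
      rw [if_neg h3] at h1
      linarith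

/-- `N0` is the level of the first empty position; the correction is `1` exactly if runner `i` has
been reached on that level. -/
theorem N0_add_eq (hp : 0 < p) (μ : YoungDiagram) (R : ℤ) (i : ℕ) (hi : i < p) :
    N0 p μ R + (if (i : ℤ) ≤ (R - len μ) % (p : ℤ) then 1 else 0)
      = resCount p i (R - len μ + 1) := by
  have h1 := insert_position_eq hp i hi (R - len μ)
  have h2 := Int.mul_ediv_add_emod (R - len μ) p
  unfold N0
  split_ifs at h1 ⊢ with h3 h4 <;> first | omega | linarith

/-- The two counts telescope to `resCount p i R = Q`, which leaves `Q - N` beads. For the empty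
partition there is one bead more if `p ∣ R - i`; it then fills the first free position `R + Q`,
which changes the charge but not the partition. -/
theorem represents_insertRunner_iff (hp : 0 < p) (ha : 0 ≤ a) (hap : a < p)
    (hν : ∀ A, A ∈ ν ↔ collapse p a A ∈ μ) {R N : ℤ} {i : ℕ} (hi : i < p)
    (hR : (p : ℤ) ∣ R + a - i) (hN : (len μ : ℤ) ≤ R - N * p) (ν' : YoungDiagram) :
    Represents (p + 1) N (insertRunner p i N
      (kCount p μ (R - i) + N0 p μ R - N + (if (i : ℤ) ≤ (R - len μ) % (p : ℤ) then 1 else 0))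
      (abacus p μ R N)) ν' ↔ ν' = ν := by
  obtain ⟨Q, hQ⟩ := hR
  have hp' : (0 : ℤ) < p := by exact_mod_cast hp
  have hQ' : resCount p i R = Q := by
    rw [resCount_eq_iff hp]; constructor <;> linarith
  have h0 := N0_add_eq hp μ R i hi
  suffices h : Represents (p + 1) N (insertRunner p i N
      (kCount p μ (R - i) + N0 p μ R - N + (if (i : ℤ) ≤ (R - len μ) % (p : ℤ) then 1 else 0))
      (abacus p μ R N)) ν by
    exact ⟨fun h' => h'.unique h, fun h' => h' ▸ h⟩
  have hC : (kCount p μ (R - i) + N0 p μ R - N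
      + (if (i : ℤ) ≤ (R - len μ) % (p : ℤ) then 1 else 0))
      = kCount p μ (R - i) + resCount p i (R - len μ + 1) - N := by rw [← h0]; ring
  rw [hC]
  obtain ⟨h1, h2⟩ := represents_insertRunner hp ha hap hν hi hQ (C := Q - N) (by ring) hN
  rcases Nat.eq_zero_or_pos (len μ) with h3 | h3
  · have hk : kCount p μ (R - i) = 0 := by simp [kCount, h3]
    rw [hk, h3]
    have h4 := resCount_succ hp i R
    rw [hQ'] at h4
    simp only [Nat.cast_zero, sub_zero, zero_add, h4]
    split_ifs with h5
    · have hempty : len ν = 0 := by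
        have h6 := hν (0, 0)
        have h7 : collapse p a (0, 0) = (0, 0) := by
          simp [collapse, content, depth, oldContent_zero ha hap, node]
        rw [h7, YoungDiagram.mem_iff_lt_colLen, YoungDiagram.mem_iff_lt_colLen] at h6
        unfold len at *; omega
      have ha0 : a = 0 := by
        obtain ⟨k, hk⟩ := h5
        have h6 : a = p * (Q - k) := by linarith
        have h7 : Q - k < 1 := by
          by_contra h; push Not at h; nlinarith
        have h8 : -1 < Q - k := by
          by_contra h; push Not at h; nlinarith
        have h9 : Q - k = 0 := by omega
        rw [h6, h9, mul_zero]
      have hRQ : R + Q = Q * ((p : ℤ) + 1) + i := by rw [ha0] at hQ; linarith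
      have hmaya : ∀ x : ℤ, x ∈ maya ν ↔ x < 0 := by
        intro x
        constructor
        · rintro ⟨r, rfl⟩
          rw [rowLen_eq_zero_iff.2 (by omega)]
          push_cast; linarith
        · intro h; exact mem_maya_of_lt (by rw [hempty]; simpa using h)
      have hNQ : N ≤ Q := by
        by_contra h
        have h' : Q + 1 ≤ N := by omega
        rw [h3] at hN
        push_cast at hN
        have hip : (i : ℤ) < p := by exact_mod_cast hi
        nlinarith
      refine ⟨R + Q + 1, by linarith, ?_⟩
      have h6 : insertRunner p i N (Q + 1 - N) (abacus p μ R N)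
          = insertRunner p i N (Q - N) (abacus p μ R N) ∪ {R + Q} := by
        unfold insertRunner
        rw [Set.union_assoc]
        congr 1
        ext b
        simp only [Set.mem_ofPred_eq, Set.mem_union, Set.mem_singleton_iff]
        constructor
        · rintro ⟨j, hj1, hj2, rfl⟩
          rcases eq_or_ne j Q with rfl | hj
          · right; exact hRQ.symm
          · left; exact ⟨j, hj1, by omega, rfl⟩
        · rintro (⟨j, hj1, hj2, rfl⟩ | rfl)
          · exact ⟨j, hj1, by omega, rfl⟩
          · exact ⟨Q, hNQ, by omega, hRQ⟩
      rw [h6, h2]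
      ext b
      rw [Set.mem_union, mem_abacus_iff, mem_abacus_iff, hmaya, hmaya, Set.mem_singleton_iff]
      have hlow : N * ((p + 1 : ℕ) : ℤ) ≤ R + Q := by rw [hempty] at h1; push_cast at *; linarith
      omega
    · rw [add_zero]; exact ⟨_, h1, h2⟩
  · rw [kCount_eq hp μ R i h3, hQ', sub_add_cancel]
    exact ⟨_, h1, h2⟩

end

/-! ### Sizes -/

/-- The path down the first column to the row of `A` and then along this row to `A` lies in `μ`. -/
theorem add_lt_card {μ : YoungDiagram} {A : ℕ × ℕ} (hA : A ∈ μ) : A.1 + A.2 + 1 ≤ μ.card := by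
  have h : (Finset.range (A.1 + A.2 + 1)).card ≤ μ.cells.card := by
    refine Finset.card_le_card_of_injOn (fun j => if j ≤ A.1 then (j, 0) else (A.1, j - A.1)) ?_ ?_
    · intro j hj
      simp only [Finset.coe_range, Set.mem_Iio] at hj
      simp only [Finset.mem_coe, YoungDiagram.mem_cells]
      refine μ.isLowerSet ?_ hA
      split_ifs <;> constructor <;> simp only <;> omega
    · intro j _ j' _ h
      simp only at h
      split_ifs at h <;> simp only [Prod.mk.injEq] at h <;> omega
  simpa using h

theorem card_le_size {ℓ : ℕ} (Λ : Fin ℓ → YoungDiagram) (m : Fin ℓ) : (Λ m).card ≤ size Λ :=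
  Finset.single_le_sum (f := fun m => (Λ m).card) (fun _ _ => Nat.zero_le _) (Finset.mem_univ m)

theorem card_add_card_le_size {ℓ : ℕ} (Λ : Fin ℓ → YoungDiagram) {m m' : Fin ℓ} (h : m ≠ m') :
    (Λ m).card + (Λ m').card ≤ size Λ := by
  unfold size
  rw [← Finset.sum_pair h (f := fun m => (Λ m).card)]
  exact Finset.sum_le_sum_of_subset (Finset.subset_univ _)

/-! ### Relabelling -/

section
variable {e : ℕ}

/-- The path from `j` forward to `i` avoids the subdivided edge, so its length `(i - j).val` is the
same in both quivers; `newVertex i - 1` is the new label of `i`. -/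
theorem relabel_eq (i j : ZMod (e + 1)) :
    relabel i j = newVertex i - 1 - (((i - j).val : ℕ) : ZMod (e + 2)) := by
  have hi := ZMod.val_lt i
  have hj := ZMod.val_lt j
  unfold relabel newVertex
  split_ifs with h
  · rw [ZMod.val_sub h, Nat.cast_sub h]; push_cast; ring
  · have h1 : (i - j).val = i.val + (e + 1) - j.val := by
      have h2 : j.val = (j - i).val + i.val := by rw [ZMod.val_sub (by omega)]; omega
      have hne : j - i ≠ 0 := by
        rw [sub_ne_zero]; rintro rfl; exact h le_rfl
      have : NeZero (j - i) := ⟨hne⟩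
      have h3 : (i - j).val = e + 1 - (j - i).val := by
        rw [← neg_sub j i, ZMod.val_neg_of_ne_zero]
      omega
    rw [h1, Nat.cast_sub (by omega)]
    have h0 : ((e : ZMod (e + 2)) + 2) = 0 := by
      have := ZMod.natCast_self (e + 2); push_cast at this; exact this
    push_cast
    linear_combination h0

theorem natCast_inj_of_lt {q x y : ℕ} (hx : x < q) (hy : y < q)
    (h : (x : ZMod q) = (y : ZMod q)) : x = y := by
  rw [ZMod.natCast_eq_natCast_iff'] at h
  rwa [Nat.mod_eq_of_lt hx, Nat.mod_eq_of_lt hy] at h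

theorem relabel_injective (i : ZMod (e + 1)) : Function.Injective (relabel i) := by
  intro j j' h
  rw [relabel_eq, relabel_eq] at h
  have h1 := natCast_inj_of_lt (by have := ZMod.val_lt (i - j); omega)
    (by have := ZMod.val_lt (i - j'); omega) (sub_right_injective h)
  have h2 := ZMod.val_injective _ h1
  exact sub_right_injective h2

theorem relabel_ne_newVertex (i j : ZMod (e + 1)) : relabel i j ≠ newVertex i := by
  intro h
  rw [relabel_eq] at h
  have h1 : (((i - j).val + 1 : ℕ) : ZMod (e + 2)) = ((0 : ℕ) : ZMod (e + 2)) := by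
    push_cast; linear_combination -h
  have := natCast_inj_of_lt (by have := ZMod.val_lt (i - j); omega) (by omega) h1
  omega

theorem subdivShift_one (i : ZMod (e + 1)) (ε : ℝ) (j : ZMod (e + 2)) :
    subdivShift i ε (fun _ => 1) j = if j = newVertex i then ε else 1 := by
  unfold subdivShift
  split_ifs <;> rfl

theorem add_relabel_eq_newVertex_iff (i ρ : ZMod (e + 1)) (x : ℤ) :
    relabel i ρ + (x : ZMod (e + 2)) = newVertex i ↔ IsNew (e + 1) (offset ρ i) x := by
  have h : IsNew (e + 1) (offset ρ i) x ↔ ((e + 2 : ℕ) : ℤ) ∣ x - offset ρ i - 1 := by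
    unfold IsNew; push_cast; rw [add_assoc, one_add_one_eq_two]
  rw [h, ← ZMod.intCast_zmod_eq_zero_iff_dvd, relabel_eq]
  unfold offset
  push_cast
  constructor <;> intro h
  · linear_combination h
  · linear_combination h

theorem res_eq_newVertex_iff (i ρ : ZMod (e + 1)) (B : ℕ × ℕ) :
    res (e + 2) (relabel i ρ) B = newVertex i ↔ IsNew (e + 1) (offset ρ i) (content B) := by
  rw [res_eq, add_comm _ (relabel i ρ), add_relabel_eq_newVertex_iff]

/-- With `k` class members before the old content `d`, the number `offset ρ i - d + (e + 1) k` lies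
in `[0, e + 1)`, so it is the distance from the residue to `i`. In the larger quiver it turns `d`
into `d + k`, the new content. -/
theorem res_relabel (i ρ : ZMod (e + 1)) {B : ℕ × ℕ}
    (hB : ¬ IsNew (e + 1) (offset ρ i) (content B)) :
    res (e + 2) (relabel i ρ) B = relabel i (res (e + 1) ρ (collapse (e + 1) (offset ρ i) B)) := by
  have hφ := newContent_oldContent (by omega) hB
  have hc : content (collapse (e + 1) (offset ρ i) B)
      = oldContent (e + 1) (offset ρ i) (content B) := by simp [collapse]
  rw [res_eq, res_eq, relabel_eq, relabel_eq, hc]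
  set d := oldContent (e + 1) (offset ρ i) (content B) with hd
  obtain ⟨k1, k2⟩ := resCount_spec (by omega : 0 < e + 1) (offset ρ i) d
  have h1 : ((i - (((d : ℤ) : ZMod (e + 1)) + ρ)).val : ℤ)
      = offset ρ i - d + ((e + 1 : ℕ) : ℤ) * resCount (e + 1) (offset ρ i) d := by
    have h3 : ((i - (((d : ℤ) : ZMod (e + 1)) + ρ)))
        = ((offset ρ i - d + ((e + 1 : ℕ) : ℤ) * resCount (e + 1) (offset ρ i) d : ℤ) :
            ZMod (e + 1)) := by
      have h0 : ((e : ZMod (e + 1)) + 1) = 0 := by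
        have := ZMod.natCast_self (e + 1); push_cast at this; exact this
      push_cast [offset_cast]
      rw [h0]; ring
    rw [h3, ZMod.val_intCast, Int.emod_eq_of_lt (by linarith) (by linarith)]
  have h2 : (((i - (((d : ℤ) : ZMod (e + 1)) + ρ)).val : ℕ) : ZMod (e + 2))
      = ((offset ρ i - d + ((e + 1 : ℕ) : ℤ) * resCount (e + 1) (offset ρ i) d : ℤ) :
          ZMod (e + 2)) := by
    rw [← h1]; push_cast; rfl
  have h4 : ((content B : ℤ) : ZMod (e + 2))
      = ((d + resCount (e + 1) (offset ρ i) d : ℤ) : ZMod (e + 2)) := by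
    rw [← hφ]; rfl
  have h0 : ((e : ZMod (e + 2)) + 2) = 0 := by
    have := ZMod.natCast_self (e + 2); push_cast at this; exact this
  rw [h2, h4]
  unfold offset
  push_cast
  linear_combination ((resCount (e + 1) (((i - ρ).val : ℕ) : ℤ) d : ℤ) : ZMod (e + 2)) * h0

end

/-! ### Sums of ghost shifts -/

theorem pathShift_zero {p : ℕ} (σ : ZMod p → ℝ) (ρ : ZMod p) : pathShift σ ρ 0 = 0 := by
  simp [pathShift]

theorem pathShift_succ {p : ℕ} (σ : ZMod p → ℝ) (ρ : ZMod p) (d : ℤ) :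
    pathShift σ ρ (d + 1) = pathShift σ ρ d + σ (ρ + (d : ZMod p)) := by
  unfold pathShift
  rcases le_or_gt 0 d with h | h
  · obtain ⟨k, rfl⟩ := Int.eq_ofNat_of_zero_le h
    rw [if_pos (by omega), if_pos h, show ((k : ℤ) + 1).toNat = k + 1 by omega,
      Finset.sum_range_succ]
    simp
  · obtain ⟨k, rfl⟩ : ∃ k : ℕ, d = -((k : ℤ) + 1) := ⟨(-d - 1).toNat, by omega⟩
    rw [if_neg (by omega : ¬ 0 ≤ -((k : ℤ) + 1)),
      show (-(-((k : ℤ) + 1))).toNat = k + 1 by omega, Finset.sum_range_succ]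
    have h1 : (ρ + ((-((k : ℤ) + 1) : ℤ) : ZMod p)) = ρ - ((k : ZMod p) + 1) := by push_cast; ring
    rw [h1]
    rcases Nat.eq_zero_or_pos k with rfl | hk
    · simp
    · rw [if_neg (by omega), show (-(-((k : ℤ) + 1) + 1)).toNat = k by omega]
      ring

/-- A function on the integers is fixed by its value at `0` and its increments, so closed formulas
need no case distinction by sign. -/
theorem pathShift_eq {p : ℕ} (σ : ZMod p → ℝ) (ρ : ZMod p) (f : ℤ → ℝ) (h0 : f 0 = 0)
    (h : ∀ d : ℤ, f (d + 1) = f d + σ (ρ + (d : ZMod p))) (d : ℤ) : pathShift σ ρ d = f d := by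
  induction d using Int.induction_on with
  | zero => rw [pathShift_zero, h0]
  | succ n ih => rw [pathShift_succ, h, ih]
  | pred n ih =>
    have h1 := pathShift_succ σ ρ (-(n : ℤ) - 1)
    have h2 := h (-(n : ℤ) - 1)
    rw [sub_add_cancel] at h1 h2
    linarith

theorem pathShift_one {p : ℕ} (ρ : ZMod p) (d : ℤ) : pathShift (fun _ => 1) ρ d = d :=
  pathShift_eq _ _ (fun d => (d : ℝ)) (by simp) (fun d => by push_cast; rfl) d

/-- The sum of the ghost shifts from `0` to content `x`, where the edges starting in new contents
are not counted. -/
def baseShift (p : ℕ) (a x : ℤ) : ℤ := x - resCount (p + 1) (a + 1) x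

/-- The number of new contents in `[0, x)`. -/
def newShift (p : ℕ) (a x : ℤ) : ℤ := resCount (p + 1) (a + 1) x

section
variable {p : ℕ} {a : ℤ}

open Classical in
theorem newShift_succ (x : ℤ) :
    newShift p a (x + 1) = newShift p a x + if IsNew p a x then 1 else 0 := by
  have h : IsNew p a x ↔ ((p + 1 : ℕ) : ℤ) ∣ x - (a + 1) := by
    unfold IsNew; push_cast; rw [sub_add_eq_sub_sub]
  unfold newShift
  rw [resCount_succ (by omega)]
  simp only [h]

open Classical in
theorem baseShift_succ (x : ℤ) :
    baseShift p a (x + 1) = baseShift p a x + if IsNew p a x then 0 else 1 := by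
  have h := newShift_succ (p := p) (a := a) x
  unfold newShift at h
  unfold baseShift
  rw [h]
  split_ifs <;> ring

open Classical in
-- An inserted box lies at the integer of the ghost of its `i`-node, one to the right of the node.
theorem baseShift_eq (x : ℤ) :
    baseShift p a x = oldContent p a x + if IsNew p a x then 1 else 0 := by
  have h := resCount_isNew p a x
  unfold baseShift oldContent
  rw [← h]; ring

theorem baseShift_succ_eq (x : ℤ) : baseShift p a (x + 1) = oldContent p a x + 1 := by
  classical
  rw [baseShift_succ, baseShift_eq]
  split_ifs <;> ring

theorem baseShift_mono : Monotone (baseShift p a) := resCount_sub_mono (by omega) (a + 1)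

theorem newShift_mono : Monotone (newShift p a) := resCount_mono (by omega) (a + 1)

theorem baseShift_add_period (x : ℤ) : baseShift p a (x + (p + 1)) = baseShift p a x + p := by
  have h : resCount (p + 1) (a + 1) (x + (p + 1)) = resCount (p + 1) (a + 1) x + 1 := by
    obtain ⟨h1, h2⟩ := resCount_spec (by omega : 0 < p + 1) (a + 1) x
    rw [resCount_eq_iff (by omega)]
    push_cast at *
    constructor <;> linarith
  unfold baseShift
  rw [h]; ring

theorem pathShift_subdivShift {e : ℕ} (i ρ : ZMod (e + 1)) (ε : ℝ) (x : ℤ) :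
    pathShift (subdivShift i ε fun _ => 1) (relabel i ρ) x
      = baseShift (e + 1) (offset ρ i) x + newShift (e + 1) (offset ρ i) x * ε := by
  classical
  refine pathShift_eq _ _ (fun x => (baseShift (e + 1) (offset ρ i) x : ℝ)
    + newShift (e + 1) (offset ρ i) x * ε) ?_ ?_ x
  · have h1 := offset_nonneg ρ i
    have h2 := offset_lt ρ i
    simp only [baseShift, newShift]
    rw [resCount_zero (by omega) (by push_cast at *; omega)]
    simp
  · intro d
    simp only [baseShift_succ, newShift_succ, subdivShift_one, add_relabel_eq_newVertex_iff]
    split_ifs <;> push_cast <;> ring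

end

/-! ### Diagrams whose solid strings are indexed -/

/-- Solid strings and ghosts are combined in one function `P`; its injectivity excludes all
coincidences among them at once. -/
theorem isLoading_of_index {p ℓ : ℕ} {J : Type*} (Y : IdemDiagram p ℓ) (f : J → ℝ × ZMod p)
    (hf : ∀ s, s ∈ Y.solid ↔ ∃ j, f j = s) (hshift : ∀ j, Y.shift j ≠ 0)
    (hcharge : StrictMono Y.charge) (P : J → Bool → ℝ) (hP0 : ∀ j, P j false = (f j).1)
    (hP1 : ∀ j, P j true = Y.ghost (f j))
    (hinj : ∀ j j' g g', P j g = P j' g' → j = j' ∧ g = g')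
    (hred : ∀ j g m, P j g ≠ Y.charge m) : Y.IsLoading := by
  refine ⟨hshift, hcharge, ?_, ?_, ?_, ?_⟩
  · intro s hs s' hs' h
    obtain ⟨j, rfl⟩ := (hf s).1 hs
    obtain ⟨j', rfl⟩ := (hf s').1 hs'
    rw [← hP0, ← hP0] at h
    rw [(hinj _ _ _ _ h).1]
  · intro s hs s' hs' h
    obtain ⟨j, rfl⟩ := (hf s).1 hs
    obtain ⟨j', rfl⟩ := (hf s').1 hs'
    rw [← hP1, ← hP1] at h
    rw [(hinj _ _ _ _ h).1]
  · intro s hs s' hs' h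
    obtain ⟨j, rfl⟩ := (hf s).1 hs
    obtain ⟨j', rfl⟩ := (hf s').1 hs'
    rw [← hP1, ← hP0] at h
    exact Bool.noConfusion (hinj _ _ _ _ h).2
  · intro s hs m
    obtain ⟨j, rfl⟩ := (hf s).1 hs
    rw [← hP0, ← hP1]
    exact ⟨hred _ _ _, hred _ _ _⟩

/-- Two nonzero real numbers have the same sign. -/
def SameSign (x y : ℝ) : Prop := (0 < x ∧ 0 < y) ∨ (x < 0 ∧ y < 0)

theorem SameSign.combination_ne_zero {x y u : ℝ} (h : SameSign x y) (hu : u ∈ Set.Icc (0 : ℝ) 1) :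
    (1 - u) * x + u * y ≠ 0 := by
  obtain ⟨h0, h1⟩ := hu
  rcases h with ⟨hx, hy⟩ | ⟨hx, hy⟩
  · rcases eq_or_lt_of_le h0 with rfl | h0
    · simpa using hx.ne'
    · have := mul_pos h0 hy
      have := mul_nonneg (sub_nonneg.2 h1) hx.le
      linarith
  · rcases eq_or_lt_of_le h0 with rfl | h0
    · simpa using hx.ne
    · have := mul_neg_of_pos_of_neg h0 hy
      have := mul_nonpos_of_nonneg_of_nonpos (sub_nonneg.2 h1) hx.le
      linarith

/-- Strings move along straight lines. The signed distance of a blocking pair is then a convex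
combination of its values at the ends, so it cannot vanish if these have the same sign. -/
theorem pullEq_of_index {p ℓ : ℕ} {J : Type*} (Y Z : IdemDiagram p ℓ) (f g : J → ℝ × ZMod p)
    (hshift : Y.shift = Z.shift) (hcharge : Y.charge = Z.charge) (hred : Y.red = Z.red)
    (hfs : ∀ s, s ∈ Y.solid ↔ ∃ j, f j = s) (hgs : ∀ s, s ∈ Z.solid ↔ ∃ j, g j = s)
    (hf : Function.Injective f) (hg : Function.Injective g) (hfg : ∀ j, (f j).2 = (g j).2)
    (h1 : ∀ j j', j ≠ j' → (f j).2 = (f j').2 →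
      SameSign ((f j).1 - (f j').1) ((g j).1 - (g j').1))
    (h2 : ∀ j j', (f j').2 = (f j).2 + 1 →
      SameSign (Y.ghost (f j) - (f j').1) (Z.ghost (g j) - (g j').1))
    (h3 : ∀ j m, Y.red m = (f j).2 →
      SameSign ((f j).1 - Y.charge m) ((g j).1 - Y.charge m)) : Y.PullEq Z := by
  let eY : J ≃ {s // s ∈ Y.solid} :=
    Equiv.ofBijective (fun j => ⟨f j, (hfs _).2 ⟨j, rfl⟩⟩)
      ⟨fun j j' h => hf (congrArg Subtype.val h),
        fun ⟨s, hs⟩ => by obtain ⟨j, rfl⟩ := (hfs s).1 hs; exact ⟨j, rfl⟩⟩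
  let eZ : J ≃ {s // s ∈ Z.solid} :=
    Equiv.ofBijective (fun j => ⟨g j, (hgs _).2 ⟨j, rfl⟩⟩)
      ⟨fun j j' h => hg (congrArg Subtype.val h),
        fun ⟨s, hs⟩ => by obtain ⟨j, rfl⟩ := (hgs s).1 hs; exact ⟨j, rfl⟩⟩
  have hw : ∀ j, (eY.symm.trans eZ) (eY j) = eZ j := fun j => by simp
  have heY : ∀ j, (eY j).1 = f j := fun j => rfl
  have heZ : ∀ j, (eZ j).1 = g j := fun j => rfl
  refine ⟨hshift, hcharge, hred, eY.symm.trans eZ,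
    fun a u => (1 - u) * a.1.1 + u * ((eY.symm.trans eZ) a).1.1, ?_, ?_, ?_, ?_, ?_⟩
  · intro a
    obtain ⟨j, rfl⟩ := eY.surjective a
    rw [hw, heY, heZ, hfg]
  · intro a; fun_prop
  · intro a; simp
  · intro a; simp
  · intro u hu
    refine ⟨?_, ?_, ?_⟩
    · intro a b hab hres
      obtain ⟨j, rfl⟩ := eY.surjective a
      obtain ⟨j', rfl⟩ := eY.surjective b
      rw [heY, heY] at hres
      have := (h1 j j' (fun h => hab (by rw [h])) hres).combination_ne_zero hu
      simp only [hw, heY, heZ]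
      intro h
      apply this
      linear_combination h
    · intro a b hres
      obtain ⟨j, rfl⟩ := eY.surjective a
      obtain ⟨j', rfl⟩ := eY.surjective b
      rw [heY, heY] at hres
      have := (h2 j j' hres).combination_ne_zero hu
      simp only [hw, heY, heZ]
      intro h
      apply this
      unfold IdemDiagram.ghost
      rw [← hshift, ← hfg]
      linear_combination h
    · intro a m hres
      obtain ⟨j, rfl⟩ := eY.surjective a
      rw [heY] at hres
      have := (h3 j m hres).combination_ne_zero hu
      simp only [hw, heY, heZ]
      intro h
      apply this
      linear_combination h

/-! ### Positions -/

/-- Multiplied by `h`, the main part of the difference is the integer `h (X - X') - (m - m')`. It is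
positive because `|m - m'| < ℓ ≤ h`, hence at least `1`, and the perturbation is smaller than `1`.
-/
theorem lt_of_lex {ℓ h : ℕ} (hℓ : ℓ ≤ h) {m m' : Fin ℓ} {X X' : ℤ} {τ τ' : ℝ}
    (hτ : |τ - τ'| * h < 1) (hlex : X' < X ∨ (X = X' ∧ m < m')) :
    (X' : ℝ) - ((m' : ℝ) + 1) / h - τ' < (X : ℝ) - ((m : ℝ) + 1) / h - τ := by
  have hm := m.2
  have hm' := m'.2
  have hpos : (0 : ℝ) < h := by exact_mod_cast (by omega : 0 < h)
  have hI : (1 : ℤ) ≤ h * (X - X') - ((m : ℤ) - m') := by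
    rcases hlex with h1 | ⟨h1, h2⟩
    · have h3 : (h : ℤ) * 1 ≤ h * (X - X') := by
        apply mul_le_mul_of_nonneg_left <;> omega
      omega
    · have : (m : ℕ) < m' := h2
      rw [h1, sub_self, mul_zero]; omega
  have hI' : (1 : ℝ) ≤ h * ((X : ℝ) - X') - ((m : ℝ) - m') := by exact_mod_cast hI
  have h4 : (τ - τ') * h < 1 :=
    lt_of_le_of_lt (mul_le_mul_of_nonneg_right (le_abs_self _) hpos.le) hτ
  have e1 : ((X : ℝ) - ((m : ℝ) + 1) / h - τ - ((X' : ℝ) - ((m' : ℝ) + 1) / h - τ')) * h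
      = h * ((X : ℝ) - X') - ((m : ℝ) - m') - (τ - τ') * h := by
    field_simp; ring
  have e2 : 0 < ((X : ℝ) - ((m : ℝ) + 1) / h - τ - ((X' : ℝ) - ((m' : ℝ) + 1) / h - τ')) * h := by
    rw [e1]; linarith
  have := pos_of_mul_pos_left e2 hpos.le
  linarith

/-- Multiplied by `h`, closeness and perturbation contribute at most a half each, one of them
strictly less. So the integer `h (X - X') - (m - m')` vanishes, and `|m - m'| < h` makes both
differences zero. -/
theorem eq_of_close {ℓ h : ℕ} (hℓ : ℓ ≤ h) {m m' : Fin ℓ} {X X' : ℤ} {τ τ' δ : ℝ}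
    (hτ : 2 * |τ - τ'| * h < 1) (hδ : 2 * h * δ ≤ 1)
    (hclose : |(X : ℝ) - ((m : ℝ) + 1) / h - τ - ((X' : ℝ) - ((m' : ℝ) + 1) / h - τ')| ≤ δ) :
    m = m' ∧ X = X' := by
  have hm := m.2
  have hm' := m'.2
  have hpos : (0 : ℝ) < h := by exact_mod_cast (by omega : 0 < h)
  have e1 : ((X : ℝ) - ((m : ℝ) + 1) / h - τ - ((X' : ℝ) - ((m' : ℝ) + 1) / h - τ')) * h
      = h * ((X : ℝ) - X') - ((m : ℝ) - m') - (τ - τ') * h := by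
    field_simp; ring
  have e2 : |h * ((X : ℝ) - X') - ((m : ℝ) - m')| < 1 := by
    have h1 : |h * ((X : ℝ) - X') - ((m : ℝ) - m') - (τ - τ') * h| ≤ δ * h := by
      rw [← e1, abs_mul, abs_of_pos hpos]
      exact mul_le_mul_of_nonneg_right hclose hpos.le
    have h2 : |(τ - τ') * h| = |τ - τ'| * h := by rw [abs_mul, abs_of_pos hpos]
    have h3 := abs_add_le (h * ((X : ℝ) - X') - ((m : ℝ) - m') - (τ - τ') * h) ((τ - τ') * h)
    rw [sub_add_cancel] at h3
    linarith
  have e3 : |(h : ℤ) * (X - X') - ((m : ℤ) - m')| < 1 := by exact_mod_cast e2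
  rw [Int.abs_lt_one_iff] at e3
  have e4 : X = X' := by
    by_contra hne
    rcases lt_or_gt_of_ne hne with h1 | h1
    · have : (h : ℤ) * 1 ≤ h * (X' - X) := by apply mul_le_mul_of_nonneg_left <;> omega
      have e5 : (h : ℤ) * (X' - X) = - (h * (X - X')) := by ring
      omega
    · have : (h : ℤ) * 1 ≤ h * (X - X') := by apply mul_le_mul_of_nonneg_left <;> omega
      omega
  rw [e4, sub_self, mul_zero] at e3
  exact ⟨Fin.ext (by omega), e4⟩

/-! ### Strings of the diagram of a multipartition -/

theorem mem_solid_idem {p ℓ : ℕ} {σ : ZMod p → ℝ} {κ : Fin ℓ → ℤ} {ρ : Fin ℓ → ZMod p} {η : ℝ}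
    {Λ : Fin ℓ → YoungDiagram} {s : ℝ × ZMod p} :
    s ∈ (idem σ κ ρ η Λ).solid ↔ ∃ m A, A ∈ Λ m ∧
      ((κ m : ℝ) + pathShift σ (ρ m) (content A) - ((m : ℝ) + 1) / (hatLevel p Λ : ℝ)
        - ((A.2 : ℝ) + (A.1 : ℝ) + 2) * η, res p (ρ m) A) = s := by
  simp only [idem, Finset.mem_biUnion, Finset.mem_univ, true_and, Finset.mem_image,
    YoungDiagram.mem_cells, content]

/-- The position of the string of a node of component `m` in a diagram with unit ghost shifts. -/
def gridPos {ℓ : ℕ} (h : ℕ) (η : ℝ) (m : Fin ℓ) (X : ℤ) (A : ℕ × ℕ) : ℝ :=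
  X - ((m : ℝ) + 1) / h - ((A.2 : ℝ) + (A.1 : ℝ) + 2) * η

theorem mem_solid_idem_one {p ℓ : ℕ} {κ : Fin ℓ → ℤ} {ρ : Fin ℓ → ZMod p} {η : ℝ}
    {Λ : Fin ℓ → YoungDiagram} {s : ℝ × ZMod p} :
    s ∈ (idem (fun _ => 1) κ ρ η Λ).solid ↔ ∃ m A, A ∈ Λ m ∧
      (gridPos (hatLevel p Λ) η m (κ m + content A) A, res p (ρ m) A) = s := by
  rw [mem_solid_idem]
  simp only [pathShift_one, gridPos]
  push_cast
  rfl

theorem le_hatLevel (p : ℕ) {ℓ : ℕ} (Λ : Fin ℓ → YoungDiagram) : ℓ ≤ hatLevel p Λ :=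
  Nat.le_add_right _ _

/-! ### Close tuples in the diagram of a multipartition -/

section
variable {p : ℕ} [NeZero p] {ℓ : ℕ} {κ : Fin ℓ → ℤ} {ρ : Fin ℓ → ZMod p} {η δ : ℝ}
  {Λ : Fin ℓ → YoungDiagram} {i : ZMod p}

open Classical in
/-- The string `a` of a tuple comes from the node `A` of component `m`. -/
def IsTupleNode (κ : Fin ℓ → ℤ) (ρ : Fin ℓ → ZMod p) (η : ℝ) (Λ : Fin ℓ → YoungDiagram)
    (i : ZMod p) (a : ℝ × Kind) (m : Fin ℓ) (A : ℕ × ℕ) : Prop :=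
  A ∈ Λ m ∧ (res p (ρ m) A = i ∨ res p (ρ m) A = i + 1) ∧
    a = (gridPos (hatLevel p Λ) η m (κ m + stripContent (ρ m) i A + 1) A,
      if res p (ρ m) A = i then Kind.ghost else Kind.solid)

/-- The ghost of an `i`-node of content `d` and the solid string of an `(i+1)`-node of content `d +
1` lie at the same integer, which `stripContent + 1` expresses for both kinds. -/
theorem mem_tupleStrings (hp : (1 : ZMod p) ≠ 0) {a : ℝ × Kind} :
    a ∈ tupleStrings (idem (fun _ => 1) κ ρ η Λ) i ↔ ∃ m A, IsTupleNode κ ρ η Λ i a m A := by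
  have hg : ∀ s : ℝ × ZMod p, (idem (fun _ => 1) κ ρ η Λ).ghost s = s.1 + 1 := fun s => rfl
  obtain ⟨x, k⟩ := a
  simp only [tupleStrings, Set.mem_ofPred_eq, hg, IsTupleNode, mem_solid_idem_one]
  constructor
  · rintro (⟨rfl, s, ⟨m, A, hA, rfl⟩, h1, h2⟩ | ⟨rfl, m, A, hA, h⟩)
    · simp only at h1 h2
      refine ⟨m, A, hA, Or.inl h1, ?_⟩
      rw [if_pos h1, h2, stripContent, if_pos h1]
      unfold gridPos
      congr 1
      push_cast; ring
    · simp only [Prod.mk.injEq] at h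
      have h' : res p (ρ m) A ≠ i := by rw [h.2]; simpa using hp
      refine ⟨m, A, hA, Or.inr h.2, ?_⟩
      rw [if_neg h', stripContent, if_neg h', ← h.1]
      congr 2; ring
  · rintro ⟨m, A, hA, h1, h2⟩
    by_cases h : res p (ρ m) A = i
    · rw [if_pos h, stripContent, if_pos h, Prod.mk.injEq] at h2
      left
      refine ⟨h2.2, _, ⟨m, A, hA, rfl⟩, h, ?_⟩
      rw [h2.1]; unfold gridPos; push_cast; ring
    · rw [if_neg h, stripContent, if_neg h, Prod.mk.injEq] at h2
      right
      refine ⟨h2.2, m, A, hA, ?_⟩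
      rw [h1.resolve_left h, h2.1]
      congr 2; ring

theorem two_mul_abs_offset_lt {p : ℕ} {Λ : Fin ℓ → YoungDiagram} {η : ℝ} (h0 : 0 < η)
    (h1 : 2 * (size Λ : ℝ) * hatLevel p Λ * η < 1)
    {m m' : Fin ℓ} {A A' : ℕ × ℕ} (hA : A ∈ Λ m) (hA' : A' ∈ Λ m') :
    2 * |((A.2 : ℝ) + (A.1 : ℝ) + 2) * η - ((A'.2 : ℝ) + (A'.1 : ℝ) + 2) * η| * hatLevel p Λ < 1 := by
  have h2 := (add_lt_card hA).trans (card_le_size Λ m)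
  have h3 := (add_lt_card hA').trans (card_le_size Λ m')
  have h2' : (A.1 : ℝ) + A.2 + 1 ≤ size Λ := by exact_mod_cast h2
  have h3' : (A'.1 : ℝ) + A'.2 + 1 ≤ size Λ := by exact_mod_cast h3
  have e : |((A.2 : ℝ) + (A.1 : ℝ) + 2) * η - ((A'.2 : ℝ) + (A'.1 : ℝ) + 2) * η| ≤ size Λ * η := by
    rw [← sub_mul, abs_mul, abs_of_pos h0]
    refine mul_le_mul_of_nonneg_right ?_ h0.le
    have p1 : (0 : ℝ) ≤ A.1 := Nat.cast_nonneg _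
    have p2 : (0 : ℝ) ≤ A.2 := Nat.cast_nonneg _
    have p3 : (0 : ℝ) ≤ A'.1 := Nat.cast_nonneg _
    have p4 : (0 : ℝ) ≤ A'.2 := Nat.cast_nonneg _
    rw [abs_le]; constructor <;> linarith
  have h4 : (0 : ℝ) ≤ hatLevel p Λ := Nat.cast_nonneg _
  have := mul_le_mul_of_nonneg_right e h4
  linarith

theorem IsTupleNode.eq_of_close (h0 : 0 < η) (h1 : 2 * (size Λ : ℝ) * hatLevel p Λ * η < 1)
    (hδ : 2 * (hatLevel p Λ : ℝ) * δ ≤ 1) {a b : ℝ × Kind} {m m' : Fin ℓ} {A A' : ℕ × ℕ}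
    (ha : IsTupleNode κ ρ η Λ i a m A) (hb : IsTupleNode κ ρ η Λ i b m' A')
    (hab : |a.1 - b.1| ≤ δ) : m = m' ∧ stripContent (ρ m) i A = stripContent (ρ m') i A' := by
  obtain ⟨hA, -, rfl⟩ := ha
  obtain ⟨hB, -, rfl⟩ := hb
  obtain ⟨rfl, h2⟩ := Subdiv.eq_of_close (le_hatLevel p Λ)
    (two_mul_abs_offset_lt h0 h1 hA hB) hδ hab
  exact ⟨rfl, by linarith⟩

theorem IsCloseTuple.pairwise {Y : IdemDiagram p ℓ} {l : List (ℝ × Kind)}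
    (hl : IsCloseTuple Y i δ l) : l.Pairwise fun a b => a.1 < b.1 := by
  have : IsTrans (ℝ × Kind) fun a b => a.1 < b.1 := ⟨fun _ _ _ h h' => h.trans h'⟩
  rw [← List.isChain_iff_pairwise]
  exact hl.2.2.imp fun _ _ h => h.2.1

open Classical in
theorem IsCloseTuple.length_le {Y : IdemDiagram p ℓ} {l : List (ℝ × Kind)}
    (hl : IsCloseTuple Y i δ l) :
    l.length ≤ (Y.solid.image Y.ghost ∪ Y.solid.image Prod.fst).card := by
  rw [← List.length_map (f := Prod.fst)]
  refine length_le_card_of_nodup _ ?_ ?_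
  · rw [List.nodup_iff_pairwise_ne, List.pairwise_map]
    exact hl.pairwise.imp fun h => h.ne
  · intro x hx
    obtain ⟨a, ha, rfl⟩ := List.mem_map.1 hx
    rw [Finset.mem_union, Finset.mem_image, Finset.mem_image]
    rcases hl.2.1 a ha with ⟨-, s, hs, -, h⟩ | ⟨-, h⟩
    · exact Or.inl ⟨s, hs, h.symm⟩
    · exact Or.inr ⟨_, h, rfl⟩

/-- Neighbours in a close tuple come from one component and one strip diagonal, and this is passed
along the chain. -/
theorem IsCloseTuple.node_eq (hp : (1 : ZMod p) ≠ 0) (h0 : 0 < η) (hδ0 : 0 ≤ δ)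
    (h1 : 2 * (size Λ : ℝ) * hatLevel p Λ * η < 1) (hδ : 2 * (hatLevel p Λ : ℝ) * δ ≤ 1)
    {l : List (ℝ × Kind)} (hl : IsCloseTuple (idem (fun _ => 1) κ ρ η Λ) i δ l)
    {a b : ℝ × Kind} (hal : a ∈ l) (hbl : b ∈ l) {m m' : Fin ℓ} {A A' : ℕ × ℕ}
    (ha : IsTupleNode κ ρ η Λ i a m A) (hb : IsTupleNode κ ρ η Λ i b m' A') :
    m = m' ∧ stripContent (ρ m) i A = stripContent (ρ m') i A' := by
  -- The existence of nodes is part of the relation since transitivity needs a node for the middle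
  -- string.
  let T : ℝ × Kind → ℝ × Kind → Prop := fun a b =>
    (∃ m A, IsTupleNode κ ρ η Λ i a m A) ∧ (∃ m A, IsTupleNode κ ρ η Λ i b m A) ∧
      ∀ m A m' A', IsTupleNode κ ρ η Λ i a m A → IsTupleNode κ ρ η Λ i b m' A' →
        m = m' ∧ stripContent (ρ m) i A = stripContent (ρ m') i A'
  have hclose : ∀ a ∈ l, ∀ b ∈ l, |a.1 - b.1| ≤ δ → T a b := fun a ha b hb hab =>
    ⟨(mem_tupleStrings hp).1 (hl.2.1 a ha), (mem_tupleStrings hp).1 (hl.2.1 b hb),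
      fun m A m' A' h h' => h.eq_of_close h0 h1 hδ h' hab⟩
  have htrans : IsTrans _ T := by
    refine ⟨fun a b c hab hbc => ⟨hab.1, hbc.2.1, fun m A m' A' ha hc => ?_⟩⟩
    obtain ⟨m'', A'', hb⟩ := hab.2.1
    obtain ⟨rfl, h3⟩ := hab.2.2 _ _ _ _ ha hb
    obtain ⟨rfl, h4⟩ := hbc.2.2 _ _ _ _ hb hc
    exact ⟨rfl, h3.trans h4⟩
  have hsymm : Std.Symm T := by
    refine ⟨fun a b h => ⟨h.2.1, h.1, fun m A m' A' ha hb => ?_⟩⟩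
    obtain ⟨h3, h4⟩ := h.2.2 _ _ _ _ hb ha
    exact ⟨h3.symm, h4.symm⟩
  have hchain : l.IsChain T := by
    refine hl.2.2.imp_of_mem_imp fun a b ha hb hab => hclose a ha b hb ?_
    rw [abs_sub_comm, abs_of_pos (by linarith [hab.2.1])]
    exact hab.2.2
  rw [List.isChain_iff_pairwise] at hchain
  have hT : T a b := by
    rcases eq_or_ne a b with rfl | hne
    · exact hclose a hal a hal (by simpa using hδ0)
    · exact hchain.forall hal hbl hne
  exact hT.2.2 _ _ _ _ ha hb

/-- The counterpart of `IsMaxStrip.head_eq`. A predecessor in a strip has `c + r` smaller by one, so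
its string is `η ≤ δ` further to the right and would extend the tuple. -/
theorem IsMaxCloseTuple.last_eq (hp : (1 : ZMod p) ≠ 0) (h0 : 0 < η) (hηδ : η ≤ δ)
    {l : List (ℝ × Kind)} (hl : IsMaxCloseTuple (idem (fun _ => 1) κ ρ η Λ) i δ l)
    {a : ℝ × Kind} (ha : l.getLast? = some a) {m : Fin ℓ} {A : ℕ × ℕ}
    (hA : IsTupleNode κ ρ η Λ i a m A) :
    (res p (ρ m) A = i → A.1 = 0) ∧ (res p (ρ m) A = i + 1 → A.2 = 0) := by
  have key : ∀ B : ℕ × ℕ, B ≤ A → B.2 + B.1 + 1 = A.2 + A.1 →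
      (res p (ρ m) B = i ∨ res p (ρ m) B = i + 1) → (res p (ρ m) B = i ↔ res p (ρ m) A ≠ i) →
      stripContent (ρ m) i B = stripContent (ρ m) i A → False := by
    intro B hBA hdist hres hne hcont
    classical
    let b : ℝ × Kind := (gridPos (hatLevel p Λ) η m (κ m + stripContent (ρ m) i B + 1) B,
      if res p (ρ m) B = i then Kind.ghost else Kind.solid)
    have hb : IsTupleNode κ ρ η Λ i b m B := ⟨(Λ m).isLowerSet hBA hA.1, hres, rfl⟩
    have hba : b.1 = a.1 + η := by
      have h1 : ((B.2 : ℝ) + B.1 + 1) = A.2 + A.1 := by exact_mod_cast hdist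
      rw [hA.2.2]
      simp only [b, gridPos, hcont]
      linear_combination (-η) * h1
    have h := hl.2 (l ++ [b]) ⟨by simp, ?_, ?_⟩ (List.sublist_append_left _ _)
    · simpa using congrArg List.length h
    · intro c hc
      rcases List.mem_append.1 hc with hc | hc
      · exact hl.1.2.1 c hc
      · rw [List.mem_singleton.1 hc, mem_tupleStrings hp]; exact ⟨m, B, hb⟩
    · refine List.IsChain.append hl.1.2.2 (List.isChain_singleton _) ?_
      intro x hx y hy
      rw [ha] at hx
      simp only [Option.mem_def, Option.some.injEq, List.head?_cons] at hx hy
      subst hx hy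
      refine ⟨?_, by linarith, by linarith⟩
      rw [hA.2.2]
      simp only [b]
      by_cases h3 : res p (ρ m) A = i
      · rw [if_pos h3, if_neg (fun h => (hne.1 h) h3)]; simp
      · rw [if_neg h3, if_pos (hne.2 h3)]; simp
  constructor
  · intro h
    by_contra hr0
    obtain ⟨r, hr⟩ := Nat.exists_eq_succ_of_ne_zero hr0
    have h' : res p (ρ m) (r, A.2) = i + 1 := by
      rw [← h]; simp only [res, hr]; push_cast; ring
    have hne : res p (ρ m) (r, A.2) ≠ i := by rw [h']; simpa using hp
    refine key (r, A.2) ⟨by simp only; omega, le_rfl⟩ (by simp only; omega) (Or.inr h')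
      ⟨fun h => absurd h hne, fun h2 => absurd h h2⟩ ?_
    rw [stripContent, stripContent, if_neg hne, if_pos h]
    simp only [content, hr]; push_cast; ring
  · intro h
    by_contra hc0
    obtain ⟨c, hc⟩ := Nat.exists_eq_succ_of_ne_zero hc0
    have h' : res p (ρ m) (A.1, c) = i := by
      simp only [res, hc] at h ⊢; push_cast at h; linear_combination h
    have hne : res p (ρ m) A ≠ i := by rw [h]; simpa using hp
    refine key (A.1, c) ⟨le_rfl, by simp only; omega⟩ (by simp only; omega) (Or.inl h')
      ⟨fun _ => hne, fun _ => h'⟩ ?_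
    rw [stripContent, stripContent, if_pos h', if_neg hne]
    simp only [content, hc]; push_cast; ring

theorem inTupleFrom_iff (hp : (1 : ZMod p) ≠ 0) (h0 : 0 < η) (hηδ : η ≤ δ)
    (h1 : 2 * (size Λ : ℝ) * hatLevel p Λ * η < 1) (hδ : 2 * (hatLevel p Λ : ℝ) * δ ≤ 1)
    {m : Fin ℓ} {A : ℕ × ℕ} (hA : A ∈ Λ m) {k : Kind} :
    InTupleFrom (idem (fun _ => 1) κ ρ η Λ) i δ k
        (gridPos (hatLevel p Λ) η m (κ m + content A) A, res p (ρ m) A) ↔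
      res p (ρ m) A = i ∧ k = if 0 ≤ content A then Kind.ghost else Kind.solid := by
  classical
  have hs : res p (ρ m) A = i → IsTupleNode κ ρ η Λ i ((idem (fun _ => 1) κ ρ η Λ).ghost
      (gridPos (hatLevel p Λ) η m (κ m + content A) A, res p (ρ m) A), Kind.ghost) m A := by
    intro h
    refine ⟨hA, Or.inl h, ?_⟩
    rw [if_pos h, stripContent, if_pos h]
    simp only [IdemDiagram.ghost, idem, gridPos]
    congr 1
    push_cast; ring
  have key : ∀ (l : List (ℝ × Kind)) (a : ℝ × Kind),
      IsMaxCloseTuple (idem (fun _ => 1) κ ρ η Λ) i δ l → ((idem (fun _ => 1) κ ρ η Λ).ghost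
      (gridPos (hatLevel p Λ) η m (κ m + content A) A, res p (ρ m) A), Kind.ghost) ∈ l →
      l.getLast? = some a → res p (ρ m) A = i →
      a.2 = if 0 ≤ content A then Kind.ghost else Kind.solid := by
    intro l a hl hsl ha hres
    have hal : a ∈ l := List.mem_of_getLast? ha
    obtain ⟨m', A', hA'⟩ := (mem_tupleStrings hp).1 (hl.1.2.1 a hal)
    obtain ⟨rfl, h3⟩ := hl.1.node_eq hp h0 (h0.le.trans hηδ) h1 hδ hsl hal (hs hres) hA'
    have h4 := hl.last_eq hp h0 hηδ ha hA'
    rw [stripContent, if_pos hres, stripContent] at h3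
    rw [hA'.2.2]
    rcases hA'.2.1 with h | h
    · rw [if_pos h] at h3 ⊢
      have := h4.1 h
      rw [if_pos]
      unfold content at *; omega
    · have h' : res p (ρ m) A' ≠ i := by rw [h]; simpa using hp
      rw [if_neg h'] at h3 ⊢
      have := h4.2 h
      rw [if_neg]
      unfold content at *; omega
  constructor
  · rintro ⟨hres, l, hl, hsl, x, hx⟩
    exact ⟨hres, key l _ hl hsl hx hres⟩
  · rintro ⟨hres, rfl⟩
    obtain ⟨l, hl1, hl2, hl3⟩ := exists_maximal_list
      (IsCloseTuple (idem (fun _ => 1) κ ρ η Λ) i δ) List.Sublist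
      (fun l => List.Sublist.refl l) (fun _ _ _ => List.Sublist.trans) (fun _ _ h => h)
      _ (fun l => IsCloseTuple.length_le) [((idem (fun _ => 1) κ ρ η Λ).ghost
      (gridPos (hatLevel p Λ) η m (κ m + content A) A, res p (ρ m) A), Kind.ghost)]
      ⟨by simp, by
        intro a ha
        rw [List.mem_singleton.1 ha, mem_tupleStrings hp]
        exact ⟨m, A, hs hres⟩, List.isChain_singleton _⟩
    have hsl := hl2.subset (List.mem_singleton_self _)
    obtain ⟨a, ha⟩ : ∃ a, l.getLast? = some a :=
      ⟨_, List.getLast?_eq_some_getLast hl1.1⟩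
    refine ⟨hres, l, ⟨hl1, hl3⟩, hsl, a.1, ?_⟩
    rw [ha, ← key l a ⟨hl1, hl3⟩ hsl ha hres]

end

/-! ### The strings before and after subdivision -/

section
variable {p : ℕ} {a : ℤ}

theorem isNew_succ_of_isNew (hp : 0 < p) {x : ℤ} (hx : IsNew p a x) : ¬ IsNew p a (x + 1) := by
  rintro h
  have h1 : ((p : ℤ) + 1) ∣ 1 := by
    have := dvd_sub h hx
    rwa [show x + 1 - a - 1 - (x - a - 1) = 1 by ring] at this
  have := Int.le_of_dvd one_pos h1
  omega

theorem not_isNew_zero (ha : 0 ≤ a) (hap : a < p) : ¬ IsNew p a 0 := by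
  intro h
  have h1 : ((p : ℤ) + 1) ∣ a + 1 := by
    have := (dvd_neg (α := ℤ)).2 h
    rwa [show -(0 - a - 1) = a + 1 by ring] at this
  have := Int.le_of_dvd (by omega) h1
  omega

/-- The side on which a string is inserted can therefore be read off the content in either
partition. -/
theorem oldContent_nonneg_iff (ha : 0 ≤ a) (hap : a < p) (x : ℤ) :
    0 ≤ oldContent p a x ↔ 0 ≤ x := by
  refine ⟨fun h => ?_, oldContent_nonneg ha hap⟩
  by_contra hx
  have h1 := oldContent_succ p a (-1)
  rw [show (-1 : ℤ) + 1 = 0 by norm_num, if_neg (not_isNew_zero ha hap),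
    oldContent_zero ha hap] at h1
  have h2 : oldContent p a x ≤ oldContent p a (-1) := oldContent_mono (by omega)
  omega

theorem isNew_inj (hp : 0 < p) {x y : ℤ} (hx : IsNew p a x) (hy : IsNew p a y)
    (h : oldContent p a x = oldContent p a y) : x = y := by
  rw [← (dvd_oldContent_of_isNew hp hx).2, h, (dvd_oldContent_of_isNew hp hy).2]

theorem not_isNew_inj (hp : 0 < p) {x y : ℤ} (hx : ¬ IsNew p a x) (hy : ¬ IsNew p a y)
    (h : oldContent p a x = oldContent p a y) : x = y := by
  rw [← newContent_oldContent hp hx, h, newContent_oldContent hp hy]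

theorem newShift_eq (hp : 0 < p) {x : ℤ} (hx : ¬ IsNew p a x) :
    newShift p a x = resCount p a (oldContent p a x) := by
  have h1 := resCount_isNew p a x
  rw [if_neg hx, add_zero] at h1
  unfold newShift
  rw [h1]
  conv_lhs => rw [← newContent_oldContent hp hx]
  rw [resCount_newContent hp]

theorem newShift_eq_of_isNew (hp : 0 < p) {x : ℤ} (hx : IsNew p a x) :
    newShift p a x = resCount p a (oldContent p a x) := by
  obtain ⟨h1, h2⟩ := dvd_oldContent_of_isNew hp hx
  have h3 := newShift_succ (p := p) (a := a) (newContent p a (oldContent p a x))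
  rw [if_neg (not_isNew_newContent hp _), add_zero, h2,
    newShift_eq hp (not_isNew_newContent hp _), oldContent_newContent hp] at h3
  exact h3

/-- The count equals that of class members before the old content or, for the ghost of an inserted
string, before its successor; members are at least two apart. -/
theorem newShift_bounds (hp : 2 ≤ p) (ha : 0 ≤ a) (hap : a < p) (x : ℤ) (g : Bool) :
    2 * newShift p a (x + g.toNat) ≤ |oldContent p a x| + 2 ∧
      -(2 * newShift p a (x + g.toNat)) ≤ |oldContent p a x| + 1 := by
  have hp0 : 0 < p := by omega
  have key : newShift p a (x + g.toNat) = resCount p a (oldContent p a x) ∨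
      newShift p a (x + g.toNat) = resCount p a (oldContent p a x + 1) := by
    have h0 : newShift p a x = resCount p a (oldContent p a x) := by
      by_cases hx : IsNew p a x
      · exact newShift_eq_of_isNew hp0 hx
      · exact newShift_eq hp0 hx
    cases g
    · left; simpa using h0
    · rw [Bool.toNat_true, Nat.cast_one, newShift_succ, h0]
      by_cases hx : IsNew p a x
      · right
        rw [if_pos hx, resCount_succ hp0, if_pos (dvd_oldContent_of_isNew hp0 hx).1]
      · left; rw [if_neg hx, add_zero]
  rcases le_or_gt 0 (oldContent p a x) with h | h
  · rw [abs_of_nonneg h]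
    have h1 := two_mul_resCount_le hp ha h
    have h2 := resCount_nonneg ha hap h
    have h3 := two_mul_resCount_le hp ha (by omega : 0 ≤ oldContent p a x + 1)
    have h4 := resCount_nonneg ha hap (by omega : 0 ≤ oldContent p a x + 1)
    rcases key with k | k <;> rw [k] <;> constructor <;> omega
  · rw [abs_of_neg h]
    have h1 := neg_two_mul_resCount_le hp hap h.le
    have h2 := resCount_nonpos ha hap h.le
    have h3 := neg_two_mul_resCount_le hp hap (by omega : oldContent p a x + 1 ≤ 0)
    have h4 := resCount_nonpos ha hap (by omega : oldContent p a x + 1 ≤ 0)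
    rcases key with k | k <;> rw [k] <;> constructor <;> omega

/-- The least nonnegative new content is `a + 1 ≥ 1`, so an old content precedes it. -/
theorem one_le_baseShift (ha : 0 ≤ a) {x : ℤ} (h : 1 ≤ newShift p a x) :
    1 ≤ baseShift p a x := by
  obtain ⟨h1, -⟩ := resCount_spec (by omega : 0 < p + 1) (a + 1) x
  unfold newShift at h
  unfold baseShift
  push_cast at h1
  have : (0 : ℤ) ≤ p := Int.natCast_nonneg p
  nlinarith

open Classical in
/-- The displacement of an inserted string (or of its ghost) from the ghost next to which it is
inserted. -/
def nudge (p : ℕ) (a : ℤ) (t ε : ℝ) (x : ℤ) (g : Bool) : ℝ :=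
  if IsNew p a x then (if 0 ≤ x then -t else t) + (if g then ε else 0) else 0

/-- `c + r + 2` for the node from which `B` arises. -/
def oldHeight (p : ℕ) (a : ℤ) (B : ℕ × ℕ) : ℤ := 2 * depth B + |oldContent p a (content B)| + 2

/-- `c + r + 2` for the node `B = (r, c)`. -/
def height (B : ℕ × ℕ) : ℤ := 2 * depth B + |content B| + 2

theorem abs_nudge_lt {η t ε : ℝ} (ht : 0 < t) (hε : 0 < ε) (h : t + ε < η) (x : ℤ) (g : Bool) :
    |nudge p a t ε x g| < η := by
  unfold nudge
  rw [abs_lt]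
  split_ifs <;> constructor <;> linarith

end

/-- The position of the string (for `g = false`) or ghost string of the subdivided diagram that
corresponds to the node `B` in component `m`. -/
def subdivPos {ℓ : ℕ} (p h : ℕ) (κ : Fin ℓ → ℤ) (a : Fin ℓ → ℤ) (η t ε : ℝ) (m : Fin ℓ)
    (B : ℕ × ℕ) (g : Bool) : ℝ :=
  ((κ m + baseShift p (a m) (content B + g.toNat) : ℤ) : ℝ) - ((m : ℝ) + 1) / h
    - (oldHeight p (a m) B * η - nudge p (a m) t ε (content B) g)

/-- The position of the string (for `g = false`) or ghost string of the diagram of the subdivided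
multipartition that corresponds to the node `B` in component `m`. -/
def plusPos {ℓ : ℕ} (p h : ℕ) (κ : Fin ℓ → ℤ) (a : Fin ℓ → ℤ) (ε η : ℝ) (m : Fin ℓ)
    (B : ℕ × ℕ) (g : Bool) : ℝ :=
  ((κ m + baseShift p (a m) (content B + g.toNat) : ℤ) : ℝ) - ((m : ℝ) + 1) / h
    - (height B * η - newShift p (a m) (content B + g.toNat) * ε)

/-- The assumptions on the parameters of the diagrams, for a quiver with `p` vertices. -/
structure Params (p ℓ : ℕ) (lam lamPlus : Fin ℓ → YoungDiagram) (a : Fin ℓ → ℤ)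
    (η t ε η' : ℝ) : Prop where
  two_le : 2 ≤ p
  nonneg : ∀ m, 0 ≤ a m
  lt : ∀ m, a m < p
  mem_iff : ∀ m A, A ∈ lamPlus m ↔ collapse p (a m) A ∈ lam m
  size_le : size lamPlus ≤ 2 * size lam
  η_pos : 0 < η
  η_lt : 2 * (size lam : ℝ) * hatLevel p lam * η < 1
  t_pos : 0 < t
  ε_pos : 0 < ε
  t_ne : t ≠ ε
  add_lt : t + ε < η
  η'_pos : 0 < η'
  η'_lt : 2 * (size lamPlus : ℝ) * hatLevel (p + 1) lamPlus * η' < ε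

/-! ### The order of the strings within each diagram -/

namespace Params
variable {p ℓ : ℕ} {lam lamPlus : Fin ℓ → YoungDiagram} {a : Fin ℓ → ℤ} {η t ε η' : ℝ}
  {m m' : Fin ℓ} {B B' : ℕ × ℕ} {g g' : Bool} {κ : Fin ℓ → ℤ}

theorem oldHeight_le (H : Params p ℓ lam lamPlus a η t ε η') (hB : B ∈ lamPlus m) :
    2 ≤ oldHeight p (a m) B ∧ oldHeight p (a m) B ≤ (lam m).card + 1 := by
  have h1 := add_lt_card ((H.mem_iff m B).1 hB)
  have h2 := add_eq_depth (collapse p (a m) B)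
  simp only [collapse, depth_node, content_node] at h1 h2
  have h3 := abs_nonneg (oldContent p (a m) (content B))
  unfold oldHeight
  omega

theorem height_le (hB : B ∈ lamPlus m) : 2 ≤ height B ∧ height B ≤ (lamPlus m).card + 1 := by
  have h1 := add_lt_card hB
  have h2 := add_eq_depth B
  have h3 := abs_nonneg (content B)
  unfold height
  omega

theorem one_le_size (H : Params p ℓ lam lamPlus a η t ε η') (hB : B ∈ lamPlus m) :
    1 ≤ size lam := by
  have h1 := H.oldHeight_le hB
  have h2 := card_le_size lam m
  omega

theorem ε_mul_lt (H : Params p ℓ lam lamPlus a η t ε η') (hn : 1 ≤ size lam) :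
    ε * (2 * size lam * hatLevel p lam) < 1 := by
  have h1 : ε ≤ η := by linarith [H.add_lt, H.t_pos]
  have h2 : (0 : ℝ) ≤ 2 * size lam * hatLevel p lam := by positivity
  have := mul_le_mul_of_nonneg_right h1 h2
  linarith [H.η_lt]

/-- With `n = size lam` this is `ℓ + 2n(p + 1) + 2ℓ ≤ 3(ℓ + np)`, true because `p ≥ 2`. -/
theorem hatLevel_plus_le (H : Params p ℓ lam lamPlus a η t ε η') :
    hatLevel (p + 1) lamPlus + 2 * ℓ ≤ 3 * hatLevel p lam := by
  have h1 := H.size_le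
  have h2 := H.two_le
  unfold hatLevel
  have h3 : size lamPlus * (p + 1) ≤ 2 * size lam * (p + 1) := Nat.mul_le_mul_right _ h1
  have h4 : size lam * 2 ≤ size lam * p := Nat.mul_le_mul_left _ h2
  linarith

/-- Heights differ by at most `n - 1`, displacements by less than `2η`, and `(n + 1)η ≤ 2nη`. -/
theorem abs_offset_lt (H : Params p ℓ lam lamPlus a η t ε η') (hB : B ∈ lamPlus m)
    (hB' : B' ∈ lamPlus m') (x x' : ℤ) :
    |(oldHeight p (a m) B * η - nudge p (a m) t ε x g)
      - (oldHeight p (a m') B' * η - nudge p (a m') t ε x' g')| * hatLevel p lam < 1 := by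
  have h1 := H.oldHeight_le hB
  have h1' := H.oldHeight_le hB'
  have h2 := card_le_size lam m
  have h2' := card_le_size lam m'
  have hn := H.one_le_size hB
  have q1 := abs_nudge_lt (a := a m) (p := p) H.t_pos H.ε_pos H.add_lt x g
  have q2 := abs_nudge_lt (a := a m') (p := p) H.t_pos H.ε_pos H.add_lt x' g'
  have h3 : |oldHeight p (a m) B - oldHeight p (a m') B'| ≤ (size lam : ℤ) - 1 := by
    rw [abs_le]; constructor <;> omega
  have h3' : |(oldHeight p (a m) B : ℝ) - oldHeight p (a m') B'| ≤ (size lam : ℝ) - 1 := by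
    exact_mod_cast h3
  have h4 : |(oldHeight p (a m) B * η - nudge p (a m) t ε x g)
      - (oldHeight p (a m') B' * η - nudge p (a m') t ε x' g')| ≤ 2 * size lam * η := by
    have e1 : (oldHeight p (a m) B * η - nudge p (a m) t ε x g)
      - (oldHeight p (a m') B' * η - nudge p (a m') t ε x' g')
      = ((oldHeight p (a m) B : ℝ) - oldHeight p (a m') B') * η
        + (nudge p (a m') t ε x' g' - nudge p (a m) t ε x g) := by ring
    have e2 := abs_add_le (((oldHeight p (a m) B : ℝ) - oldHeight p (a m') B') * η)
      (nudge p (a m') t ε x' g' - nudge p (a m) t ε x g)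
    have e3 := abs_sub (nudge p (a m') t ε x' g') (nudge p (a m) t ε x g)
    have e4 : |((oldHeight p (a m) B : ℝ) - oldHeight p (a m') B') * η|
        ≤ ((size lam : ℝ) - 1) * η := by
      rw [abs_mul, abs_of_pos H.η_pos]
      exact mul_le_mul_of_nonneg_right h3' H.η_pos.le
    have hn' : (1 : ℝ) ≤ size lam := by exact_mod_cast hn
    rw [e1]
    nlinarith [H.η_pos]
  have h5 : (0 : ℝ) ≤ hatLevel p lam := Nat.cast_nonneg _
  have := mul_le_mul_of_nonneg_right h4 h5
  linarith [H.η_lt]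

theorem subdivPos_lt_of_lex (H : Params p ℓ lam lamPlus a η t ε η') (hB : B ∈ lamPlus m)
    (hB' : B' ∈ lamPlus m')
    (hlex : κ m' + baseShift p (a m') (content B' + g'.toNat)
        < κ m + baseShift p (a m) (content B + g.toNat) ∨
      (κ m + baseShift p (a m) (content B + g.toNat)
        = κ m' + baseShift p (a m') (content B' + g'.toNat) ∧ m < m')) :
    subdivPos p (hatLevel p lam) κ a η t ε m' B' g'
      < subdivPos p (hatLevel p lam) κ a η t ε m B g :=
  lt_of_lex (le_hatLevel p lam) (H.abs_offset_lt hB hB' _ _) hlex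

theorem abs_height_sub_lt (H : Params p ℓ lam lamPlus a η t ε η') (hB : B ∈ lamPlus m)
    (hB' : B' ∈ lamPlus m') :
    2 * (|(height B : ℝ) - height B'| * η' * hatLevel (p + 1) lamPlus) < ε := by
  have h1 := height_le hB
  have h1' := height_le hB'
  have h2 := card_le_size lamPlus m
  have h2' := card_le_size lamPlus m'
  have h3 : |height B - height B'| ≤ (size lamPlus : ℤ) := by
    rw [abs_le]; constructor <;> omega
  have h3' : |(height B : ℝ) - height B'| ≤ (size lamPlus : ℝ) := by exact_mod_cast h3
  have h5 : (0 : ℝ) ≤ hatLevel (p + 1) lamPlus := Nat.cast_nonneg _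
  have h6 := mul_le_mul_of_nonneg_right (mul_le_mul_of_nonneg_right h3' H.η'_pos.le) h5
  linarith [H.η'_lt]

/-- The summand `1 / 2` leaves room for the heights, which contribute less than `ε / 2` by
`abs_height_sub_lt`. -/
theorem newShift_mul_lt (H : Params p ℓ lam lamPlus a η t ε η') (hn : 1 ≤ size lam) (hℓ : 1 ≤ ℓ)
    {v : ℤ} (hv0 : 0 ≤ v) (hv : 3 * v ≤ 2 * size lam) :
    ε * (v * hatLevel (p + 1) lamPlus + 1 / 2) < 1 := by
  have h1 := H.ε_mul_lt hn
  have h2 := H.hatLevel_plus_le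
  have h3 : (hatLevel (p + 1) lamPlus : ℤ) ≤ 3 * hatLevel p lam - 1 := by omega
  have h4 : 1 ≤ hatLevel p lam := hℓ.trans (le_hatLevel p lam)
  have h5 : 2 * (v * hatLevel (p + 1) lamPlus) + 1 ≤ 2 * (2 * size lam * hatLevel p lam : ℤ) := by
    have a1 : v * (hatLevel (p + 1) lamPlus : ℤ) ≤ v * (3 * hatLevel p lam - 1) :=
      mul_le_mul_of_nonneg_left h3 hv0
    have a2 : 3 * v * (hatLevel p lam : ℤ) ≤ 2 * size lam * hatLevel p lam :=
      mul_le_mul_of_nonneg_right hv (Int.natCast_nonneg _)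
    have a3 : (1 : ℤ) * 1 ≤ size lam * hatLevel p lam := by
      apply mul_le_mul <;> omega
    rcases eq_or_lt_of_le hv0 with rfl | h
    · linarith
    · linarith
  have h6 : 2 * ((v : ℝ) * hatLevel (p + 1) lamPlus) + 1 ≤ 2 * (2 * size lam * hatLevel p lam) := by
    exact_mod_cast h5
  have h7 : (v : ℝ) * hatLevel (p + 1) lamPlus + 1 / 2 ≤ 2 * size lam * hatLevel p lam := by linarith
  have := mul_le_mul_of_nonneg_left h7 H.ε_pos.le
  linarith

theorem newShift_le (H : Params p ℓ lam lamPlus a η t ε η') (hB : B ∈ lamPlus m) (g : Bool) :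
    2 * newShift p (a m) (content B + g.toNat) ≤ (lam m).card + 1 ∧
      -(2 * newShift p (a m) (content B + g.toNat)) ≤ (lam m).card := by
  have h1 := newShift_bounds H.two_le (H.nonneg m) (H.lt m) (content B) g
  have h2 := H.oldHeight_le hB
  unfold oldHeight at h2
  omega

/-- Two nonempty components give `n ≥ 2` and `|v - v'| ≤ (n + 1) / 2`, hence `3|v - v'| ≤ 2n` by
integrality. The factor `3` pays for the growth of `hatLevel`. -/
theorem plusPos_lt_of_lex (H : Params p ℓ lam lamPlus a η t ε η') (hB : B ∈ lamPlus m)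
    (hB' : B' ∈ lamPlus m') (hm : m ≠ m')
    (hlex : κ m' + baseShift p (a m') (content B' + g'.toNat)
        < κ m + baseShift p (a m) (content B + g.toNat) ∨
      (κ m + baseShift p (a m) (content B + g.toNat)
        = κ m' + baseShift p (a m') (content B' + g'.toNat) ∧ m < m')) :
    plusPos p (hatLevel (p + 1) lamPlus) κ a ε η' m' B' g'
      < plusPos p (hatLevel (p + 1) lamPlus) κ a ε η' m B g := by
  refine lt_of_lex (le_hatLevel (p + 1) lamPlus) ?_ hlex
  have h1 := H.newShift_le hB g
  have h1' := H.newShift_le hB' g'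
  have h2 := card_add_card_le_size lam hm
  have h3 := H.oldHeight_le hB
  have h3' := H.oldHeight_le hB'
  set v := newShift p (a m) (content B + g.toNat)
  set v' := newShift p (a m') (content B' + g'.toNat)
  have hv : 3 * |v - v'| ≤ 2 * size lam := by
    rcases abs_cases (v - v') with ⟨h, -⟩ | ⟨h, -⟩ <;> rw [h] <;> omega
  have h4 := H.newShift_mul_lt (H.one_le_size hB) (by have := m.2; omega) (abs_nonneg _) hv
  have h5 := H.abs_height_sub_lt hB hB'
  have e1 : (height B * η' - v * ε) - (height B' * η' - v' * ε)
      = ((height B : ℝ) - height B') * η' - ((v : ℝ) - v') * ε := by ring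
  have e2 := abs_sub (((height B : ℝ) - height B') * η') (((v : ℝ) - v') * ε)
  rw [abs_mul, abs_mul, abs_of_pos H.η'_pos, abs_of_pos H.ε_pos] at e2
  have h6 : (0 : ℝ) ≤ hatLevel (p + 1) lamPlus := Nat.cast_nonneg _
  have h7 := mul_le_mul_of_nonneg_right e2 h6
  push_cast at h4
  rw [e1]
  linarith

theorem newShift_le_add {a x x' : ℤ} (h : x < x') :
    baseShift p a x + newShift p a x + 1 ≤ baseShift p a x' + newShift p a x' := by
  unfold baseShift newShift; omega

/-- Within a component each step of the content moves the string right by `1` or by `ε ≤ 1`, and all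
height differences together stay below `ε`. -/
theorem plusPos_lt_of_content_lt (H : Params p ℓ lam lamPlus a η t ε η') (hB : B ∈ lamPlus m)
    (hB' : B' ∈ lamPlus m) (h : content B' + g'.toNat < content B + g.toNat) :
    plusPos p (hatLevel (p + 1) lamPlus) κ a ε η' m B' g'
      < plusPos p (hatLevel (p + 1) lamPlus) κ a ε η' m B g := by
  have h1 := newShift_le_add (p := p) (a := a m) h
  have h2 : baseShift p (a m) (content B' + g'.toNat) ≤ baseShift p (a m) (content B + g.toNat) :=
    baseShift_mono h.le
  have h3 : newShift p (a m) (content B' + g'.toNat) ≤ newShift p (a m) (content B + g.toNat) :=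
    newShift_mono h.le
  have h4 := H.abs_height_sub_lt hB hB'
  have hhat : (1 : ℝ) ≤ hatLevel (p + 1) lamPlus := by
    have := m.2
    have := le_hatLevel (p + 1) lamPlus
    exact_mod_cast (by omega : 1 ≤ hatLevel (p + 1) lamPlus)
  have hn := H.one_le_size hB
  have hε : ε ≤ 1 := by
    have h5 := H.ε_mul_lt hn
    have h6 : (1 : ℝ) ≤ 2 * size lam * hatLevel p lam := by
      have := m.2
      have := le_hatLevel p lam
      have h7 : 1 * 1 ≤ size lam * hatLevel p lam := Nat.mul_le_mul hn (by omega)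
      have h8 : (1 : ℝ) ≤ size lam * hatLevel p lam := by exact_mod_cast h7
      linarith
    nlinarith [H.ε_pos]
  have h5 : |(height B : ℝ) - height B'| * η' < ε := by
    have : 0 ≤ |(height B : ℝ) - height B'| * η' := mul_nonneg (abs_nonneg _) H.η'_pos.le
    nlinarith
  have h6 : ((height B : ℝ) - height B') * η' < ε :=
    lt_of_le_of_lt (mul_le_mul_of_nonneg_right (le_abs_self _) H.η'_pos.le) h5
  unfold plusPos
  set v := newShift p (a m) (content B + g.toNat)
  set v' := newShift p (a m) (content B' + g'.toNat)
  set u := baseShift p (a m) (content B + g.toNat)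
  set u' := baseShift p (a m) (content B' + g'.toNat)
  have h7 : ε ≤ ((u : ℝ) - u') + ((v : ℝ) - v') * ε := by
    have k1 : (u' : ℝ) + v' + 1 ≤ u + v := by exact_mod_cast h1
    have k2 : (u' : ℝ) ≤ u := by exact_mod_cast h2
    have k3 : (v' : ℝ) ≤ v := by exact_mod_cast h3
    nlinarith [H.ε_pos]
  push_cast
  linarith

/-! ### Distinctness -/

theorem subdivPos_inj (H : Params p ℓ lam lamPlus a η t ε η') (hB : B ∈ lamPlus m)
    (hB' : B' ∈ lamPlus m')
    (h : subdivPos p (hatLevel p lam) κ a η t ε m B g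
      = subdivPos p (hatLevel p lam) κ a η t ε m' B' g') : m = m' ∧ B = B' ∧ g = g' := by
  classical
  have hp0 : 0 < p := by have := H.two_le; omega
  have hX : κ m + baseShift p (a m) (content B + g.toNat)
      = κ m' + baseShift p (a m') (content B' + g'.toNat) := by
    rcases lt_trichotomy (κ m + baseShift p (a m) (content B + g.toNat))
      (κ m' + baseShift p (a m') (content B' + g'.toNat)) with h1 | h1 | h1
    · exact absurd h (H.subdivPos_lt_of_lex hB' hB (Or.inl h1)).ne
    · exact h1
    · exact absurd h (H.subdivPos_lt_of_lex hB hB' (Or.inl h1)).ne'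
  have hm : m = m' := by
    rcases lt_trichotomy m m' with h1 | h1 | h1
    · exact absurd h (H.subdivPos_lt_of_lex hB hB' (Or.inr ⟨hX, h1⟩)).ne'
    · exact h1
    · exact absurd h (H.subdivPos_lt_of_lex hB' hB (Or.inr ⟨hX.symm, h1⟩)).ne
  subst hm
  refine ⟨rfl, ?_⟩
  have hU : baseShift p (a m) (content B + g.toNat) = baseShift p (a m) (content B' + g'.toNat) := by
    linarith
  have hq : ((oldHeight p (a m) B : ℝ) - oldHeight p (a m) B') * η
      = nudge p (a m) t ε (content B) g - nudge p (a m) t ε (content B') g' := by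
    unfold subdivPos at h
    rw [hX] at h
    linarith
  have q1 := abs_lt.1 (abs_nudge_lt (a := a m) (p := p) H.t_pos H.ε_pos H.add_lt (content B) g)
  have q2 := abs_lt.1 (abs_nudge_lt (a := a m) (p := p) H.t_pos H.ε_pos H.add_lt (content B') g')
  have hη := H.η_pos
  have hheight : |oldHeight p (a m) B - oldHeight p (a m) B'| ≤ 1 := by
    have h1 : ((oldHeight p (a m) B : ℝ) - oldHeight p (a m) B') < 2 := by nlinarith
    have h2 : (-2 : ℝ) < ((oldHeight p (a m) B : ℝ) - oldHeight p (a m) B') := by nlinarith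
    have h1' : (oldHeight p (a m) B - oldHeight p (a m) B') < 2 := by exact_mod_cast h1
    have h2' : -2 < (oldHeight p (a m) B - oldHeight p (a m) B') := by exact_mod_cast h2
    rw [abs_le]; constructor <;> omega
  -- the strings other than old solid strings lie at the same integer as the next old string
  have hold : ∀ {B : ℕ × ℕ} {g : Bool}, baseShift p (a m) (content B + g.toNat)
      = oldContent p (a m) (content B) + if g = false ∧ ¬ IsNew p (a m) (content B) then 0 else 1 := by
    intro B g
    cases g
    · have := baseShift_eq (p := p) (a := a m) (content B)
      by_cases hn : IsNew p (a m) (content B) <;> simpa [hn] using this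
    · have := baseShift_succ_eq (p := p) (a := a m) (content B)
      simpa using this
  have hnudge0 : ∀ {B : ℕ × ℕ} {g : Bool}, ¬ IsNew p (a m) (content B) →
      nudge p (a m) t ε (content B) g = 0 := fun h => if_neg h
  -- Heights have the parity of the old content. If the old contents differ, they differ by one and
  -- only one string can be displaced; then the heights differ by exactly one, which a displacement
  -- smaller than `η` cannot balance.
  have habs : ∀ B : ℕ × ℕ, ∃ k, |oldContent p (a m) (content B)|
      = oldContent p (a m) (content B) + 2 * k := by
    intro B
    rcases abs_cases (oldContent p (a m) (content B)) with ⟨h, -⟩ | ⟨h, -⟩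
    · exact ⟨0, by omega⟩
    · exact ⟨-oldContent p (a m) (content B), by omega⟩
  obtain ⟨k, hk⟩ := habs B
  obtain ⟨k', hk'⟩ := habs B'
  have hne : oldHeight p (a m) B ≠ oldHeight p (a m) B' →
      oldHeight p (a m) B - oldHeight p (a m) B' = 1 ∨
      oldHeight p (a m) B - oldHeight p (a m) B' = -1 := by
    intro h; rw [abs_le] at hheight; omega
  have hone : ∀ s : ℤ, oldHeight p (a m) B - oldHeight p (a m) B' = s →
      (s : ℝ) * η = nudge p (a m) t ε (content B) g - nudge p (a m) t ε (content B') g' := by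
    rintro s rfl
    rw [← hq]; push_cast; ring
  rw [hold, hold] at hU
  have hcontent : oldContent p (a m) (content B) = oldContent p (a m) (content B') := by
    by_contra hc
    by_cases h1 : g = false ∧ ¬ IsNew p (a m) (content B)
    · rw [if_pos h1] at hU
      rw [hnudge0 h1.2] at hone
      rcases hne (by unfold oldHeight; split_ifs at hU <;> omega) with h2 | h2
      · have := hone _ h2; push_cast at this; linarith
      · have := hone _ h2; push_cast at this; linarith
    · rw [if_neg h1] at hU
      by_cases h1' : g' = false ∧ ¬ IsNew p (a m) (content B')
      · rw [hnudge0 h1'.2] at hone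
        rw [if_pos h1'] at hU
        rcases hne (by unfold oldHeight; omega) with h2 | h2
        · have := hone _ h2; push_cast at this; linarith
        · have := hone _ h2; push_cast at this; linarith
      · rw [if_neg h1'] at hU; omega
  have hdepth : depth B = depth B' := by
    unfold oldHeight at hheight
    rw [hcontent, abs_le] at hheight
    omega
  have hq0 : nudge p (a m) t ε (content B) g = nudge p (a m) t ε (content B') g' := by
    have := hone 0 (by unfold oldHeight; rw [hdepth, hcontent]; ring)
    push_cast at this; linarith
  have ht := H.t_pos
  have hε := H.ε_pos
  have hne := H.t_ne
  -- Here `t ≠ ε` is needed: the ghost of a string inserted on the left is displaced by `ε - t`, and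
  -- for `t = ε` it would lie on the ghost `i`-string.
  have hnew : ∀ {B : ℕ × ℕ} {g : Bool}, IsNew p (a m) (content B) →
      nudge p (a m) t ε (content B) g ≠ 0 := by
    intro B g hB h0
    unfold nudge at h0
    rw [if_pos hB] at h0
    split_ifs at h0
    · exact hne (by linarith)
    · linarith
    · linarith
    · linarith
  have hiff : IsNew p (a m) (content B) ↔ IsNew p (a m) (content B') := by
    constructor <;> intro h1 <;> by_contra h2
    · rw [hnudge0 h2] at hq0; exact hnew h1 hq0
    · rw [hnudge0 h2] at hq0; exact hnew h1 hq0.symm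
  by_cases hn : IsNew p (a m) (content B)
  · have hc := isNew_inj hp0 hn (hiff.1 hn) hcontent
    refine ⟨node_ext hdepth hc, ?_⟩
    rw [← hc] at hq0
    unfold nudge at hq0
    rw [if_pos hn, if_pos hn] at hq0
    cases g <;> cases g' <;> simp at hq0 ⊢ <;> linarith
  · have hc := not_isNew_inj hp0 hn (fun h => hn (hiff.2 h)) hcontent
    refine ⟨node_ext hdepth hc, ?_⟩
    rw [hcontent] at hU
    have hn' : ¬ IsNew p (a m) (content B') := fun h => hn (hiff.2 h)
    cases g <;> cases g' <;> simp [hn, hn'] at hU ⊢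

/-- After components and `content + g` are matched, the heights agree too. Height and content have
the same parity, so `g = g'`. -/
theorem plusPos_inj (H : Params p ℓ lam lamPlus a η t ε η') (hB : B ∈ lamPlus m)
    (hB' : B' ∈ lamPlus m')
    (h : plusPos p (hatLevel (p + 1) lamPlus) κ a ε η' m B g
      = plusPos p (hatLevel (p + 1) lamPlus) κ a ε η' m' B' g') : m = m' ∧ B = B' ∧ g = g' := by
  have hm : m = m' := by
    by_contra hm
    rcases lt_trichotomy (κ m + baseShift p (a m) (content B + g.toNat))
      (κ m' + baseShift p (a m') (content B' + g'.toNat)) with h1 | h1 | h1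
    · exact absurd h (H.plusPos_lt_of_lex hB' hB (Ne.symm hm) (Or.inl h1)).ne
    · rcases lt_or_gt_of_ne hm with h2 | h2
      · exact absurd h (H.plusPos_lt_of_lex hB hB' hm (Or.inr ⟨h1, h2⟩)).ne'
      · exact absurd h (H.plusPos_lt_of_lex hB' hB (Ne.symm hm) (Or.inr ⟨h1.symm, h2⟩)).ne
    · exact absurd h (H.plusPos_lt_of_lex hB hB' hm (Or.inl h1)).ne'
  subst hm
  refine ⟨rfl, ?_⟩
  have hc : content B + g.toNat = content B' + g'.toNat := by
    rcases lt_trichotomy (content B + g.toNat) (content B' + g'.toNat) with h1 | h1 | h1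
    · exact absurd h (H.plusPos_lt_of_content_lt hB' hB h1).ne
    · exact h1
    · exact absurd h (H.plusPos_lt_of_content_lt hB hB' h1).ne'
  have hh : height B = height B' := by
    unfold plusPos at h
    rw [hc] at h
    have : (height B : ℝ) * η' = height B' * η' := by linarith
    exact_mod_cast mul_right_cancel₀ H.η'_pos.ne' this
  have hg : g = g' := by
    unfold height at hh
    rcases abs_cases (content B) with ⟨h1, -⟩ | ⟨h1, -⟩ <;>
    rcases abs_cases (content B') with ⟨h2, -⟩ | ⟨h2, -⟩ <;> rw [h1, h2] at hh <;>
    cases g <;> cases g' <;> simp at hc ⊢ <;> omega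
  subst hg
  have hc' : content B = content B' := by omega
  refine ⟨node_ext ?_ hc', rfl⟩
  unfold height at hh
  rw [hc'] at hh
  omega

end Params

namespace Params
variable {p ℓ : ℕ} {lam lamPlus : Fin ℓ → YoungDiagram} {a : Fin ℓ → ℤ} {η t ε η' : ℝ}
  {m m' : Fin ℓ} {B B' : ℕ × ℕ} {g g' : Bool} {κ : Fin ℓ → ℤ}

/-! ### Comparison with the red strings -/

/-- The total correction lies strictly between `0` and `1`: it is at most `ℓ/h + 3nη` with `h =
hatLevel p lam`, and `3nηh < 3/2 < 2n ≤ h - ℓ`. -/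
theorem subdivPos_red (H : Params p ℓ lam lamPlus a η t ε η') (hB : B ∈ lamPlus m) (c : ℤ) :
    (κ m + baseShift p (a m) (content B + g.toNat) ≤ c →
      subdivPos p (hatLevel p lam) κ a η t ε m B g < c) ∧
    (c < κ m + baseShift p (a m) (content B + g.toNat) →
      c < subdivPos p (hatLevel p lam) κ a η t ε m B g) := by
  have h1 := H.oldHeight_le hB
  have h2 := card_le_size lam m
  have hn := H.one_le_size hB
  have q := abs_lt.1 (abs_nudge_lt (a := a m) (p := p) H.t_pos H.ε_pos H.add_lt (content B) g)
  have hη := H.η_pos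
  have hm : (m : ℝ) + 1 ≤ ℓ := by exact_mod_cast m.2
  have hm0 : (0 : ℝ) ≤ m := Nat.cast_nonneg _
  have hn' : (1 : ℝ) ≤ size lam := by exact_mod_cast hn
  have hk1 : (2 : ℝ) ≤ oldHeight p (a m) B := by exact_mod_cast h1.1
  have hk2 : (oldHeight p (a m) B : ℝ) ≤ size lam + 1 := by
    exact_mod_cast (by omega : oldHeight p (a m) B ≤ size lam + 1)
  have hh : (ℓ : ℝ) + 2 * size lam ≤ hatLevel p lam := by
    have h3 : size lam * 2 ≤ size lam * p := Nat.mul_le_mul_left _ H.two_le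
    have h4 : ℓ + 2 * size lam ≤ hatLevel p lam := by unfold hatLevel; omega
    exact_mod_cast h4
  have hpos : (0 : ℝ) < hatLevel p lam := by linarith
  have hτ0 : 0 < oldHeight p (a m) B * η - nudge p (a m) t ε (content B) g := by nlinarith
  have hdiv0 : 0 < ((m : ℝ) + 1) / hatLevel p lam := by positivity
  have hsum : ((m : ℝ) + 1) / hatLevel p lam
      + (oldHeight p (a m) B * η - nudge p (a m) t ε (content B) g) < 1 := by
    have h3 : oldHeight p (a m) B * η - nudge p (a m) t ε (content B) g ≤ 3 * size lam * η := by
      nlinarith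
    have h4 := mul_le_mul_of_nonneg_right h3 hpos.le
    have h5 := H.η_lt
    have h6 : (((m : ℝ) + 1) / hatLevel p lam
      + (oldHeight p (a m) B * η - nudge p (a m) t ε (content B) g)) * hatLevel p lam
        < 1 * hatLevel p lam := by
      rw [add_mul, div_mul_cancel₀ _ hpos.ne']
      linarith
    exact lt_of_mul_lt_mul_right h6 hpos.le
  unfold subdivPos
  constructor
  · intro h
    have h' : ((κ m + baseShift p (a m) (content B + g.toNat) : ℤ) : ℝ) ≤ c := by exact_mod_cast h
    linarith
  · intro h
    have h' : (c : ℝ) + 1 ≤ ((κ m + baseShift p (a m) (content B + g.toNat) : ℤ) : ℝ) := by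
      exact_mod_cast h
    linarith

/-- For `n = 1` the estimate is `ℓ + 2(p + 1) ≤ 2(ℓ + p)`, which needs `ℓ ≥ 2`; for `n ≥ 2`
integrality gives `3v ≤ 2n`. -/
theorem newShift_mul_le (H : Params p ℓ lam lamPlus a η t ε η') (hB : B ∈ lamPlus m)
    (hℓ : 2 ≤ ℓ) (hv : 0 ≤ newShift p (a m) (content B + g.toNat)) :
    newShift p (a m) (content B + g.toNat) * (hatLevel (p + 1) lamPlus : ℤ)
      ≤ 2 * size lam * hatLevel p lam := by
  have h1 := H.newShift_le hB g
  have h2 := card_le_size lam m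
  have hn := H.one_le_size hB
  have h3 := H.hatLevel_plus_le
  set v := newShift p (a m) (content B + g.toNat)
  rcases eq_or_lt_of_le hn with h | h
  · have hv1 : v ≤ 1 := by omega
    have h4 : hatLevel (p + 1) lamPlus ≤ 2 * hatLevel p lam := by
      have h5 := H.size_le
      have h6 : size lamPlus * (p + 1) ≤ 2 * (p + 1) := Nat.mul_le_mul_right _ (by omega)
      unfold hatLevel
      rw [← h]
      omega
    have h5 : v * (hatLevel (p + 1) lamPlus : ℤ) ≤ 1 * hatLevel (p + 1) lamPlus :=
      mul_le_mul_of_nonneg_right hv1 (Int.natCast_nonneg _)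
    rw [← h]
    push_cast
    omega
  · have hv1 : 3 * v ≤ 2 * size lam := by omega
    have h4 : v * (hatLevel (p + 1) lamPlus : ℤ) ≤ v * (3 * hatLevel p lam) :=
      mul_le_mul_of_nonneg_left (by omega) hv
    have h5 : 3 * v * (hatLevel p lam : ℤ) ≤ 2 * size lam * hatLevel p lam :=
      mul_le_mul_of_nonneg_right hv1 (Int.natCast_nonneg _)
    linarith

/-- Let `h` be the new `hatLevel`. With integer part at most `κ m'`, the term `(m + 1)/h ≥ 1/h`
pulls left at least as far as the `ε`-shifts push right, and the height makes the inequality strict.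
With a larger integer part, `h ≥ ℓ + 3` leaves enough room. -/
theorem plusPos_red (H : Params p ℓ lam lamPlus a η t ε η') (hB : B ∈ lamPlus m) (m' : Fin ℓ) :
    (κ m + baseShift p (a m) (content B + g.toNat) ≤ κ m' →
      plusPos p (hatLevel (p + 1) lamPlus) κ a ε η' m B g < κ m') ∧
    (κ m' < κ m + baseShift p (a m) (content B + g.toNat) →
      κ m' < plusPos p (hatLevel (p + 1) lamPlus) κ a ε η' m B g) := by
  have h1 := height_le hB
  have hn := H.one_le_size hB
  have hv := H.newShift_le hB g
  have hv2 := card_le_size lam m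
  have hn2 := card_le_size lamPlus m
  have hεlt := H.ε_mul_lt hn
  have hη' := H.η'_pos
  have hε := H.ε_pos
  have hm : (m : ℝ) + 1 ≤ ℓ := by exact_mod_cast m.2
  have hm0 : (0 : ℝ) ≤ m := Nat.cast_nonneg _
  have hn1 : 1 ≤ size lamPlus := by omega
  have hpos : (0 : ℝ) < hatLevel (p + 1) lamPlus := by
    have := m.2
    have := le_hatLevel (p + 1) lamPlus
    exact_mod_cast (by omega : 0 < hatLevel (p + 1) lamPlus)
  have hk1 : (2 : ℝ) ≤ height B := by exact_mod_cast h1.1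
  set v := newShift p (a m) (content B + g.toNat) with hvdef
  set u := baseShift p (a m) (content B + g.toNat) with hudef
  have key : (plusPos p (hatLevel (p + 1) lamPlus) κ a ε η' m B g - κ m') * hatLevel (p + 1) lamPlus
      = ((κ m + u - κ m' : ℤ) : ℝ) * hatLevel (p + 1) lamPlus - ((m : ℝ) + 1)
        - height B * η' * hatLevel (p + 1) lamPlus + v * ε * hatLevel (p + 1) lamPlus := by
    unfold plusPos
    rw [← hvdef, ← hudef]
    push_cast
    field_simp
    ring
  constructor
  · intro h
    have hvε : (v : ℝ) * ε * hatLevel (p + 1) lamPlus ≤ 1 := by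
      rcases le_or_gt v 0 with hv0 | hv0
      · have : (v : ℝ) ≤ 0 := by exact_mod_cast hv0
        have := mul_nonpos_of_nonpos_of_nonneg this (mul_nonneg hε.le hpos.le)
        linarith
      · have hm' : m' ≠ m := by
          rintro rfl
          have := one_le_baseShift (H.nonneg m') (x := content B + g.toNat) (by omega : 1 ≤ v)
          omega
        have hℓ : 2 ≤ ℓ := by
          have := m.2; have := m'.2
          have : (m' : ℕ) ≠ m := fun h => hm' (Fin.ext h)
          omega
        have h3 := H.newShift_mul_le hB (g := g) hℓ hv0.le
        have h3' : (v : ℝ) * hatLevel (p + 1) lamPlus ≤ 2 * size lam * hatLevel p lam := by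
          exact_mod_cast h3
        have := mul_le_mul_of_nonneg_left h3' hε.le
        linarith
    have hX : ((κ m + u - κ m' : ℤ) : ℝ) ≤ 0 := by exact_mod_cast (by omega : κ m + u - κ m' ≤ 0)
    have h4 := mul_nonpos_of_nonpos_of_nonneg hX hpos.le
    have h5 : 0 < height B * η' * hatLevel (p + 1) lamPlus := by positivity
    have h6 : (plusPos p (hatLevel (p + 1) lamPlus) κ a ε η' m B g - κ m')
        * hatLevel (p + 1) lamPlus < 0 := by rw [key]; linarith
    have := neg_of_mul_neg_left h6 hpos.le
    linarith
  · intro h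
    have hX : (1 : ℝ) ≤ ((κ m + u - κ m' : ℤ) : ℝ) := by
      exact_mod_cast (by omega : 1 ≤ κ m + u - κ m')
    have h4 := mul_le_mul_of_nonneg_right hX hpos.le
    have hh : (ℓ : ℝ) + 3 ≤ hatLevel (p + 1) lamPlus := by
      have h5 : 1 * 3 ≤ size lamPlus * (p + 1) :=
        Nat.mul_le_mul hn1 (by have := H.two_le; omega)
      have h6 : ℓ + 3 ≤ hatLevel (p + 1) lamPlus := by unfold hatLevel; omega
      exact_mod_cast h6
    have hk2 : (height B : ℝ) ≤ 2 * size lamPlus := by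
      exact_mod_cast (by omega : height B ≤ 2 * size lamPlus)
    have hεhat : ε * (2 * hatLevel p lam) ≤ 1 := by
      have : (1 : ℝ) ≤ size lam := by exact_mod_cast hn
      have h7 : (2 * hatLevel p lam : ℝ) ≤ 2 * size lam * hatLevel p lam := by
        have : (0 : ℝ) ≤ hatLevel p lam := Nat.cast_nonneg _
        nlinarith
      have := mul_le_mul_of_nonneg_left h7 hε.le
      linarith
    have hhat1 : (1 : ℝ) ≤ hatLevel p lam := by
      have := m.2
      have := le_hatLevel p lam
      exact_mod_cast (by omega : 1 ≤ hatLevel p lam)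
    have hkη : height B * η' * hatLevel (p + 1) lamPlus ≤ ε := by
      have h7 : height B * (η' * hatLevel (p + 1) lamPlus)
          ≤ 2 * size lamPlus * (η' * hatLevel (p + 1) lamPlus) :=
        mul_le_mul_of_nonneg_right hk2 (by positivity)
      have h8 := H.η'_lt
      linarith
    have hvε : -(3 / 2) ≤ (v : ℝ) * ε * hatLevel (p + 1) lamPlus := by
      have h8 : -(v * hatLevel (p + 1) lamPlus : ℤ) ≤ size lam * (3 * hatLevel p lam) := by
        have h9 := H.hatLevel_plus_le
        have h10 : (-v) * (hatLevel (p + 1) lamPlus : ℤ) ≤ size lam * hatLevel (p + 1) lamPlus :=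
          mul_le_mul_of_nonneg_right (by omega) (Int.natCast_nonneg _)
        have h11 : (size lam : ℤ) * hatLevel (p + 1) lamPlus ≤ size lam * (3 * hatLevel p lam) :=
          mul_le_mul_of_nonneg_left (by omega) (Int.natCast_nonneg _)
        linarith
      have h8' : -((v : ℝ) * hatLevel (p + 1) lamPlus) ≤ size lam * (3 * hatLevel p lam) := by
        exact_mod_cast h8
      have := mul_le_mul_of_nonneg_left h8' hε.le
      linarith
    have hε1 : ε ≤ 1 / 2 := by nlinarith
    have h6 : 0 < (plusPos p (hatLevel (p + 1) lamPlus) κ a ε η' m B g - κ m')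
        * hatLevel (p + 1) lamPlus := by rw [key]; linarith
    have := pos_of_mul_pos_left h6 hpos.le
    linarith

/-! ### Comparison of the two diagrams -/

theorem sameSign_red (H : Params p ℓ lam lamPlus a η t ε η') (hB : B ∈ lamPlus m) (m' : Fin ℓ) :
    SameSign (subdivPos p (hatLevel p lam) κ a η t ε m B g - κ m')
      (plusPos p (hatLevel (p + 1) lamPlus) κ a ε η' m B g - κ m') := by
  have h1 := H.subdivPos_red hB (g := g) (κ := κ) (κ m')
  have h2 := H.plusPos_red hB (g := g) (κ := κ) m'
  rcases le_or_gt (κ m + baseShift p (a m) (content B + g.toNat)) (κ m') with h | h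
  · exact Or.inr ⟨by linarith [h1.1 h], by linarith [h2.1 h]⟩
  · exact Or.inl ⟨by linarith [h1.2 h], by linarith [h2.2 h]⟩

/-- The integer parts agree, so heights decide. Passing to old heights changes nothing unless `B'`
is inserted and `g = true`: then `B` and `B'` collapse to the same diagonal, the old heights can
tie, and the side of the inserted string replaces the lost difference `±1` of the heights. -/
theorem sameSign_of_content_eq (H : Params p ℓ lam lamPlus a η t ε η')
    (hne : ¬ (B = B' ∧ g = false))
    (hc : content B + g.toNat = content B') :
    SameSign (subdivPos p (hatLevel p lam) κ a η t ε m B g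
        - subdivPos p (hatLevel p lam) κ a η t ε m B' false)
      (plusPos p (hatLevel (p + 1) lamPlus) κ a ε η' m B g
        - plusPos p (hatLevel (p + 1) lamPlus) κ a ε η' m B' false) := by
  classical
  have hp0 : 0 < p := by have := H.two_le; omega
  have hη := H.η_pos
  have hη' := H.η'_pos
  have ht := H.t_pos
  have hε := H.ε_pos
  have hlt := H.add_lt
  have hc0 : content B' + (false.toNat : ℤ) = content B + g.toNat := by simpa using hc.symm
  have e1 : subdivPos p (hatLevel p lam) κ a η t ε m B g
        - subdivPos p (hatLevel p lam) κ a η t ε m B' false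
      = ((oldHeight p (a m) B' - oldHeight p (a m) B : ℤ) : ℝ) * η
        + nudge p (a m) t ε (content B) g - nudge p (a m) t ε (content B') false := by
    unfold subdivPos; rw [hc0]; push_cast; ring
  have e2 : plusPos p (hatLevel (p + 1) lamPlus) κ a ε η' m B g
        - plusPos p (hatLevel (p + 1) lamPlus) κ a ε η' m B' false
      = ((height B' - height B : ℤ) : ℝ) * η' := by
    unfold plusPos; rw [hc0]; push_cast; ring
  rw [e1, e2]
  -- it suffices to compare heights, up to a displacement smaller than the distance of strings
  have fin : ∀ (k k' : ℤ) (q : ℝ), ((1 ≤ k' ∧ 0 < k * η + q) ∨ (k' ≤ -1 ∧ k * η + q < 0)) →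
      SameSign (k * η + q) (k' * η') := by
    rintro k k' q (⟨h1, h2⟩ | ⟨h1, h2⟩)
    · have : (1 : ℝ) ≤ k' := by exact_mod_cast h1
      exact Or.inl ⟨h2, by positivity⟩
    · have : (k' : ℝ) ≤ -1 := by exact_mod_cast h1
      exact Or.inr ⟨h2, by nlinarith⟩
  rw [add_sub_assoc]
  apply fin
  have lin : ∀ (k : ℤ) (c : ℝ), (c : ℝ) ≤ k → c * η ≤ k * η := fun k c h =>
    mul_le_mul_of_nonneg_right h hη.le
  have lin' : ∀ (k : ℤ) (c : ℝ), (k : ℝ) ≤ c → k * η ≤ c * η := fun k c h =>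
    mul_le_mul_of_nonneg_right h hη.le
  -- conclusion from bounds on the heights and on the displacement
  have small : ∀ (k k' : ℤ) (q : ℝ), |q| < η → (1 ≤ k ∧ 1 ≤ k' ∨ k ≤ -1 ∧ k' ≤ -1) →
      ((1 ≤ k' ∧ 0 < k * η + q) ∨ (k' ≤ -1 ∧ k * η + q < 0)) := by
    rintro k k' q hq (⟨h1, h2⟩ | ⟨h1, h2⟩)
    · have := lin k 1 (by exact_mod_cast h1)
      have := (abs_lt.1 hq).1
      exact Or.inl ⟨h2, by linarith⟩
    · have := lin' k (-1) (by exact_mod_cast h1)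
      have := (abs_lt.1 hq).2
      exact Or.inr ⟨h2, by linarith⟩
  have q1 := abs_nudge_lt (a := a m) (p := p) ht hε hlt (content B) g
  have q2 := abs_nudge_lt (a := a m) (p := p) ht hε hlt (content B') false
  have s1 := oldContent_nonneg_iff (H.nonneg m) (H.lt m) (content B)
  have s2 := oldContent_nonneg_iff (H.nonneg m) (H.lt m) (content B + 1)
  have hsucc := oldContent_succ p (a m) (content B)
  have z0 := oldContent_zero (H.nonneg m) (H.lt m)
  cases g
  · have hc' : content B = content B' := by simpa using hc
    have hd : depth B ≠ depth B' := fun h => hne ⟨node_ext h hc', rfl⟩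
    rw [hc', sub_self]
    refine small _ _ _ (by simpa using hη) ?_
    unfold oldHeight height
    rw [hc']
    omega
  · have hc' : content B + 1 = content B' := by simpa using hc
    rw [← hc'] at q2 ⊢
    have hk : oldHeight p (a m) B' - oldHeight p (a m) B = 2 * ((depth B' : ℤ) - depth B)
        + (|oldContent p (a m) (content B + 1)| - |oldContent p (a m) (content B)|) := by
      unfold oldHeight; rw [← hc']; ring
    have hk' : height B' - height B = 2 * ((depth B' : ℤ) - depth B)
        + (|content B + 1| - |content B|) := by
      unfold height; rw [← hc']; ring
    rw [hk, hk']
    have habs : |content B + 1| - |content B| = if 0 ≤ content B then 1 else -1 := by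
      split_ifs with h
      · rw [abs_of_nonneg h, abs_of_nonneg (by omega)]; ring
      · rw [abs_of_neg (by omega : content B < 0), abs_of_nonpos (by omega)]; ring
    rw [habs]
    by_cases hn1 : IsNew p (a m) (content B + 1)
    · have hn : ¬ IsNew p (a m) (content B) := fun h => isNew_succ_of_isNew hp0 h hn1
      have hx : content B + 1 ≠ 0 := by
        intro h; rw [h] at hn1; exact not_isNew_zero (H.nonneg m) (H.lt m) hn1
      rw [if_pos hn1] at hsucc
      have e3 : oldContent p (a m) (content B + 1) = oldContent p (a m) (content B) := by
        rw [hsucc]; ring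
      have e4 : nudge p (a m) t ε (content B) true = 0 := if_neg hn
      have e5 : nudge p (a m) t ε (content B + 1) false = if 0 ≤ content B + 1 then -t else t := by
        unfold nudge; rw [if_pos hn1]; simp
      rw [e3, sub_self, add_zero, e4, e5, zero_sub]
      rcases le_or_gt 0 (content B) with h | h
      · rw [if_pos h, if_pos (by omega), neg_neg]
        -- Equal depths are the tie. The inserted string is to the left of the ghost, in accordance
        -- with its greater height.
        rcases le_or_gt (depth B) (depth B') with hd | hd
        · left
          have := lin (2 * ((depth B' : ℤ) - depth B)) 0 (by
            exact_mod_cast (by omega : 0 ≤ 2 * ((depth B' : ℤ) - depth B)))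
          exact ⟨by omega, by linarith⟩
        · right
          have := lin' (2 * ((depth B' : ℤ) - depth B)) (-2) (by
            exact_mod_cast (by omega : 2 * ((depth B' : ℤ) - depth B) ≤ -2))
          exact ⟨by omega, by linarith⟩
      · rw [if_neg (by omega), if_neg (by omega)]
        -- Below the main diagonal the tie goes the other way: the inserted box has smaller height
        -- and its string is to the right of the ghost.
        rcases lt_or_ge (depth B) (depth B') with hd | hd
        · left
          have := lin (2 * ((depth B' : ℤ) - depth B)) 2 (by
            exact_mod_cast (by omega : 2 ≤ 2 * ((depth B' : ℤ) - depth B)))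
          exact ⟨by omega, by linarith⟩
        · right
          have := lin' (2 * ((depth B' : ℤ) - depth B)) 0 (by
            exact_mod_cast (by omega : 2 * ((depth B' : ℤ) - depth B) ≤ 0))
          exact ⟨by omega, by linarith⟩
    · rw [if_neg hn1] at hsucc
      have e4 : nudge p (a m) t ε (content B + 1) false = 0 := if_neg hn1
      rw [e4, sub_zero]
      refine small _ _ _ q1 ?_
      have habs' : |oldContent p (a m) (content B + 1)| - |oldContent p (a m) (content B)|
          = if 0 ≤ content B then 1 else -1 := by
        split_ifs with h
        · rw [abs_of_nonneg (s1.2 h), abs_of_nonneg (s2.2 (by omega)), hsucc]; ring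
        · have h1 : oldContent p (a m) (content B) < 0 := by
            by_contra h'; exact h (s1.1 (by omega))
          rw [abs_of_neg h1, abs_of_nonpos (by omega), hsucc]; ring
      rw [habs']
      split_ifs <;> omega

/-- In one component the contents agree modulo `p + 1`. If they are not equal, they differ by a full
period at least, which changes the integer part by at least `p`. Different components are ordered
lexicographically in both diagrams. -/
theorem sameSign (H : Params p ℓ lam lamPlus a η t ε η') (hB : B ∈ lamPlus m)
    (hB' : B' ∈ lamPlus m') (hne : ¬ (m = m' ∧ B = B' ∧ g = false))
    (hres : m = m' → ((p : ℤ) + 1) ∣ content B + g.toNat - content B') :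
    SameSign (subdivPos p (hatLevel p lam) κ a η t ε m B g
        - subdivPos p (hatLevel p lam) κ a η t ε m' B' false)
      (plusPos p (hatLevel (p + 1) lamPlus) κ a ε η' m B g
        - plusPos p (hatLevel (p + 1) lamPlus) κ a ε η' m' B' false) := by
  by_cases hm : m = m'
  · subst hm
    have hp2 := H.two_le
    obtain ⟨k, hk⟩ := hres rfl
    rcases lt_trichotomy k 0 with h | h | h
    · have h1 : content B + g.toNat + ((p : ℤ) + 1) ≤ content B' := by nlinarith
      have h2 := baseShift_mono (p := p) (a := a m) h1
      rw [baseShift_add_period] at h2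
      right
      refine ⟨sub_neg.2 (H.subdivPos_lt_of_lex hB' hB (Or.inl ?_)),
        sub_neg.2 (H.plusPos_lt_of_content_lt hB' hB ?_)⟩
      · simp only [Bool.toNat_false, Nat.cast_zero, add_zero]; omega
      · simp only [Bool.toNat_false, Nat.cast_zero, add_zero]; omega
    · rw [h, mul_zero] at hk
      exact H.sameSign_of_content_eq (fun h => hne ⟨rfl, h⟩) (by omega)
    · have h1 : content B' + ((p : ℤ) + 1) ≤ content B + g.toNat := by nlinarith
      have h2 := baseShift_mono (p := p) (a := a m) h1
      rw [baseShift_add_period] at h2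
      left
      refine ⟨sub_pos.2 (H.subdivPos_lt_of_lex hB hB' (Or.inl ?_)),
        sub_pos.2 (H.plusPos_lt_of_content_lt hB hB' ?_)⟩
      · simp only [Bool.toNat_false, Nat.cast_zero, add_zero]; omega
      · simp only [Bool.toNat_false, Nat.cast_zero, add_zero]; omega
  · have hpos : ∀ {m m' : Fin ℓ} {B B' : ℕ × ℕ} {g g' : Bool} (_ : B ∈ lamPlus m)
        (_ : B' ∈ lamPlus m') (_ : m ≠ m'),
        (κ m' + baseShift p (a m') (content B' + g'.toNat)
          < κ m + baseShift p (a m) (content B + g.toNat) ∨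
        (κ m + baseShift p (a m) (content B + g.toNat)
          = κ m' + baseShift p (a m') (content B' + g'.toNat) ∧ m < m')) →
        subdivPos p (hatLevel p lam) κ a η t ε m' B' g'
            < subdivPos p (hatLevel p lam) κ a η t ε m B g ∧
          plusPos p (hatLevel (p + 1) lamPlus) κ a ε η' m' B' g'
            < plusPos p (hatLevel (p + 1) lamPlus) κ a ε η' m B g :=
      fun hB hB' hm h => ⟨H.subdivPos_lt_of_lex hB hB' h, H.plusPos_lt_of_lex hB hB' hm h⟩
    have hmain : (κ m' + baseShift p (a m') (content B' + false.toNat)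
          < κ m + baseShift p (a m) (content B + g.toNat) ∨
        (κ m + baseShift p (a m) (content B + g.toNat)
          = κ m' + baseShift p (a m') (content B' + false.toNat) ∧ m < m')) ∨
        (κ m + baseShift p (a m) (content B + g.toNat)
          < κ m' + baseShift p (a m') (content B' + false.toNat) ∨
        (κ m' + baseShift p (a m') (content B' + false.toNat)
          = κ m + baseShift p (a m) (content B + g.toNat) ∧ m' < m)) := by
      rcases lt_or_gt_of_ne hm with h | h <;> omega
    rcases hmain with h | h
    · obtain ⟨h1, h2⟩ := hpos hB hB' hm h
      exact Or.inl ⟨sub_pos.2 h1, sub_pos.2 h2⟩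
    · obtain ⟨h1, h2⟩ := hpos hB' hB (Ne.symm hm) h
      exact Or.inr ⟨sub_neg.2 h1, sub_neg.2 h2⟩

end Params

/-! ### The strings of the two diagrams -/

section
variable {p ℓ : ℕ} {κ a : Fin ℓ → ℤ} {η t ε : ℝ} {m : Fin ℓ} {B : ℕ × ℕ} {h : ℕ}

theorem oldHeight_eq (p : ℕ) (a : ℤ) (B : ℕ × ℕ) :
    oldHeight p a B = (collapse p a B).2 + (collapse p a B).1 + 2 := by
  rw [add_eq_depth]
  simp [oldHeight, collapse]

theorem height_eq (B : ℕ × ℕ) : height B = B.2 + B.1 + 2 := by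
  rw [add_eq_depth]; rfl

theorem subdivPos_of_not_isNew (hB : ¬ IsNew p (a m) (content B)) :
    subdivPos p h κ a η t ε m B false
      = gridPos h η m (κ m + content (collapse p (a m) B)) (collapse p (a m) B) := by
  have h1 := oldHeight_eq p (a m) B
  have h2 : (oldHeight p (a m) B : ℝ)
      = (collapse p (a m) B).2 + (collapse p (a m) B).1 + 2 := by exact_mod_cast h1
  have h3 := baseShift_eq (p := p) (a := a m) (content B)
  rw [if_neg hB, add_zero] at h3
  have h4 : content (collapse p (a m) B) = oldContent p (a m) (content B) := by simp [collapse]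
  unfold subdivPos gridPos nudge
  rw [if_neg hB, h2, sub_zero, h4, ← h3]
  simp

theorem subdivPos_of_isNew (hB : IsNew p (a m) (content B)) :
    subdivPos p h κ a η t ε m B false
      = gridPos h η m (κ m + content (collapse p (a m) B)) (collapse p (a m) B) + 1
        + if 0 ≤ content B then -t else t := by
  have h1 := oldHeight_eq p (a m) B
  have h2 : (oldHeight p (a m) B : ℝ)
      = (collapse p (a m) B).2 + (collapse p (a m) B).1 + 2 := by exact_mod_cast h1
  have h3 := baseShift_eq (p := p) (a := a m) (content B)
  rw [if_pos hB] at h3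
  have h4 : content (collapse p (a m) B) = oldContent p (a m) (content B) := by simp [collapse]
  unfold subdivPos gridPos nudge
  rw [if_pos hB, h2, h4]
  simp only [Bool.toNat_false, Nat.cast_zero, add_zero, h3]
  push_cast
  ring

open Classical in
theorem subdivPos_true :
    subdivPos p h κ a η t ε m B true = subdivPos p h κ a η t ε m B false
      + if IsNew p (a m) (content B) then ε else 1 := by
  unfold subdivPos nudge
  simp only [Bool.toNat_true, Nat.cast_one, baseShift_succ, Bool.toNat_false, Nat.cast_zero,
    add_zero, if_true, Bool.false_eq_true, if_false]
  split_ifs <;> push_cast <;> ring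

open Classical in
theorem plusPos_true :
    plusPos p h κ a ε η m B true = plusPos p h κ a ε η m B false
      + if IsNew p (a m) (content B) then ε else 1 := by
  unfold plusPos
  simp only [Bool.toNat_true, Nat.cast_one, baseShift_succ, newShift_succ, Bool.toNat_false,
    Nat.cast_zero, add_zero]
  split_ifs <;> push_cast <;> ring

end

section
variable {e ℓ : ℕ} {i : ZMod (e + 1)} {ρ : Fin ℓ → ZMod (e + 1)} {κ : Fin ℓ → ℤ}
  {lam lamPlus : Fin ℓ → YoungDiagram} {η δ t ε η' : ℝ}

/-- The solid string of the subdivided diagram that corresponds to a node of the subdivided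
multipartition. -/
def subdivString (i : ZMod (e + 1)) (ρ : Fin ℓ → ZMod (e + 1)) (κ : Fin ℓ → ℤ)
    (lam lamPlus : Fin ℓ → YoungDiagram) (η t ε : ℝ)
    (j : {j : Fin ℓ × (ℕ × ℕ) // j.2 ∈ lamPlus j.1}) : ℝ × ZMod (e + 2) :=
  (subdivPos (e + 1) (hatLevel (e + 1) lam) κ (fun m => offset (ρ m) i) η t ε j.1.1 j.1.2 false,
    res (e + 2) (relabel i (ρ j.1.1)) j.1.2)

/-- The solid string of a node in the diagram of the subdivided multipartition. -/
def plusString (i : ZMod (e + 1)) (ρ : Fin ℓ → ZMod (e + 1)) (κ : Fin ℓ → ℤ)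
    (lamPlus : Fin ℓ → YoungDiagram) (ε η' : ℝ)
    (j : {j : Fin ℓ × (ℕ × ℕ) // j.2 ∈ lamPlus j.1}) : ℝ × ZMod (e + 2) :=
  (plusPos (e + 1) (hatLevel (e + 2) lamPlus) κ (fun m => offset (ρ m) i) ε η' j.1.1 j.1.2 false,
    res (e + 2) (relabel i (ρ j.1.1)) j.1.2)

theorem mem_solid_idem_plus {s : ℝ × ZMod (e + 2)} :
    s ∈ (idem (subdivShift i ε fun _ => 1) κ (fun m => relabel i (ρ m)) η' lamPlus).solid ↔
      ∃ j, plusString i ρ κ lamPlus ε η' j = s := by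
  have key : ∀ m (B : ℕ × ℕ), ((κ m : ℝ) + pathShift (subdivShift i ε fun _ => 1) (relabel i (ρ m))
        (content B) - ((m : ℝ) + 1) / (hatLevel (e + 2) lamPlus : ℝ)
        - ((B.2 : ℝ) + (B.1 : ℝ) + 2) * η')
      = plusPos (e + 1) (hatLevel (e + 2) lamPlus) κ (fun m => offset (ρ m) i) ε η' m B false := by
    intro m B
    have h : (height B : ℝ) = (B.2 : ℝ) + (B.1 : ℝ) + 2 := by exact_mod_cast height_eq B
    rw [pathShift_subdivShift, ← h]
    unfold plusPos
    push_cast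
    simp only [Bool.toNat_false, Nat.cast_zero, add_zero]
    ring
  rw [mem_solid_idem]
  simp only [key]
  constructor
  · rintro ⟨m, B, hB, rfl⟩; exact ⟨⟨(m, B), hB⟩, rfl⟩
  · rintro ⟨⟨⟨m, B⟩, hB⟩, rfl⟩; exact ⟨m, B, hB, rfl⟩

/-- Boxes of old content correspond to the relabelled strings, boxes `B` of new content to the
strings inserted for the `i`-nodes `collapse B`. -/
theorem mem_solid_subdivide (hp : (1 : ZMod (e + 1)) ≠ 0) (hη : 0 < η) (hηδ : η ≤ δ)
    (h1 : 2 * (size lam : ℝ) * hatLevel (e + 1) lam * η < 1)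
    (hδ : 2 * (hatLevel (e + 1) lam : ℝ) * δ ≤ 1)
    (hmem : ∀ m A, A ∈ lamPlus m ↔ collapse (e + 1) (offset (ρ m) i) A ∈ lam m)
    {s : ℝ × ZMod (e + 2)} :
    s ∈ (subdivide i δ t ε (idem (fun _ => 1) κ ρ η lam)).solid ↔
      ∃ j, subdivString i ρ κ lam lamPlus η t ε j = s := by
  have hghost : ∀ s : ℝ × ZMod (e + 1), (idem (fun _ => 1) κ ρ η lam).ghost s = s.1 + 1 :=
    fun s => rfl
  have hnonneg : ∀ m (x : ℤ), 0 ≤ oldContent (e + 1) (offset (ρ m) i) x ↔ 0 ≤ x := fun m x =>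
    oldContent_nonneg_iff (offset_nonneg _ _) (offset_lt _ _) x
  have hcc : ∀ m B, content (collapse (e + 1) (offset (ρ m) i) B)
      = oldContent (e + 1) (offset (ρ m) i) (content B) := fun m B => by simp [collapse]
  have hgoal : ∀ m B, IsNew (e + 1) (offset (ρ m) i) (content B) →
      ((if 0 ≤ content B
        then (gridPos (hatLevel (e + 1) lam) η m
          (κ m + content (collapse (e + 1) (offset (ρ m) i) B))
          (collapse (e + 1) (offset (ρ m) i) B) + 1 - t, newVertex i)
        else (gridPos (hatLevel (e + 1) lam) η m
          (κ m + content (collapse (e + 1) (offset (ρ m) i) B))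
          (collapse (e + 1) (offset (ρ m) i) B) + 1 + t, newVertex i)) : ℝ × ZMod (e + 2))
      = (subdivPos (e + 1) (hatLevel (e + 1) lam) κ (fun m => offset (ρ m) i) η t ε m B false,
          res (e + 2) (relabel i (ρ m)) B) := by
    intro m B hB
    rw [subdivPos_of_isNew (a := fun m => offset (ρ m) i) hB, (res_eq_newVertex_iff i (ρ m) B).2 hB]
    split_ifs
    · rw [sub_eq_add_neg]
    · rfl
  have hres : ∀ m B, IsNew (e + 1) (offset (ρ m) i) (content B) →
      res (e + 1) (ρ m) (collapse (e + 1) (offset (ρ m) i) B) = i := by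
    intro m B hB
    rw [res_eq_iff, hcc]
    exact (dvd_oldContent_of_isNew (by omega) hB).1
  have hnode : ∀ m A, A ∈ lam m → res (e + 1) (ρ m) A = i → ∃ B, B ∈ lamPlus m ∧
      IsNew (e + 1) (offset (ρ m) i) (content B) ∧ collapse (e + 1) (offset (ρ m) i) B = A := by
    intro m A hA h
    rw [res_eq_iff] at h
    have hc : collapse (e + 1) (offset (ρ m) i)
        (node (depth A) (newContent (e + 1) (offset (ρ m) i) (content A) + 1)) = A := by
      rw [collapse, depth_node, content_node, oldContent_newContent_succ (by omega) h,
        node_depth_content]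
    refine ⟨_, (hmem m _).2 ?_, ?_, hc⟩
    · rwa [hc]
    · rw [content_node, isNew_newContent_succ (by omega)]; exact h
  simp only [subdivide, Finset.mem_union, Finset.mem_image, Finset.mem_filter,
    mem_solid_idem_one, hghost]
  constructor
  · rintro ((⟨_, ⟨m, A, hA, rfl⟩, rfl⟩ | ⟨_, ⟨⟨m, A, hA, rfl⟩, h⟩, rfl⟩) |
      ⟨_, ⟨⟨m, A, hA, rfl⟩, h⟩, rfl⟩)
    · have hc : collapse (e + 1) (offset (ρ m) i)
          (node (depth A) (newContent (e + 1) (offset (ρ m) i) (content A))) = A := by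
        rw [collapse, depth_node, content_node, oldContent_newContent (by omega),
          node_depth_content]
      have hn : ¬ IsNew (e + 1) (offset (ρ m) i)
          (content (node (depth A) (newContent (e + 1) (offset (ρ m) i) (content A)))) := by
        rw [content_node]; exact not_isNew_newContent (by omega) _
      refine ⟨⟨(m, node (depth A) (newContent (e + 1) (offset (ρ m) i) (content A))),
        (hmem m _).2 (by rwa [hc])⟩, ?_⟩
      simp only [subdivString]
      rw [subdivPos_of_not_isNew (a := fun m => offset (ρ m) i) hn, res_relabel i (ρ m) hn, hc]
    · rw [inTupleFrom_iff hp hη hηδ h1 hδ hA] at h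
      obtain ⟨B, hB, hn, rfl⟩ := hnode m A hA h.1
      have hpos : 0 ≤ content B := by
        by_contra h0
        rw [hcc, if_neg (fun h' => h0 ((hnonneg _ _).1 h'))] at h
        exact Kind.noConfusion h.2
      refine ⟨⟨(m, B), hB⟩, ?_⟩
      have := hgoal m B hn
      rw [if_pos hpos] at this
      exact this.symm
    · rw [inTupleFrom_iff hp hη hηδ h1 hδ hA] at h
      obtain ⟨B, hB, hn, rfl⟩ := hnode m A hA h.1
      have hneg : ¬ 0 ≤ content B := by
        intro h0
        rw [hcc, if_pos ((hnonneg _ _).2 h0)] at h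
        exact Kind.noConfusion h.2
      refine ⟨⟨(m, B), hB⟩, ?_⟩
      have := hgoal m B hn
      rw [if_neg hneg] at this
      exact this.symm
  · rintro ⟨⟨⟨m, B⟩, hB⟩, rfl⟩
    have hA := (hmem m B).1 hB
    by_cases hn : IsNew (e + 1) (offset (ρ m) i) (content B)
    · have := hgoal m B hn
      rcases le_or_gt 0 (content B) with h0 | h0
      · rw [if_pos h0] at this
        refine Or.inl (Or.inr ⟨_, ⟨⟨m, _, hA, rfl⟩, ?_⟩, this⟩)
        rw [inTupleFrom_iff hp hη hηδ h1 hδ hA, hcc, if_pos ((hnonneg _ _).2 h0)]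
        exact ⟨hres m B hn, rfl⟩
      · rw [if_neg h0.not_ge] at this
        refine Or.inr ⟨_, ⟨⟨m, _, hA, rfl⟩, ?_⟩, this⟩
        rw [inTupleFrom_iff hp hη hηδ h1 hδ hA, hcc,
          if_neg (fun h' => h0.not_ge ((hnonneg _ _).1 h'))]
        exact ⟨hres m B hn, rfl⟩
    · refine Or.inl (Or.inl ⟨_, ⟨m, _, hA, rfl⟩, ?_⟩)
      simp only [subdivString]
      rw [subdivPos_of_not_isNew (a := fun m => offset (ρ m) i) hn, res_relabel i (ρ m) hn]

/-- Old strings and their ghosts keep their places, so a coincidence would persist after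
subdivision. -/
theorem IsLoading.of_subdivide {Y : IdemDiagram (e + 1) ℓ} (hshift : ∀ j, Y.shift j = 1)
    (h : (subdivide i δ t ε Y).IsLoading) : Y.IsLoading := by
  have hmem : ∀ s ∈ Y.solid, (s.1, relabel i s.2) ∈ (subdivide i δ t ε Y).solid := by
    intro s hs
    exact Finset.mem_union_left _ (Finset.mem_union_left _ (Finset.mem_image_of_mem _ hs))
  have hghost : ∀ s, (subdivide i δ t ε Y).ghost (s.1, relabel i s.2) = Y.ghost s := by
    intro s
    have hs : Y.shift = fun _ => 1 := funext hshift
    unfold IdemDiagram.ghost subdivide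
    simp only [hs, subdivShift_one, if_neg (relabel_ne_newVertex i s.2)]
  have hinj : ∀ s s' : ℝ × ZMod (e + 1), (s.1, relabel i s.2) = (s'.1, relabel i s'.2) → s = s' := by
    intro s s' h
    rw [Prod.mk.injEq] at h
    exact Prod.ext h.1 (relabel_injective i h.2)
  obtain ⟨-, h2, h3, h4, h5, h6⟩ := h
  refine ⟨fun j => by rw [hshift]; exact one_ne_zero, h2, ?_, ?_, ?_, ?_⟩
  · intro s hs s' hs' heq
    exact hinj _ _ (h3 _ (hmem s hs) _ (hmem s' hs') heq)
  · intro s hs s' hs' heq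
    exact hinj _ _ (h4 _ (hmem s hs) _ (hmem s' hs') (by rw [hghost, hghost, heq]))
  · intro s hs s' hs' heq
    exact h5 _ (hmem s hs) _ (hmem s' hs') (by rw [hghost, heq])
  · intro s hs m
    have := h6 _ (hmem s hs) m
    rw [hghost] at this
    exact this

theorem subdivide_idem_isLoading (hp : (1 : ZMod (e + 1)) ≠ 0)
    (H : Params (e + 1) ℓ lam lamPlus (fun m => offset (ρ m) i) η t ε η') (hκ : StrictMono κ)
    (hηδ : η ≤ δ) (hδ : 2 * (hatLevel (e + 1) lam : ℝ) * δ ≤ 1) :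
    (subdivide i δ t ε (idem (fun _ => 1) κ ρ η lam)).IsLoading := by
  classical
  refine isLoading_of_index _ (subdivString i ρ κ lam lamPlus η t ε)
    (fun s => mem_solid_subdivide hp H.η_pos hηδ H.η_lt hδ H.mem_iff) ?_ ?_
    (fun j g => subdivPos (e + 1) (hatLevel (e + 1) lam) κ (fun m => offset (ρ m) i) η t ε
      j.1.1 j.1.2 g) (fun j => rfl) ?_ ?_ ?_
  · intro j
    change subdivShift i ε (fun _ => 1) j ≠ 0
    rw [subdivShift_one]
    split_ifs
    · exact H.ε_pos.ne'
    · exact one_ne_zero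
  · exact fun m m' h => Int.cast_lt.2 (hκ h)
  · intro j
    change _ = _ + subdivShift i ε (fun _ => 1) _
    simp only [subdivPos_true, subdivString, subdivShift_one, res_eq_newVertex_iff]
  · rintro ⟨⟨m, B⟩, hB⟩ ⟨⟨m', B'⟩, hB'⟩ g g' h
    obtain ⟨rfl, rfl, rfl⟩ := H.subdivPos_inj hB hB' h
    exact ⟨rfl, rfl⟩
  · rintro ⟨⟨m, B⟩, hB⟩ g m'
    change subdivPos _ _ κ _ _ _ _ _ _ _ ≠ (κ m' : ℝ)
    rcases H.sameSign_red hB (κ := κ) (g := g) m' with ⟨h, -⟩ | ⟨h, -⟩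
    · exact (sub_pos.1 h).ne'
    · exact (sub_neg.1 h).ne

theorem idem_plus_isLoading (H : Params (e + 1) ℓ lam lamPlus (fun m => offset (ρ m) i) η t ε η')
    (hκ : StrictMono κ) :
    (idem (subdivShift i ε fun _ => 1) κ (fun m => relabel i (ρ m)) η' lamPlus).IsLoading := by
  classical
  refine isLoading_of_index _ (plusString i ρ κ lamPlus ε η')
    (fun s => mem_solid_idem_plus) ?_ ?_
    (fun j g => plusPos (e + 1) (hatLevel (e + 2) lamPlus) κ (fun m => offset (ρ m) i) ε η'
      j.1.1 j.1.2 g) (fun j => rfl) ?_ ?_ ?_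
  · intro j
    change subdivShift i ε (fun _ => 1) j ≠ 0
    rw [subdivShift_one]
    split_ifs
    · exact H.ε_pos.ne'
    · exact one_ne_zero
  · exact fun m m' h => Int.cast_lt.2 (hκ h)
  · intro j
    change _ = _ + subdivShift i ε (fun _ => 1) _
    simp only [plusPos_true, plusString, subdivShift_one, res_eq_newVertex_iff]
  · rintro ⟨⟨m, B⟩, hB⟩ ⟨⟨m', B'⟩, hB'⟩ g g' h
    obtain ⟨rfl, rfl, rfl⟩ := H.plusPos_inj hB hB' h
    exact ⟨rfl, rfl⟩
  · rintro ⟨⟨m, B⟩, hB⟩ g m'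
    change plusPos _ _ κ _ _ _ _ _ _ ≠ (κ m' : ℝ)
    rcases H.sameSign_red hB (κ := κ) (g := g) m' with ⟨-, h⟩ | ⟨-, h⟩
    · exact (sub_pos.1 h).ne'
    · exact (sub_neg.1 h).ne

theorem subdivide_idem_pullEq (hp : (1 : ZMod (e + 1)) ≠ 0)
    (H : Params (e + 1) ℓ lam lamPlus (fun m => offset (ρ m) i) η t ε η')
    (hηδ : η ≤ δ) (hδ : 2 * (hatLevel (e + 1) lam : ℝ) * δ ≤ 1) :
    (subdivide i δ t ε (idem (fun _ => 1) κ ρ η lam)).PullEq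
      (idem (subdivShift i ε fun _ => 1) κ (fun m => relabel i (ρ m)) η' lamPlus) := by
  classical
  -- Blocking pairs are those with residues equal (`g = false`) or, for a ghost and a solid string,
  -- consecutive (`g = true`).
  have hdvd : ∀ (m : Fin ℓ) (B B' : ℕ × ℕ) (g : Bool),
      res (e + 2) (relabel i (ρ m)) B' = res (e + 2) (relabel i (ρ m)) B + (g.toNat : ZMod (e + 2)) →
      (((e + 1 : ℕ) : ℤ) + 1) ∣ content B + g.toNat - content B' := by
    intro m B B' g h
    have h1 : (((e + 1 : ℕ) : ℤ) + 1) = ((e + 2 : ℕ) : ℤ) := by push_cast; ring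
    rw [h1, ← ZMod.intCast_zmod_eq_zero_iff_dvd]
    rw [res_eq, res_eq] at h
    push_cast
    linear_combination -h
  have hghostY : ∀ j, (subdivide i δ t ε (idem (fun _ => 1) κ ρ η lam)).ghost
      (subdivString i ρ κ lam lamPlus η t ε j) = subdivPos (e + 1) (hatLevel (e + 1) lam) κ
        (fun m => offset (ρ m) i) η t ε j.1.1 j.1.2 true := by
    intro j
    change _ + subdivShift i ε (fun _ => 1) _ = _
    simp only [subdivPos_true, subdivString, subdivShift_one, res_eq_newVertex_iff]
  have hghostZ : ∀ j, (idem (subdivShift i ε fun _ => 1) κ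
      (fun m => relabel i (ρ m)) η' lamPlus).ghost (plusString i ρ κ lamPlus ε η' j)
      = plusPos (e + 1) (hatLevel (e + 2) lamPlus) κ (fun m => offset (ρ m) i) ε η'
        j.1.1 j.1.2 true := by
    intro j
    change _ + subdivShift i ε (fun _ => 1) _ = _
    simp only [plusPos_true, plusString, subdivShift_one, res_eq_newVertex_iff]
  refine pullEq_of_index _ _ (subdivString i ρ κ lam lamPlus η t ε)
    (plusString i ρ κ lamPlus ε η') rfl rfl rfl
    (fun s => mem_solid_subdivide hp H.η_pos hηδ H.η_lt hδ H.mem_iff)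
    (fun s => mem_solid_idem_plus) ?_ ?_ (fun j => rfl) ?_ ?_ ?_
  · rintro ⟨⟨m, B⟩, hB⟩ ⟨⟨m', B'⟩, hB'⟩ h
    obtain ⟨rfl, rfl, -⟩ := H.subdivPos_inj hB hB' (congrArg Prod.fst h)
    rfl
  · rintro ⟨⟨m, B⟩, hB⟩ ⟨⟨m', B'⟩, hB'⟩ h
    obtain ⟨rfl, rfl, -⟩ := H.plusPos_inj hB hB' (congrArg Prod.fst h)
    rfl
  · rintro ⟨⟨m, B⟩, hB⟩ ⟨⟨m', B'⟩, hB'⟩ hne hres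
    refine H.sameSign (g := false) hB hB' ?_ ?_
    · rintro ⟨rfl, rfl, -⟩; exact hne rfl
    · rintro rfl
      exact hdvd m B B' false (by simpa [subdivString] using hres.symm)
  · rintro ⟨⟨m, B⟩, hB⟩ ⟨⟨m', B'⟩, hB'⟩ hres
    rw [hghostY, hghostZ]
    refine H.sameSign (g := true) hB hB' ?_ ?_
    · rintro ⟨-, -, h⟩; exact Bool.noConfusion h
    · rintro rfl
      exact hdvd m B B' true (by simpa [subdivString] using hres)
  · rintro ⟨⟨m, B⟩, hB⟩ m' -
    exact H.sameSign_red hB m'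

end

end Subdiv

end

/-! ### The main theorem -/

theorem mainTheorem7 (e : ℕ) (he : 1 ≤ e) (i : ZMod (e + 1)) (ℓ : ℕ)
    (lam : Fin ℓ → YoungDiagram) (ρ : Fin ℓ → ZMod (e + 1)) :
    ∃ lamPlus : Fin ℓ → YoungDiagram,
      -- the box definition gives the boxes of an `ℓ`-partition
      (∀ m, (lamPlus m).cells = Subdiv.boxPlus (e + 1) (lam m) (ρ m) i) ∧
      -- abacus definition: new runner between the runners `i - 1` and `i` of `Ab(λ, ρ)`
      (∀ m, ∀ N : ℤ, N < 0 → (Subdiv.len (lam m) : ℤ) ≤ (ρ m).val - N * (e + 1) →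
        ∀ ν : YoungDiagram,
          Subdiv.Represents (e + 2) N
            (Subdiv.insertRunner (e + 1) i.val N
              (Subdiv.kCount (e + 1) (lam m) ((ρ m).val - i.val)
                + Subdiv.N0 (e + 1) (lam m) (ρ m).val - N
                + (if (i.val : ℤ) ≤ (((ρ m).val : ℤ) - Subdiv.len (lam m)) % ((e : ℤ) + 1)
                    then 1 else 0))
              (Subdiv.abacus (e + 1) (lam m) (ρ m).val N)) ν
          ↔ ν = lamPlus m) ∧
      -- abacus definition after relabelling: new leftmost runner of `Ab(λ, ρ')`, `ρ' = ρ - i`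
      (∀ m, ∀ N : ℤ, N < 0 → (Subdiv.len (lam m) : ℤ) ≤ (ρ m - i).val - N * (e + 1) →
        ∀ ν : YoungDiagram,
          Subdiv.Represents (e + 2) N
            (Subdiv.insertRunner (e + 1) 0 N
              (Subdiv.kCount (e + 1) (lam m) (ρ m - i).val
                + Subdiv.N0 (e + 1) (lam m) (ρ m - i).val - N + 1)
              (Subdiv.abacus (e + 1) (lam m) (ρ m - i).val N)) ν
          ↔ ν = lamPlus m) ∧
      -- the subdivision of the idempotent of `λ` is the idempotent of `λ⁺`
      (∀ κ : Fin ℓ → ℤ, StrictMono κ →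
        ∀ η δ t ε η' : ℝ,
          0 < η → 2 * (Subdiv.size lam : ℝ) * Subdiv.hatLevel (e + 1) lam * η < 1 →
          η ≤ δ → 2 * (Subdiv.hatLevel (e + 1) lam : ℝ) * δ ≤ 1 →
          0 < t → 0 < ε → t ≠ ε → t + ε < η →
          0 < η' →
          2 * (Subdiv.size lamPlus : ℝ) * Subdiv.hatLevel (e + 2) lamPlus * η' < ε →
          (Subdiv.idem (fun _ => 1) κ ρ η lam).IsLoading ∧
          (Subdiv.subdivide i δ t ε (Subdiv.idem (fun _ => 1) κ ρ η lam)).IsLoading ∧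
          (Subdiv.idem (Subdiv.subdivShift i ε fun _ => 1) κ
            (fun m => Subdiv.relabel i (ρ m)) η' lamPlus).IsLoading ∧
          (Subdiv.subdivide i δ t ε (Subdiv.idem (fun _ => 1) κ ρ η lam)).PullEq
            (Subdiv.idem (Subdiv.subdivShift i ε fun _ => 1) κ
              (fun m => Subdiv.relabel i (ρ m)) η' lamPlus)) := by
  have hp : (1 : ZMod (e + 1)) ≠ 0 := by
    have : Fact (1 < e + 1) := ⟨by omega⟩
    exact one_ne_zero
  have hmem : ∀ m A, A ∈ Subdiv.plus (e + 1) hp (lam m) (ρ m) i ↔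
      Subdiv.collapse (e + 1) (Subdiv.offset (ρ m) i) A ∈ lam m := fun m A =>
    Subdiv.mem_plus_iff hp
  refine ⟨fun m => Subdiv.plus (e + 1) hp (lam m) (ρ m) i, fun m => rfl, ?_, ?_, ?_⟩
  · intro m N _ hN ν
    have hR : ((e + 1 : ℕ) : ℤ) ∣ ((ρ m).val : ℤ) + Subdiv.offset (ρ m) i - (i.val : ℤ) := by
      rw [← ZMod.intCast_zmod_eq_zero_iff_dvd]
      simp [Subdiv.offset]
    have h := Subdiv.represents_insertRunner_iff (by omega) (Subdiv.offset_nonneg (ρ m) i)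
      (Subdiv.offset_lt (ρ m) i) (hmem m) (ZMod.val_lt i) hR (N := N) (by push_cast; exact hN) ν
    rw [Nat.cast_add_one e] at h
    exact h
  · intro m N _ hN ν
    have hR : ((e + 1 : ℕ) : ℤ) ∣ ((ρ m - i).val : ℤ) + Subdiv.offset (ρ m) i - ((0 : ℕ) : ℤ) := by
      rw [← ZMod.intCast_zmod_eq_zero_iff_dvd]
      simp [Subdiv.offset]
    have h := Subdiv.represents_insertRunner_iff (by omega) (Subdiv.offset_nonneg (ρ m) i)
      (Subdiv.offset_lt (ρ m) i) (hmem m) (Nat.succ_pos e) hR (N := N) (by push_cast; exact hN) ν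
    -- For the leftmost runner every position is on a runner numbered at least `0`, so the
    -- correction is always `1`.
    rw [Nat.cast_zero, sub_zero, if_pos (Int.emod_nonneg _ (by omega))] at h
    exact h
  · intro κ hκ η δ t ε η' h1 h2 h3 h4 h5 h6 h7 h8 h9 h10
    have hsize : Subdiv.size (fun m => Subdiv.plus (e + 1) hp (lam m) (ρ m) i)
        ≤ 2 * Subdiv.size lam := by
      unfold Subdiv.size
      rw [Finset.mul_sum]
      exact Finset.sum_le_sum fun m _ => Subdiv.card_plus_le hp _ _ _
    have H : Subdiv.Params (e + 1) ℓ lam (fun m => Subdiv.plus (e + 1) hp (lam m) (ρ m) i)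
        (fun m => Subdiv.offset (ρ m) i) η t ε η' :=
      ⟨by omega, fun m => Subdiv.offset_nonneg _ _, fun m => Subdiv.offset_lt _ _, hmem, hsize,
        h1, h2, h5, h6, h7, h8, h9, h10⟩
    have hload := Subdiv.subdivide_idem_isLoading hp H hκ h3 h4
    exact ⟨Subdiv.IsLoading.of_subdivide (fun _ => rfl) hload, hload,
      Subdiv.idem_plus_isLoading H hκ, Subdiv.subdivide_idem_pullEq hp H h3 h4⟩
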